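/- Let $\mathbb H^2$ be the hyperbolic plane, $\overline{\mathbb H}^2=\mathbb H^2\cup S^1_\infty$ the hyperbolic plane with its circle at infinity, and $\widetilde{PSL_2\mathbb R}$ the universal covering group of $PSL_2\mathbb R=\mathrm{Isom}^+(\mathbb H^2)$. A path $V:[0,1]\to UT\mathbb H^2$ of unit tangent vectors determines an element of $\widetilde{PSL_2\mathbb R}$, namely the homotopy class of the path $t\mapsto g_t$ in $PSL_2\mathbb R$, where $g_t$ is the isometry carrying $V(0)$ to $V(t)$. For $\tilde\alpha\in\widetilde{PSL_2\mathbb R}$ with image $\alpha\in PSL_2\mathbb R$ and $y\in\mathbb H^2$, the twist $\mathrm{Twist}(\tilde\alpha,y)\in\mathbb R$ is defined as follows: let $c:[0,1]\to\mathbb H^2$ be the constant speed geodesic from $y$ to $\alpha y$ and let $V$ be a unit vector field along $c$ in the class $\tilde\alpha$; then $\mathrm{Twist}(\tilde\alpha,y)$ is the total variation $\theta(1)-\theta(0)$ of the continuous anticlockwise angle $\theta(t)$ from the velocity direction of $c$ to $V(t)$ (if $c$ is constant, from a fixed direction). For $y\in S^1_\infty$, $\mathrm{Twist}(\tilde\alpha,y)$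 is the limit of $\mathrm{Twist}(\tilde\alpha,x)$ as $x\to y$ along any geodesic ending at $y$. Let $g,n\ge 0$, let $\tilde\alpha_1,\tilde\beta_1,\dots,\tilde\alpha_g,\tilde\beta_g,\tilde\gamma_1,\dots,\tilde\gamma_n\in\widetilde{PSL_2\mathbb R}$ with images $\alpha_i,\beta_i,\gamma_j\in PSL_2\mathbb R$, let $p\in\overline{\mathbb H}^2$, and write $[a,b]=aba^{-1}b^{-1}$. For $1\le i\le g$ put $$q_i=[\alpha_{i+1},\beta_{i+1}]\cdots[\alpha_g,\beta_g]\,\gamma_1\cdots\gamma_n\,p .$$ Let $\mathcal D(\boldsymbol\alpha,\boldsymbol\beta,\boldsymbol\gamma;p)$ be the closed geodesic polygon whose $4g+n+1$ vertices are, in order along the oriented boundary: first $p$; then, for $i=1,\dots,g$ successively, $$[\alpha_i,\beta_i]q_i\;\to\;\beta_i^{-1}q_i\;\to\;\alpha_i^{-1}\beta_i^{-1}q_i\;\to\;\beta_i\alpha_i^{-1}\beta_i^{-1}q_i ;$$ then $$\gamma_1\gamma_2\cdots\gamma_n p\;\to\;\gamma_2\cdots\gamma_n p\;\to\;\cdots\;\to\;\gamma_n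 p ,$$ and finally back to $p$. **Theorem.** Suppose that $\mathcal D(\boldsymbol\alpha,\boldsymbol\beta,\boldsymbol\gamma;p)$ is a convex polygon, i.e. its vertices go once around the boundary of their geodesic convex hull in one direction: either no three vertices, taken in the order of the list, form a nondegenerate clockwise triangle, or no three form a nondegenerate anticlockwise triangle. (Successive vertices may coincide, angles equal to $\pi$ are allowed, and the polygon may be degenerate.) Then $$\mathrm{Twist}\bigl([\tilde\alpha_1,\tilde\beta_1]\cdots[\tilde\alpha_g,\tilde\beta_g]\,\tilde\gamma_1\cdots\tilde\gamma_n,\;p\bigr)=\sum_{j=1}^n\mathrm{Twist}\bigl(\tilde\gamma_j,\;\gamma_{j+1}\gamma_{j+2}\cdots\gamma_n\,p\bigr)+\Delta\bigl[\mathcal D(\boldsymbol\alpha,\boldsymbol\beta,\boldsymbol\gamma;p)\bigr],$$ where $\Delta[\mathcal D]$ is the signed hyperbolic area of the region bounded by $\mathcal D$, namely the area of the convex hull of its vertices, positive if the boundary is described anticlockwise and negative if clockwise. -/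

import Mathlib

open scoped MatrixGroups Topology UpperHalfPlane unitInterval commutatorElement

noncomputable section

/-! ### The universal covering group -/

/-- The group of continuous paths `[0,1] → G` issuing from `1`, under pointwise multiplication. -/
def basedPaths (G : Type*) [TopologicalSpace G] [Group G] [IsTopologicalGroup G] :
    Subgroup C(I, G) where
  carrier := {γ | γ 0 = 1}
  mul_mem' := by
    intro a b ha hb
    change a 0 = 1 at ha
    change b 0 = 1 at hb
    change a 0 * b 0 = 1
    rw [ha, hb, mul_one]
  one_mem' := by simp
  inv_mem' := by
    intro a ha
    change a 0 = 1 at ha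
    change (a 0)⁻¹ = 1
    rw [ha, inv_one]

/-- Homotopy of paths issuing from `1`, relative to the two endpoints, is compatible with the
pointwise product. -/
def homotopyCon (G : Type*) [TopologicalSpace G] [Group G] [IsTopologicalGroup G] :
    Con (basedPaths G) where
  r γ δ := ContinuousMap.HomotopicRel γ.1 δ.1 {0, 1}
  iseqv :=
    { refl := fun γ => ContinuousMap.HomotopicRel.refl γ.1
      symm := fun h => ContinuousMap.HomotopicRel.symm h
      trans := fun h₁ h₂ => ContinuousMap.HomotopicRel.trans h₁ h₂ }
  mul' := by
    rintro a b c d ⟨F⟩ ⟨H⟩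
    refine ⟨⟨⟨F.toContinuousMap * H.toContinuousMap, ?_, ?_⟩, ?_⟩⟩
    · intro x
      simp
    · intro x
      simp
    · intro t x hx
      have h1 := F.prop' t x hx
      have h2 := H.prop' t x hx
      simp only [ContinuousMap.coe_mk, ContinuousMap.toFun_eq_coe] at h1 h2
      change F (t, x) * H (t, x) = a.1 x * c.1 x
      exact congrArg₂ (· * ·) h1 h2

/-- The universal covering group of a (nice, connected) topological group `G`: homotopy classes,
relative to the endpoints, of paths in `G` issuing from `1`, multiplied pointwise. -/
abbrev UniversalCover (G : Type*) [TopologicalSpace G] [Group G] [IsTopologicalGroup G] : Type _ :=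
  (homotopyCon G).Quotient

/-- The covering homomorphism, sending the class of a path to its endpoint. -/
def UniversalCover.proj {G : Type*} [TopologicalSpace G] [Group G] [IsTopologicalGroup G] :
    UniversalCover G →* G :=
  (homotopyCon G).lift
    { toFun := fun γ => γ.1 1
      map_one' := rfl
      map_mul' := fun _ _ => rfl }
    (fun _ _ h => ContinuousMap.HomotopicRel.fst_eq_snd h (by simp))

/-- Any path `h` in `G`, whatever its starting point, determines an element of the universal
cover: the class of `t ↦ h t * (h 0)⁻¹`, which carries `h 0` to `h 1`. -/
def UniversalCover.ofPath {G : Type*} [TopologicalSpace G] [Group G] [IsTopologicalGroup G]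
    (h : C(I, G)) : UniversalCover G :=
  Con.toQuotient (c := homotopyCon G)
    ⟨h * ContinuousMap.const I (h 0)⁻¹, by
      change h 0 * (h 0)⁻¹ = 1
      exact mul_inv_cancel _⟩

/-- The universal cover of `PSL(2, ℝ)`. Since `SL(2, ℝ) → PSL(2, ℝ)` is a double covering of
connected Lie groups, it is the universal cover of `SL(2, ℝ)`. -/
abbrev PSLCover : Type := UniversalCover SL(2, ℝ)

/-! ### The closed hyperbolic plane and its geodesics -/

/-- The hyperbolic plane (upper half plane model) with the circle at infinity `ℝ ∪ {∞}`. -/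
abbrev ClosedPlane : Type := ℍ ⊕ OnePoint ℝ

/-- The action of `SL(2, ℝ)` by Möbius transformations `z ↦ (a z + b) / (c z + d)` on the closed
hyperbolic plane. -/
instance closedPlaneAction : MulAction SL(2, ℝ) ClosedPlane where
  smul g p := Sum.map (fun z => g • z) (fun x => (g : GL (Fin 2) ℝ) • x) p
  one_smul p := by
    change Sum.map _ _ p = p
    rcases p with z | x <;> simp
  mul_smul g h p := by
    change Sum.map _ _ p = Sum.map _ _ (Sum.map _ _ p)
    rcases p with z | x <;> simp [mul_smul]

/-- The universal cover acts on the closed hyperbolic plane through its projection. -/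
instance coverAction : MulAction PSLCover ClosedPlane :=
  MulAction.compHom ClosedPlane (UniversalCover.proj : PSLCover →* SL(2, ℝ))

/-- `z ↦ e^s z`: translation by `s` along the imaginary axis, upwards. -/
def translation (s : ℝ) : SL(2, ℝ) :=
  ⟨!![Real.exp (s / 2), 0; 0, Real.exp (-(s / 2))], by
    rw [Matrix.det_fin_two_of, ← Real.exp_add]; simp⟩

/-- The rotation about `i` through the angle `θ`, anticlockwise. -/
def rotationAtI (θ : ℝ) : SL(2, ℝ) :=
  ⟨!![Real.cos (θ / 2), Real.sin (θ / 2); -Real.sin (θ / 2), Real.cos (θ / 2)], by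
    rw [Matrix.det_fin_two_of]; nlinarith [Real.sin_sq_add_cos_sq (θ / 2)]⟩

/-- The oriented unit speed geodesic `s ↦ g (e^s i)`, with its two ideal endpoints at `s = ±∞`.
Every oriented geodesic, with every unit speed parametrization, is of this form. -/
def geodesic (g : SL(2, ℝ)) : EReal → ClosedPlane
  | ⊥ => g • (Sum.inr ((0 : ℝ) : OnePoint ℝ) : ClosedPlane)
  | ⊤ => g • (Sum.inr OnePoint.infty : ClosedPlane)
  | (s : ℝ) => g • (Sum.inl (translation s • UpperHalfPlane.I) : ClosedPlane)

/-! ### Twist -/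

lemma continuous_translation : Continuous translation := by
  refine Continuous.subtype_mk (continuous_matrix fun i j => ?_) _
  fin_cases i <;> fin_cases j <;> simp <;> fun_prop

lemma continuous_rotationAtI : Continuous rotationAtI := by
  refine Continuous.subtype_mk (continuous_matrix fun i j => ?_) _
  fin_cases i <;> fin_cases j <;> simp <;> fun_prop

/-- Identify the unit tangent bundle with the isometry group: `h` stands for the image under `h` of
the upward unit vector at `i`. The velocity of the geodesic `t ↦ g (e^(t d) i)`, `0 ≤ t ≤ 1`, of
constant speed `d` is then `t ↦ g * translation (t d)` (if `d = 0`, this is a constant unit vector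
at `g i`), and this is the unit vector field along that geodesic which makes the angle `θ t`,
measured anticlockwise, with the velocity. -/
def vectorField (g : SL(2, ℝ)) (d : ℝ) (θ : C(I, ℝ)) : C(I, SL(2, ℝ)) where
  toFun t := g * translation (t * d) * rotationAtI (θ t)
  continuous_toFun :=
    (continuous_const.mul (continuous_translation.comp (by fun_prop))).mul
      (continuous_rotationAtI.comp (by fun_prop))

/-- `τ` is a value of the twist of `a` at `y`: along a constant speed geodesic starting at `y` there
is a unit vector field in the homotopy class `a`, whose angle with the geodesic increases by `τ`.
(The geodesic then ends at `a y`.) -/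
def IsTwist (a : PSLCover) (y : ℍ) (τ : ℝ) : Prop :=
  ∃ (g : SL(2, ℝ)) (d : ℝ) (θ : C(I, ℝ)), 0 ≤ d ∧ g • UpperHalfPlane.I = y ∧
    UniversalCover.ofPath (vectorField g d θ) = a ∧ θ 1 - θ 0 = τ

/-- The twist of `a` at a point `y` of the hyperbolic plane: the unique `τ` with `IsTwist a y τ`. -/
def innerTwist (a : PSLCover) (y : ℍ) : ℝ :=
  Classical.epsilon (IsTwist a y)

/-- The twist of `a` at an ideal point `ξ`: the limit of the twists at points tending to `ξ` along
any geodesic ending at `ξ`. -/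
def idealTwist (a : PSLCover) (ξ : OnePoint ℝ) : ℝ :=
  Classical.epsilon fun τ : ℝ => ∀ g : SL(2, ℝ), (g : GL (Fin 2) ℝ) • OnePoint.infty = ξ →
    Filter.Tendsto (fun s : ℝ => innerTwist a (g • translation s • UpperHalfPlane.I))
      Filter.atTop (𝓝 τ)

/-- The twist of `a` at a point of the closed hyperbolic plane. -/
def twist (a : PSLCover) : ClosedPlane → ℝ :=
  Sum.elim (innerTwist a) (idealTwist a)

/-! ### Convex polygons and area -/

/-- The geodesic segment joining two points of the closed hyperbolic plane. -/
def geodesicSegment (x y : ClosedPlane) : Set ClosedPlane :=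
  {z | ∃ (g : SL(2, ℝ)) (a s b : EReal), a ≤ s ∧ s ≤ b ∧
    geodesic g a = x ∧ geodesic g s = z ∧ geodesic g b = y}

/-- Geodesic convexity in the closed hyperbolic plane. -/
def IsGeodesicallyConvex (S : Set ClosedPlane) : Prop :=
  ∀ x ∈ S, ∀ y ∈ S, geodesicSegment x y ⊆ S

/-- The geodesic convex hull. -/
def geodesicHull (S : Set ClosedPlane) : Set ClosedPlane :=
  ⋂₀ {T | S ⊆ T ∧ IsGeodesicallyConvex T}

/-- The points of the closed hyperbolic plane strictly to the right of the upward oriented imaginary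
axis. -/
def rightSide : Set ClosedPlane :=
  {p | (∃ z : ℍ, 0 < z.re ∧ p = Sum.inl z) ∨
    ∃ x : ℝ, 0 < x ∧ p = Sum.inr ((x : ℝ) : OnePoint ℝ)}

/-- `x, y, z` are the vertices of a nondegenerate geodesic triangle in clockwise order: `x ≠ y`, and
`z` lies strictly to the right of the geodesic from `x` to `y`. -/
def ClockwiseTriangle (x y z : ClosedPlane) : Prop :=
  ∃ (g : SL(2, ℝ)) (a b : EReal), a < b ∧ geodesic g a = x ∧ geodesic g b = y ∧
    g⁻¹ • z ∈ rightSide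

/-- The closed polygon with successive vertices `l` is convex and described anticlockwise: its
vertices go once around the boundary of their convex hull, anticlockwise. This says that any three
vertices, in the order in which they occur, form an anticlockwise or a degenerate triangle.
Successive vertices may coincide, angles may be equal to `π`, and the polygon may be degenerate,
with all its vertices on a geodesic. -/
def IsAnticlockwiseConvex (l : List ClosedPlane) : Prop :=
  ∀ x y z : ClosedPlane, [x, y, z].Sublist l → ¬ ClockwiseTriangle x y z

/-- The closed polygon with successive vertices `l` is convex (and described in either sense). -/
def IsConvexPolygon (l : List ClosedPlane) : Prop :=
  IsAnticlockwiseConvex l ∨ IsAnticlockwiseConvex l.reverse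

/-- The area of the region bounded by the convex polygon with vertices `l`, the geodesic convex hull
of `l`, for the hyperbolic area measure `dx dy / y ^ 2`. -/
def regionArea (l : List ClosedPlane) : ℝ :=
  MeasureTheory.volume.real {z : ℍ | (Sum.inl z : ClosedPlane) ∈ geodesicHull {p | p ∈ l}}

open Classical in
/-- The area of a convex polygon, signed by the orientation of its boundary: positive if the
boundary is described anticlockwise, and negative if clockwise (if both are the case, the polygon is
degenerate and its area is zero). -/
def signedArea (l : List ClosedPlane) : ℝ :=
  if IsAnticlockwiseConvex l then regionArea l else -regionArea l

/-! ### The polygon of a surface relator -/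

/-- `γ_{j+1} γ_{j+2} ⋯ γ_n`, for the sequence with entries `γ_{i+1} = c i`, `i < n`: the product of
all the entries of `c` but the first `j`. -/
def tailProd {n : ℕ} (c : Fin n → PSLCover) (j : ℕ) : PSLCover :=
  ((List.ofFn c).drop j).prod

/-- The vertices, along the oriented boundary, of the polygon associated with the relator
`[α₁, β₁] ⋯ [α_g, β_g] γ₁ ⋯ γ_n` at `p`. It starts at `p`. Then the `i`-th commutator contributes
`[α_i, β_i] q → β_i⁻¹ q → α_i⁻¹ β_i⁻¹ q → β_i α_i⁻¹ β_i⁻¹ q`, where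
`q = [α_{i+1}, β_{i+1}] ⋯ [α_g, β_g] γ₁ ⋯ γ_n p`, and finally come
`γ₁ ⋯ γ_n p → γ₂ ⋯ γ_n p → ⋯ → γ_n p`, which is joined to `p`. -/
def relatorPolygon {g n : ℕ} (α β : Fin g → PSLCover) (γ : Fin n → PSLCover) (p : ClosedPlane) :
    List ClosedPlane :=
  p :: ((List.ofFn fun i : Fin g =>
      let q : ClosedPlane :=
        (tailProd (fun k => ⁅α k, β k⁆) ((i : ℕ) + 1) * tailProd γ 0) • p
      [⁅α i, β i⁆ • q, (β i)⁻¹ • q, ((α i)⁻¹ * (β i)⁻¹) • q,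
        (β i * (α i)⁻¹ * (β i)⁻¹) • q]).flatten
    ++ List.ofFn fun j : Fin n => tailProd γ (j : ℕ) • p)

end

/-! The proof compares every rotation with the Euclidean directions of the upper half plane. Since
`g' = (c z + d)⁻²`, a path in the class `a` turns the Euclidean direction of a tangent vector at `y`
by `-2` times the variation of `arg (c y + d)`; this is `dirVariation a y`. Two facts govern it: it
is a cocycle in `a` (`dirVariation_mul`), and its dependence on `y` is a difference of areas,
`dirVariation a u - dirVariation a v = horArea (a u) (a v) - horArea u v` (`dirVariation_sub`). Here
`horArea u v` is the signed area of the triangle `∞, u, v`, and by Gauss-Bonnet the velocity of the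
geodesic from `u` to `v` turns by `-horArea u v`. Hence the twist is `dirVariation a y + horArea y
(a y)` (`innerTwist_eq`).

In a commutator the letters `a, a⁻¹` and `b, b⁻¹` pair off into differences of `dirVariation`, so
that only areas below `∞` of edges remain (`dirVariation_commutator`). For `p` in the hyperbolic
plane, expanding the whole relator then gives an exact identity, with no convexity: the twist of the
product is the sum of the twists of the `γ_j` plus the sum of `horArea` over the edges of the
polygon (`cycleSum_relatorWords`). As `horArea` is antisymmetric, this boundary sum is also the sum
of the signed areas of the triangles of the fan from the first vertex (`cycleSum_eq_fan`).

Convexity serves only to identify the fan sum with the area of the hull. In a linear model of the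
closed plane, geodesics are straight and orientation is the sign of a determinant; there almost
every point of the hull lies in exactly one triangle of the fan (`exists_fan_triangle`,
`chainSum_indicator`, `regionArea_eq_chainSum`). The area of a single triangle is computed by
integration (`volume_openTriangle_inl`, `volume_openTriangle_ideal`).

An ideal `p` is approached along a geodesic: the twists converge (`tendsto_idealTwist`) and the
signed areas of the triangles of the orbit converge to `0` or, in absolute value, to `π`
(`ideal_triangle`). The structure `Approximates` treats both kinds of base point together. -/

open scoped NNReal
open MeasureTheory Filter

noncomputable section

/-! ### The automorphy factor -/

/-- The automorphy factor `c z + d`. -/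
def autFactor (g : SL(2, ℝ)) (z : ℍ) : ℂ := (g 1 0 : ℂ) * z + (g 1 1 : ℂ)

lemma autFactor_re (g : SL(2, ℝ)) (z : ℍ) : (autFactor g z).re = g 1 0 * z.re + g 1 1 := by
  simp [autFactor]

lemma autFactor_im (g : SL(2, ℝ)) (z : ℍ) : (autFactor g z).im = g 1 0 * z.im := by
  simp [autFactor]

lemma sl_det (g : SL(2, ℝ)) : g 0 0 * g 1 1 - g 0 1 * g 1 0 = 1 := by
  have := g.det_coe
  rwa [Matrix.det_fin_two] at this

lemma autFactor_ne_zero (g : SL(2, ℝ)) (z : ℍ) : autFactor g z ≠ 0 := by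
  intro h
  have h1 := congrArg Complex.re h
  have h2 := congrArg Complex.im h
  rw [autFactor_re] at h1
  rw [autFactor_im] at h2
  have h3 := sl_det g
  simp only [Complex.zero_re, Complex.zero_im, mul_eq_zero, z.im_ne_zero, or_false] at h1 h2
  simp only [h2, zero_mul, zero_add] at h1
  simp [h2, h1] at h3

lemma coe_sl_smul (g : SL(2, ℝ)) (z : ℍ) :
    ((g • z : ℍ) : ℂ) = ((g 0 0 : ℂ) * z + (g 0 1 : ℂ)) / autFactor g z := by
  rw [UpperHalfPlane.coe_specialLinearGroup_apply]; rfl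

/-- The chain rule for `g' = (c z + d)⁻²`, up to the power; all cocycle relations below come from
it. -/
lemma autFactor_mul (g h : SL(2, ℝ)) (z : ℍ) :
    autFactor (g * h) z = autFactor g (h • z) * autFactor h z := by
  have h0 := autFactor_ne_zero h z
  have e : autFactor g (h • z) = (g 1 0 : ℂ) * ((h • z : ℍ) : ℂ) + (g 1 1 : ℂ) := rfl
  rw [e, coe_sl_smul]
  field_simp
  have e10 : (g * h) 1 0 = g 1 0 * h 0 0 + g 1 1 * h 1 0 := by
    simp [Matrix.mul_apply, Fin.sum_univ_two]
  have e11 : (g * h) 1 1 = g 1 0 * h 0 1 + g 1 1 * h 1 1 := by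
    simp [Matrix.mul_apply, Fin.sum_univ_two]
  rw [autFactor, e10, e11, autFactor]
  push_cast; ring

lemma autFactor_one (z : ℍ) : autFactor 1 z = 1 := by
  simp [autFactor]

lemma im_sl_smul (g : SL(2, ℝ)) (z : ℍ) : (g • z).im = z.im / Complex.normSq (autFactor g z) := by
  have h0 := autFactor_ne_zero g z
  have h1 : (g • z).im = ((g • z : ℍ) : ℂ).im := rfl
  have h3 := sl_det g
  have h2 : Complex.normSq (autFactor g z) ≠ 0 := by simpa using h0
  rw [h1, coe_sl_smul, Complex.div_im, autFactor_re, autFactor_im]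
  field_simp
  simp
  linear_combination z.im * h3

lemma re_sl_smul (g : SL(2, ℝ)) (z : ℍ) :
    (g • z).re = ((g 0 0 * z.re + g 0 1) * (g 1 0 * z.re + g 1 1) + g 0 0 * g 1 0 * z.im ^ 2) /
      Complex.normSq (autFactor g z) := by
  have h1 : (g • z).re = ((g • z : ℍ) : ℂ).re := rfl
  rw [h1, coe_sl_smul, Complex.div_re, autFactor_re, autFactor_im, ← add_div]
  simp
  ring

lemma continuous_autFactor {X : Type*} [TopologicalSpace X] {g : X → SL(2, ℝ)} {z : X → ℍ}
    (hg : Continuous g) (hz : Continuous z) : Continuous fun x => autFactor (g x) (z x) := by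
  have h (i j : Fin 2) : Continuous fun x => (g x) i j :=
    (continuous_subtype_val.comp hg).matrix_elem i j
  unfold autFactor
  exact ((Complex.continuous_ofReal.comp (h 1 0)).mul
    (UpperHalfPlane.continuous_coe.comp hz)).add (Complex.continuous_ofReal.comp (h 1 1))

lemma continuous_sl_smul {X : Type*} [TopologicalSpace X] {g : X → SL(2, ℝ)} {z : X → ℍ}
    (hg : Continuous g) (hz : Continuous z) : Continuous fun x => g x • z x := by
  have h (i j : Fin 2) : Continuous fun x => (g x) i j :=
    (continuous_subtype_val.comp hg).matrix_elem i j
  rw [UpperHalfPlane.isOpenEmbedding_coe.isInducing.continuous_iff]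
  have : (UpperHalfPlane.coe ∘ fun x => g x • z x) =
      fun x => (((g x) 0 0 : ℂ) * z x + ((g x) 0 1 : ℂ)) / autFactor (g x) (z x) := by
    funext x; exact coe_sl_smul _ _
  rw [this]
  exact (((Complex.continuous_ofReal.comp (h 0 0)).mul
    (UpperHalfPlane.continuous_coe.comp hz)).add (Complex.continuous_ofReal.comp (h 0 1))).div
    (continuous_autFactor hg hz) fun x => autFactor_ne_zero _ _

/-! ### The turning of a derivative -/

/-- The difference of the arguments of the automorphy factor at two points. -/
def turn (g : SL(2, ℝ)) (u v : ℍ) : ℝ :=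
  Complex.arg (autFactor g u) - Complex.arg (autFactor g v)

/-- As `z` runs over the upper half plane, `c z + d` stays in one open half plane bounded by the
real axis, or is constant if `c = 0`. So principal arguments differ by less than `π`, and no
multiple of `2π` can intervene. -/
lemma turn_eq_arg_div (g : SL(2, ℝ)) (u v : ℍ) :
    turn g u v = Complex.arg (autFactor g u / autFactor g v) ∧ |turn g u v| < Real.pi := by
  have hu := autFactor_ne_zero g u
  have hv := autFactor_ne_zero g v
  have key : |turn g u v| < Real.pi := by
    unfold turn
    rcases lt_trichotomy (g 1 0) 0 with hc | hc | hc
    · have hui : (autFactor g u).im < 0 := by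
        rw [autFactor_im]; exact mul_neg_of_neg_of_pos hc u.im_pos
      have hvi : (autFactor g v).im < 0 := by
        rw [autFactor_im]; exact mul_neg_of_neg_of_pos hc v.im_pos
      have h1 := Complex.arg_neg_iff.2 hui
      have h2 := Complex.arg_neg_iff.2 hvi
      have h3 := Complex.neg_pi_lt_arg (autFactor g u)
      have h4 := Complex.neg_pi_lt_arg (autFactor g v)
      rw [abs_lt]; constructor <;> linarith
    · have : autFactor g u = autFactor g v := by simp [autFactor, hc]
      rw [this]; simpa using Real.pi_pos
    · have hui : 0 < (autFactor g u).im := by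
        rw [autFactor_im]; exact mul_pos hc u.im_pos
      have hvi : 0 < (autFactor g v).im := by
        rw [autFactor_im]; exact mul_pos hc v.im_pos
      have pos {w : ℂ} (hw : 0 < w.im) : 0 < w.arg ∧ w.arg < Real.pi := by
        refine ⟨lt_of_le_of_ne (Complex.arg_nonneg_iff.2 hw.le) ?_,
          lt_of_le_of_ne (Complex.arg_le_pi w) ?_⟩
        · intro h; exact hw.ne' (Complex.arg_eq_zero_iff.1 h.symm).2
        · intro h; exact hw.ne' (Complex.arg_eq_pi_iff.1 h).2
      have h1 := pos hui
      have h2 := pos hvi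
      rw [abs_lt]; constructor <;> linarith [h1.1, h1.2, h2.1, h2.2]
  refine ⟨?_, key⟩
  have h := Complex.arg_div_coe_angle hu hv
  rw [← Real.Angle.coe_sub] at h
  have h2 := congrArg Real.Angle.toReal h
  rw [Complex.arg_coe_angle_toReal_eq_arg, Real.Angle.toReal_coe_eq_self_iff.2] at h2
  · exact h2.symm
  · rw [abs_lt] at key; exact ⟨key.1, key.2.le⟩

lemma turn_self (g : SL(2, ℝ)) (u : ℍ) : turn g u u = 0 := sub_self _

lemma autFactor_div_mem_slitPlane (g : SL(2, ℝ)) (u v : ℍ) :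
    autFactor g u / autFactor g v ∈ Complex.slitPlane := by
  obtain ⟨h1, h2⟩ := turn_eq_arg_div g u v
  rw [Complex.mem_slitPlane_iff_arg]
  refine ⟨?_, div_ne_zero (autFactor_ne_zero _ _) (autFactor_ne_zero _ _)⟩
  rw [← h1]
  exact fun h => absurd h2 (by rw [h, abs_of_pos Real.pi_pos]; exact lt_irrefl _)

lemma continuous_turn {X : Type*} [TopologicalSpace X] {g : X → SL(2, ℝ)} {u v : X → ℍ}
    (hg : Continuous g) (hu : Continuous u) (hv : Continuous v) :
    Continuous fun x => turn (g x) (u x) (v x) := by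
  simp_rw [fun x => (turn_eq_arg_div (g x) (u x) (v x)).1]
  rw [continuous_iff_continuousAt]
  intro x
  exact (Complex.continuousAt_arg (autFactor_div_mem_slitPlane _ _ _)).comp_of_eq
    (((continuous_autFactor hg hu).div (continuous_autFactor hg hv)
      fun x => autFactor_ne_zero _ _).continuousAt) rfl

/-! ### The signed area below infinity of a geodesic segment -/

/-- The signed area of the geodesic triangle with vertices `∞`, `u`, `v`. -/
def horArea (u v : ℍ) : ℝ := 2 * Real.arctan ((v.re - u.re) / (u.im + v.im))

lemma horArea_swap (u v : ℍ) : horArea v u = -horArea u v := by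
  unfold horArea
  rw [← neg_sub, neg_div, Real.arctan_neg, add_comm]; ring

lemma horArea_self (u : ℍ) : horArea u u = 0 := by simp [horArea]

/-- The half angle of the area is put in the form of an argument because `v - conj u` is multiplied
by automorphy factors when an isometry is applied to `u` and `v`. -/
lemma horArea_eq_arg (u v : ℍ) :
    horArea u v = -2 * Complex.arg (((v : ℂ) - (starRingEnd ℂ) u) / Complex.I) := by
  have h : ((v : ℂ) - (starRingEnd ℂ) u) / Complex.I =
      ((u.im + v.im : ℝ) : ℂ) + (-(v.re - u.re) : ℝ) * Complex.I := by
    rw [Complex.div_I]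
    apply Complex.ext <;> simp <;> ring
  have hp : 0 < u.im + v.im := add_pos u.im_pos v.im_pos
  rw [h, horArea]
  have : Complex.arg (((u.im + v.im : ℝ) : ℂ) + (-(v.re - u.re) : ℝ) * Complex.I) =
      Real.arctan (-(v.re - u.re) / (u.im + v.im)) := by
    rw [Real.arctan_eq_arcsin, Complex.arg_of_re_nonneg (by simp; linarith)]
    congr 1
    rw [Complex.norm_add_mul_I]
    simp only [Complex.add_im, Complex.ofReal_im, Complex.mul_im, Complex.ofReal_re, Complex.I_im,
      Complex.I_re, mul_one, mul_zero, add_zero, zero_add]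
    have e : (u.im + v.im) ^ 2 + (-(v.re - u.re)) ^ 2 =
        (u.im + v.im) ^ 2 * (1 + (-(v.re - u.re) / (u.im + v.im)) ^ 2) := by
      field_simp
    rw [e, Real.sqrt_mul (sq_nonneg _), Real.sqrt_sq hp.le]
    field_simp
  rw [this, neg_div, Real.arctan_neg]; ring

/-- The change of `horArea` under an isometry. -/
lemma horArea_smul (g : SL(2, ℝ)) (u v : ℍ) :
    horArea (g • u) (g • v) = horArea u v - 2 * turn g u v := by
  have hu := autFactor_ne_zero g u
  have hv := autFactor_ne_zero g v
  set X : ℂ := ((v : ℂ) - (starRingEnd ℂ) u) / Complex.I with hX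
  set Y : ℂ := (((g • v : ℍ) : ℂ) - (starRingEnd ℂ) ((g • u : ℍ) : ℂ)) / Complex.I with hY
  have repos (u v : ℍ) : 0 < (((v : ℂ) - (starRingEnd ℂ) u) / Complex.I).re := by
    rw [Complex.div_I]; simp; linarith [u.im_pos, v.im_pos]
  have hX0 : 0 < X.re := repos u v
  have hY0 : 0 < Y.re := repos _ _
  have hXne : X ≠ 0 := fun h => by simp [h] at hX0
  set q := autFactor g u / autFactor g v with hq
  have hqne : q ≠ 0 := div_ne_zero hu hv
  have hcu : (starRingEnd ℂ) (autFactor g u) ≠ 0 := by simpa using hu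
  have hn : 0 < Complex.normSq (autFactor g u) := Complex.normSq_pos.2 hu
  -- This is `g v - conj (g u) = (v - conj u) / (j v * conj (j u))` for the automorphy factor `j`,
  -- with `1 / conj (j u)` rewritten as `j u / |j u|²`.
  have hmul : Y = (((Complex.normSq (autFactor g u))⁻¹ : ℝ) : ℂ) * (X * q) := by
    have hdet : (g 0 0 : ℂ) * g 1 1 - g 0 1 * g 1 0 = 1 := by exact_mod_cast sl_det g
    rw [hY, hX, hq, coe_sl_smul, coe_sl_smul, Complex.ofReal_inv, Complex.normSq_eq_conj_mul_self]
    simp only [map_div₀, map_add, map_mul, Complex.conj_ofReal]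
    field_simp
    have e1 : (starRingEnd ℂ) (autFactor g u) = (g 1 0 : ℂ) * (starRingEnd ℂ) (u : ℂ) + g 1 1 := by
      simp [autFactor]
    rw [e1]
    simp only [autFactor]
    linear_combination ((v : ℂ) - (starRingEnd ℂ) (u : ℂ)) * hdet
  have hang : Y.arg = X.arg + q.arg := by
    have h1 : Y.arg = (X * q).arg := by
      rw [hmul, Complex.arg_real_mul _ (inv_pos.2 hn)]
    have h2 := Complex.arg_mul_coe_angle hXne hqne
    rw [← h1, ← Real.Angle.coe_add, Real.Angle.angle_eq_iff_two_pi_dvd_sub] at h2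
    obtain ⟨k, hk⟩ := h2
    have b1 := Complex.abs_arg_lt_pi_div_two_iff.2 (Or.inl hX0)
    have b2 := Complex.abs_arg_lt_pi_div_two_iff.2 (Or.inl hY0)
    have b3 := (turn_eq_arg_div g u v).2
    rw [(turn_eq_arg_div g u v).1, ← hq] at b3
    rw [abs_lt] at b1 b2 b3
    have hpi := Real.pi_pos
    -- The arguments of `X` and `Y` are below `π / 2` and that of `q` below `π` in absolute value,
    -- so the discrepancy is less than `2π`.
    have k0 : k = 0 := by
      have l1 : (k : ℝ) < 1 := by
        by_contra hcon; push Not at hcon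
        nlinarith [b1.1, b2.2, b3.1]
      have l2 : (-1 : ℝ) < k := by
        by_contra hcon; push Not at hcon
        nlinarith [b1.2, b2.1, b3.2]
      have l1' : k < 1 := by exact_mod_cast l1
      have l2' : -1 < k := by exact_mod_cast l2
      omega
    rw [k0] at hk
    simp at hk; linarith
  rw [horArea_eq_arg, horArea_eq_arg, (turn_eq_arg_div g u v).1, ← hX, ← hY, ← hq, hang]
  ring

/-- Three applications of `horArea_smul` give this as an equality of real numbers, without any
discussion modulo `2π`. -/
lemma turn_mul (g h : SL(2, ℝ)) (u v : ℍ) :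
    turn (g * h) u v = turn g (h • u) (h • v) + turn h u v := by
  have h1 := horArea_smul (g * h) u v
  have h2 := horArea_smul g (h • u) (h • v)
  have h3 := horArea_smul h u v
  rw [mul_smul, mul_smul] at h1
  linarith

lemma turn_add (g : SL(2, ℝ)) (u v w : ℍ) : turn g u v + turn g v w = turn g u w := by
  unfold turn; ring

/-- The signed area of a geodesic triangle. -/
def triArea (u v w : ℍ) : ℝ := horArea u v + horArea v w + horArea w u

/-- The corrections `turn` of the three sides telescope around the triangle. -/
lemma triArea_smul (g : SL(2, ℝ)) (u v w : ℍ) :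
    triArea (g • u) (g • v) (g • w) = triArea u v w := by
  simp only [triArea, horArea_smul, turn]; ring

/-! ### The rotation of an element of the universal cover at a point -/

/-- The automorphy factor at `i` along a path. -/
def autPath (γ : C(I, SL(2, ℝ))) : C(I, {z : ℂ // z ≠ 0}) where
  toFun t := ⟨autFactor (γ t) UpperHalfPlane.I, autFactor_ne_zero _ _⟩
  continuous_toFun := (continuous_autFactor γ.continuous continuous_const).subtype_mk _

/-- The automorphy factor at `i` as a continuous map. -/
def autMap : C(SL(2, ℝ), {z : ℂ // z ≠ 0}) where
  toFun g := ⟨autFactor g UpperHalfPlane.I, autFactor_ne_zero _ _⟩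
  continuous_toFun := (continuous_autFactor continuous_id continuous_const).subtype_mk _

lemma autPath_zero (γ : basedPaths SL(2, ℝ)) :
    autPath γ.1 0 = ⟨Complex.exp 0, Complex.exp_ne_zero 0⟩ := by
  have h : γ.1 0 = 1 := γ.2
  apply Subtype.ext
  change autFactor (γ.1 0) _ = _
  rw [h, autFactor_one]
  exact Complex.exp_zero.symm

/-- The total variation of the argument of the automorphy factor at `i`. -/
def argVariation (a : PSLCover) : ℝ :=
  Con.liftOn a (fun γ => (Complex.isCoveringMap_exp.liftPath (autPath γ.1) 0 (autPath_zero γ) 1).im)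
    (fun γ δ h => by
      have h' : ContinuousMap.HomotopicRel γ.1 δ.1 {0, 1} := h
      have h2 : ContinuousMap.HomotopicRel (autPath γ.1) (autPath δ.1) {0, 1} :=
        h'.map fun H => H.compContinuousMap autMap
      rw [Complex.isCoveringMap_exp.liftPath_apply_one_eq_of_homotopicRel h2 0])

lemma exists_mk_eq (a : PSLCover) : ∃ γ : basedPaths SL(2, ℝ), (γ : PSLCover) = a :=
  Con.induction_on a fun γ => ⟨γ, rfl⟩

/-- A continuous determination of the argument of the automorphy factor at `i` along a path
issuing from `1`. -/
structure IsArgLift (γ : C(I, SL(2, ℝ))) (ℓ : I → ℝ) : Prop where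
  continuous : Continuous ℓ
  zero : ℓ 0 = 0
  eq : ∀ t, autFactor (γ t) UpperHalfPlane.I =
    ‖autFactor (γ t) UpperHalfPlane.I‖ * Complex.exp (ℓ t * Complex.I)

lemma IsArgLift.argVariation_eq {γ : basedPaths SL(2, ℝ)} {ℓ : I → ℝ} (h : IsArgLift γ.1 ℓ) :
    argVariation (γ : PSLCover) = ℓ 1 := by
  let L : I → ℂ := fun t => (Real.log ‖autFactor (γ.1 t) UpperHalfPlane.I‖ : ℝ) + ℓ t * Complex.I
  have hc : Continuous fun t => autFactor (γ.1 t) UpperHalfPlane.I :=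
    continuous_autFactor γ.1.continuous continuous_const
  have hL : L = Complex.isCoveringMap_exp.liftPath (autPath γ.1) 0 (autPath_zero γ) := by
    rw [Complex.isCoveringMap_exp.eq_liftPath_iff]
    refine ⟨?_, ?_, ?_⟩
    · refine (Complex.continuous_ofReal.comp (Continuous.log hc.norm fun t => ?_)).add
        ((Complex.continuous_ofReal.comp h.continuous).mul continuous_const)
      simpa using autFactor_ne_zero _ _
    · funext t
      apply Subtype.ext
      change Complex.exp (L t) = autFactor (γ.1 t) UpperHalfPlane.I
      have hp : 0 < ‖autFactor (γ.1 t) UpperHalfPlane.I‖ := norm_pos_iff.2 (autFactor_ne_zero _ _)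
      rw [Complex.exp_add, ← Complex.ofReal_exp, Real.exp_log hp]
      exact (h.eq t).symm
    · have h0 : γ.1 0 = 1 := γ.2
      simp [L, h.zero, h0, autFactor_one]
  change (Complex.isCoveringMap_exp.liftPath (autPath γ.1) 0 (autPath_zero γ) 1).im = _
  rw [← hL]
  simp [L]

lemma exists_isArgLift (γ : basedPaths SL(2, ℝ)) : ∃ ℓ, IsArgLift γ.1 ℓ := by
  let L := Complex.isCoveringMap_exp.liftPath (autPath γ.1) 0 (autPath_zero γ)
  have hz : L 0 = 0 := Complex.isCoveringMap_exp.liftPath_zero _ _ _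
  refine ⟨fun t => (L t).im, Complex.continuous_im.comp L.continuous, ?_, fun t => ?_⟩
  · simp [hz]
  · have h := congrFun (Complex.isCoveringMap_exp.liftPath_lifts _ _ (autPath_zero γ)) t
    have h2 : Complex.exp (L t) = autFactor (γ.1 t) UpperHalfPlane.I := congrArg Subtype.val h
    rw [← h2, Complex.norm_exp, Complex.ofReal_exp, ← Complex.exp_add, Complex.re_add_im]

/-! ### Determinations of the argument and the rotation cocycle. -/

lemma eq_norm_mul_exp_arg (z : ℂ) : z = ‖z‖ * Complex.exp (z.arg * Complex.I) :=
  (Complex.norm_mul_exp_arg_mul_I z).symm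

/-- The hypothesis says that `a` is some determination of the argument, not necessarily the
principal one. This form lets continuous lifts be added without wrapping around. -/
lemma polar_mul {z w : ℂ} {a b : ℝ} (hz : z = ‖z‖ * Complex.exp (a * Complex.I))
    (hw : w = ‖w‖ * Complex.exp (b * Complex.I)) :
    z * w = ‖z * w‖ * Complex.exp ((a + b : ℝ) * Complex.I) := by
  rw [norm_mul]
  conv_lhs => rw [hz, hw]
  push_cast
  rw [add_mul, Complex.exp_add]; ring

lemma polar_div {z w : ℂ} {a b : ℝ} (hz : z = ‖z‖ * Complex.exp (a * Complex.I))
    (hw : w = ‖w‖ * Complex.exp (b * Complex.I)) :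
    z / w = ‖z / w‖ * Complex.exp ((a - b : ℝ) * Complex.I) := by
  rw [norm_div]
  conv_lhs => rw [hz, hw]
  push_cast
  rw [sub_mul, Complex.exp_sub]
  field_simp

lemma polar_turn (g : SL(2, ℝ)) (u v : ℍ) : autFactor g u / autFactor g v =
    ‖autFactor g u / autFactor g v‖ * Complex.exp (turn g u v * Complex.I) := by
  rw [(turn_eq_arg_div g u v).1]; exact eq_norm_mul_exp_arg _

/-- The total variation, under a path in the class `a`, of the Euclidean direction of a tangent
vector at `y`. -/
def dirVariation (a : PSLCover) (y : ℍ) : ℝ :=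
  -2 * (argVariation a + turn (UniversalCover.proj a) y UpperHalfPlane.I)

/-- At time `t` the factor of the product at `i` involves the first path at `δ t • i` instead of at
`i`. The term `turn` makes up for this, and being continuous and `0` at time `0` it completes the
sum of two lifts to a lift of the product. -/
lemma argVariation_mul (a b : PSLCover) :
    argVariation (a * b) = argVariation a + argVariation b +
      turn (UniversalCover.proj a) (UniversalCover.proj b • UpperHalfPlane.I) UpperHalfPlane.I := by
  obtain ⟨γ, rfl⟩ := exists_mk_eq a
  obtain ⟨δ, rfl⟩ := exists_mk_eq b
  obtain ⟨ℓ, hℓ⟩ := exists_isArgLift γ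
  obtain ⟨m, hm⟩ := exists_isArgLift δ
  rw [hℓ.argVariation_eq, hm.argVariation_eq, ← Con.coe_mul]
  have key : IsArgLift (γ * δ).1
      (fun t => ℓ t + m t + turn (γ.1 t) (δ.1 t • UpperHalfPlane.I) UpperHalfPlane.I) := by
    refine ⟨?_, ?_, fun t => ?_⟩
    · exact (hℓ.continuous.add hm.continuous).add (continuous_turn γ.1.continuous
        (continuous_sl_smul δ.1.continuous continuous_const) continuous_const)
    · have h0 : δ.1 0 = 1 := δ.2
      simp [hℓ.zero, hm.zero, h0, turn_self]
    · have e : (γ * δ).1 t = γ.1 t * δ.1 t := rfl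
      have h0 := autFactor_ne_zero (γ.1 t) UpperHalfPlane.I
      have e2 : autFactor (γ.1 t * δ.1 t) UpperHalfPlane.I =
          autFactor (γ.1 t) UpperHalfPlane.I * autFactor (δ.1 t) UpperHalfPlane.I *
          (autFactor (γ.1 t) (δ.1 t • UpperHalfPlane.I) / autFactor (γ.1 t) UpperHalfPlane.I) := by
        rw [autFactor_mul]; field_simp
      rw [e, e2]
      exact polar_mul (polar_mul (hℓ.eq t) (hm.eq t)) (polar_turn _ _ _)
  rw [key.argVariation_eq]
  rfl

lemma dirVariation_mul (a b : PSLCover) (y : ℍ) :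
    dirVariation (a * b) y = dirVariation a (UniversalCover.proj b • y) + dirVariation b y := by
  have h := turn_mul (UniversalCover.proj a) (UniversalCover.proj b) y UpperHalfPlane.I
  have h2 := turn_add (UniversalCover.proj a) (UniversalCover.proj b • y)
    (UniversalCover.proj b • UpperHalfPlane.I) UpperHalfPlane.I
  rw [dirVariation, dirVariation, dirVariation, argVariation_mul, map_mul, h, ← h2]
  ring

/-- The contribution of the path cancels, leaving a quantity that depends only on the endpoint `proj
a`. This is where areas enter the formula. -/
lemma dirVariation_sub (a : PSLCover) (u v : ℍ) :
    dirVariation a u - dirVariation a v =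
      horArea (UniversalCover.proj a • u) (UniversalCover.proj a • v) - horArea u v := by
  rw [horArea_smul, dirVariation, dirVariation, ← turn_add _ u v]
  ring

/-- The rotation of the class of a path of unit vectors is the variation of their Euclidean
direction. -/
lemma dirVariation_ofPath (h : C(I, SL(2, ℝ))) (m : I → ℝ) (hm : Continuous m)
    (hp : ∀ t, autFactor (h t) UpperHalfPlane.I =
      ‖autFactor (h t) UpperHalfPlane.I‖ * Complex.exp (m t * Complex.I)) :
    dirVariation (UniversalCover.ofPath h) (h 0 • UpperHalfPlane.I) = -2 * (m 1 - m 0) := by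
  set y := h 0 • UpperHalfPlane.I with hy
  let γ : basedPaths SL(2, ℝ) :=
    ⟨h * ContinuousMap.const I (h 0)⁻¹, by
      change h 0 * (h 0)⁻¹ = 1
      exact mul_inv_cancel _⟩
  have hγ (t) : γ.1 t = h t * (h 0)⁻¹ := rfl
  -- Since `h t = γ t * h 0`, the quotient of the factors of `h t` and `h 0` at `i` is the factor of
  -- `γ t` at `y`; `turn` moves it back to `i`.
  have key : IsArgLift γ.1 (fun t => m t - m 0 + turn (γ.1 t) UpperHalfPlane.I y) := by
    refine ⟨?_, ?_, fun t => ?_⟩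
    · exact (hm.sub continuous_const).add
        (continuous_turn γ.1.continuous continuous_const continuous_const)
    · have : γ.1 0 = 1 := γ.2
      simp [this, turn, autFactor_one]
    · have h0 := autFactor_ne_zero (γ.1 t) y
      have e : h t = γ.1 t * h 0 := by rw [hγ]; group
      have e1 := autFactor_mul (γ.1 t) (h 0) UpperHalfPlane.I
      rw [← e, ← hy] at e1
      have h00 := autFactor_ne_zero (h 0) UpperHalfPlane.I
      have e2 : autFactor (γ.1 t) UpperHalfPlane.I =
          autFactor (h t) UpperHalfPlane.I / autFactor (h 0) UpperHalfPlane.I *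
          (autFactor (γ.1 t) UpperHalfPlane.I / autFactor (γ.1 t) y) := by
        rw [e1]; field_simp
      rw [e2]
      exact polar_mul (polar_div (hp t) (hp 0)) (polar_turn _ _ _)
  have e : UniversalCover.ofPath h = (γ : PSLCover) := rfl
  have e2 : UniversalCover.proj (γ : PSLCover) = γ.1 1 := rfl
  rw [dirVariation, e, key.argVariation_eq, e2, turn, turn]
  ring

/-! ### Homotopy of paths with the same end and the same rotation -/

/-- Coordinates on the universal cover. -/
def frame (z : ℍ) (φ : ℝ) : SL(2, ℝ) := z.toSL2R * rotationAtI (-2 * φ)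

lemma autFactor_rotationAtI (θ : ℝ) :
    autFactor (rotationAtI θ) UpperHalfPlane.I = Complex.exp ((-(θ / 2) : ℝ) * Complex.I) := by
  rw [Complex.exp_mul_I, ← Complex.ofReal_cos, ← Complex.ofReal_sin, Real.cos_neg, Real.sin_neg]
  have h1 : (rotationAtI θ) 1 0 = -Real.sin (θ / 2) := rfl
  have h2 : (rotationAtI θ) 1 1 = Real.cos (θ / 2) := rfl
  rw [autFactor, h1, h2]
  simp
  ring

lemma rotationAtI_smul_I (θ : ℝ) : rotationAtI θ • UpperHalfPlane.I = UpperHalfPlane.I := by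
  apply UpperHalfPlane.ext
  rw [coe_sl_smul, div_eq_iff (autFactor_ne_zero _ _)]
  have h1 : (rotationAtI θ) 1 0 = -Real.sin (θ / 2) := rfl
  have h2 : (rotationAtI θ) 1 1 = Real.cos (θ / 2) := rfl
  have h3 : (rotationAtI θ) 0 0 = Real.cos (θ / 2) := rfl
  have h4 : (rotationAtI θ) 0 1 = Real.sin (θ / 2) := rfl
  rw [autFactor, h1, h2, h3, h4]
  apply Complex.ext <;> simp [add_comm]

/-- An isometry is determined by the image of `i` and the automorphy factor. -/
lemma sl_ext_of_smul_I {g h : SL(2, ℝ)} (h1 : g • UpperHalfPlane.I = h • UpperHalfPlane.I)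
    (h2 : autFactor g UpperHalfPlane.I = autFactor h UpperHalfPlane.I) : g = h := by
  have e := congrArg UpperHalfPlane.coe h1
  rw [coe_sl_smul, coe_sl_smul, h2, div_left_inj' (autFactor_ne_zero _ _)] at e
  have a := congrArg Complex.re e
  have b := congrArg Complex.im e
  have c := congrArg Complex.re h2
  have d := congrArg Complex.im h2
  simp [autFactor] at a b c d
  ext i j
  fin_cases i <;> fin_cases j <;> simp [a, b, c, d]

lemma frame_smul_I (z : ℍ) (φ : ℝ) : frame z φ • UpperHalfPlane.I = z := by
  rw [frame, mul_smul, rotationAtI_smul_I, UpperHalfPlane.toSL2R_smul_I]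

/-- The angle `-2 φ` in `frame` is chosen so that `φ` is exactly the argument of the factor at `i`:
a rotation through `θ` has factor `e^(-iθ/2)` there. -/
lemma autFactor_frame (z : ℍ) (φ : ℝ) : autFactor (frame z φ) UpperHalfPlane.I =
    ((1 / √z.im : ℝ) : ℂ) * Complex.exp (φ * Complex.I) := by
  rw [frame, autFactor_mul, rotationAtI_smul_I, autFactor_rotationAtI]
  have h1 : z.toSL2R 1 0 = 0 := by
    rw [UpperHalfPlane.coe_toSL2R]; simp
  have h2 : z.toSL2R 1 1 = 1 / √z.im := by
    rw [UpperHalfPlane.coe_toSL2R]; simp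
  rw [autFactor, h1, h2]
  congr 1
  · simp
  · congr 3; ring

lemma eq_frame {g : SL(2, ℝ)} {φ : ℝ} (h : autFactor g UpperHalfPlane.I =
    ‖autFactor g UpperHalfPlane.I‖ * Complex.exp (φ * Complex.I)) :
    g = frame (g • UpperHalfPlane.I) φ := by
  apply sl_ext_of_smul_I
  · rw [frame_smul_I]
  · rw [autFactor_frame, im_sl_smul, h]
    congr 2
    have : 0 < ‖autFactor g UpperHalfPlane.I‖ := norm_pos_iff.2 (autFactor_ne_zero _ _)
    simp [Complex.normSq_eq_norm_sq]

lemma continuous_frame {X : Type*} [TopologicalSpace X] {z : X → ℍ} {φ : X → ℝ}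
    (hz : Continuous z) (hφ : Continuous φ) : Continuous fun x => frame (z x) (φ x) := by
  refine Continuous.mul ?_ (continuous_rotationAtI.comp (continuous_const.mul hφ))
  refine Continuous.subtype_mk (continuous_matrix fun i j => ?_) _
  have him : Continuous fun x => √(z x).im := (UpperHalfPlane.continuous_im.comp hz).sqrt
  have hre : Continuous fun x => (z x).re := UpperHalfPlane.continuous_re.comp hz
  have hne (x) : √(z x).im ≠ 0 := (Real.sqrt_pos.2 (z x).im_pos).ne'
  fin_cases i <;> fin_cases j
  · exact him
  · exact hre.div him hne
  · exact continuous_const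
  · exact continuous_const.div him hne

/-- Interpolation in the upper half plane. -/
def interp (s : I) (z w : ℍ) : ℍ :=
  ⟨⟨(1 - s) * z.re + s * w.re, (1 - s) * z.im + s * w.im⟩, by
    have h0 := s.2.1
    have h1 := s.2.2
    have hz := z.im_pos
    have hw := w.im_pos
    change 0 < (1 - (s : ℝ)) * z.im + s * w.im
    rcases h0.eq_or_lt with h | h
    · rw [← h]; simpa using hz
    · have := mul_pos h hw
      have := mul_nonneg (sub_nonneg.2 h1) hz.le
      linarith⟩

lemma interp_re (s : I) (z w : ℍ) : (interp s z w).re = (1 - s) * z.re + s * w.re := rfl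
lemma interp_im (s : I) (z w : ℍ) : (interp s z w).im = (1 - s) * z.im + s * w.im := rfl

lemma continuous_interp {X : Type*} [TopologicalSpace X] {s : X → I} {z w : X → ℍ}
    (hs : Continuous s) (hz : Continuous z) (hw : Continuous w) :
    Continuous fun x => interp (s x) (z x) (w x) := by
  rw [UpperHalfPlane.isOpenEmbedding_coe.isInducing.continuous_iff]
  have h1 : Continuous fun x => ((s x : I) : ℝ) := continuous_subtype_val.comp hs
  have h2 := UpperHalfPlane.continuous_re.comp hz
  have h3 := UpperHalfPlane.continuous_im.comp hz
  have h4 := UpperHalfPlane.continuous_re.comp hw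
  have h5 := UpperHalfPlane.continuous_im.comp hw
  have : (UpperHalfPlane.coe ∘ fun x => interp (s x) (z x) (w x)) = fun x =>
      (((1 - (s x : ℝ)) * (z x).re + s x * (w x).re : ℝ) : ℂ) +
        (((1 - (s x : ℝ)) * (z x).im + s x * (w x).im : ℝ) : ℂ) * Complex.I := by
    funext x
    apply Complex.ext
    · simp [interp]
    · simp [interp]
  rw [this]
  refine (Complex.continuous_ofReal.comp ?_).add
    ((Complex.continuous_ofReal.comp ?_).mul continuous_const)
  · exact ((continuous_const.sub h1).mul h2).add (h1.mul h4)
  · exact ((continuous_const.sub h1).mul h3).add (h1.mul h5)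

/-- A path is recorded by its orbit point in `ℍ` and a lift of its argument in `ℝ`. Both spaces are
convex in the Euclidean sense, so two paths whose coordinates agree at the ends are homotopic by
linear interpolation. Thus an endpoint and a rotation determine an element of the cover. -/
lemma cover_ext {a b : PSLCover} (h1 : UniversalCover.proj a = UniversalCover.proj b)
    (h2 : argVariation a = argVariation b) : a = b := by
  obtain ⟨γ, rfl⟩ := exists_mk_eq a
  obtain ⟨δ, rfl⟩ := exists_mk_eq b
  obtain ⟨ℓ, hℓ⟩ := exists_isArgLift γ
  obtain ⟨m, hm⟩ := exists_isArgLift δ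
  rw [hℓ.argVariation_eq, hm.argVariation_eq] at h2
  replace h1 : γ.1 1 = δ.1 1 := h1
  have hγ0 : γ.1 0 = 1 := γ.2
  have hδ0 : δ.1 0 = 1 := δ.2
  rw [Con.eq]
  change ContinuousMap.HomotopicRel γ.1 δ.1 {0, 1}
  have hγ (t) := eq_frame (hℓ.eq t)
  have hδ (t) := eq_frame (hm.eq t)
  let F : C(I × I, SL(2, ℝ)) :=
    ⟨fun p => frame (interp p.1 (γ.1 p.2 • UpperHalfPlane.I) (δ.1 p.2 • UpperHalfPlane.I))
      ((1 - p.1) * ℓ p.2 + p.1 * m p.2), by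
      have hs : Continuous fun p : I × I => ((p.1 : I) : ℝ) :=
        continuous_subtype_val.comp continuous_fst
      refine continuous_frame (continuous_interp continuous_fst
        (continuous_sl_smul (γ.1.continuous.comp continuous_snd) continuous_const)
        (continuous_sl_smul (δ.1.continuous.comp continuous_snd) continuous_const)) ?_
      exact ((continuous_const.sub hs).mul (hℓ.continuous.comp continuous_snd)).add
        (hs.mul (hm.continuous.comp continuous_snd))⟩
  have i0 (z w : ℍ) : interp 0 z w = z := by
    apply UpperHalfPlane.ext
    apply Complex.ext <;> simp [interp]
  have i1 (z w : ℍ) : interp 1 z w = w := by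
    apply UpperHalfPlane.ext
    apply Complex.ext <;> simp [interp]
  have is (s : I) (z : ℍ) : interp s z z = z := by
    apply UpperHalfPlane.ext
    apply Complex.ext <;> simp [interp] <;> ring
  refine ⟨⟨⟨F, fun t => ?_, fun t => ?_⟩, ?_⟩⟩
  · change frame (interp 0 _ _) _ = _
    rw [i0]
    conv_rhs => rw [hγ t]
    simp
  · change frame (interp 1 _ _) _ = _
    rw [i1]
    conv_rhs => rw [hδ t]
    simp
  · rintro s t ht
    change frame (interp s (γ.1 t • UpperHalfPlane.I) (δ.1 t • UpperHalfPlane.I))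
      ((1 - s) * ℓ t + s * m t) = γ.1 t
    have e1 : γ.1 t = δ.1 t := by
      rcases ht with rfl | ht
      · rw [hγ0, hδ0]
      · rw [Set.mem_singleton_iff.1 ht, h1]
    have e2 : ℓ t = m t := by
      rcases ht with rfl | ht
      · rw [hℓ.zero, hm.zero]
      · rw [Set.mem_singleton_iff.1 ht, h2]
    rw [← e1, is, ← e2]
    conv_rhs => rw [hγ t]
    congr 1; ring

/-! ### The twist at a point of the hyperbolic plane -/

lemma translation_smul_I_re (s : ℝ) : (translation s • UpperHalfPlane.I).re = 0 := by
  rw [re_sl_smul]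
  simp [translation]

lemma translation_smul_I_im (s : ℝ) : (translation s • UpperHalfPlane.I).im = Real.exp s := by
  rw [im_sl_smul, Complex.normSq_apply, autFactor_re, autFactor_im]
  simp only [translation, Matrix.SpecialLinearGroup.coe_mk, Matrix.of_apply, Matrix.cons_val',
    Matrix.cons_val_zero, Matrix.cons_val_one, Matrix.cons_val_fin_one, UpperHalfPlane.I_im,
    zero_mul, zero_add, mul_zero, add_zero, ← Real.exp_add]
  rw [one_div, ← Real.exp_neg]
  congr 1; ring

lemma translation_zero : translation 0 = 1 := by
  ext i j; fin_cases i <;> fin_cases j <;> simp [translation]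

lemma autFactor_translation (s : ℝ) (z : ℍ) :
    autFactor (translation s) z = (Real.exp (-(s / 2)) : ℝ) := by
  simp [autFactor, translation]

lemma upperHalfPlane_ext {z w : ℍ} (h1 : z.re = w.re) (h2 : z.im = w.im) : z = w :=
  UpperHalfPlane.ext (Complex.ext h1 h2)

lemma eq_translation_smul_I {z : ℍ} (h : z.re = 0) :
    z = translation (Real.log z.im) • UpperHalfPlane.I := by
  apply upperHalfPlane_ext
  · rw [h, translation_smul_I_re]
  · rw [translation_smul_I_im, Real.exp_log z.im_pos]

lemma rotationAtI_inv (θ : ℝ) : (rotationAtI θ)⁻¹ = rotationAtI (-θ) := by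
  refine inv_eq_of_mul_eq_one_right ?_
  apply sl_ext_of_smul_I
  · rw [mul_smul, rotationAtI_smul_I, rotationAtI_smul_I, one_smul]
  · rw [autFactor_mul, rotationAtI_smul_I, autFactor_rotationAtI, autFactor_rotationAtI,
      ← Complex.exp_add, autFactor_one, Complex.exp_eq_one_iff]
    exact ⟨0, by push_cast; ring⟩

/-- The rotation through `π` is `z ↦ -1 / z`, which reverses the sign of the real part; the
intermediate value theorem does the rest. -/
lemma exists_rotationAtI_smul_re_eq_zero (w : ℍ) : ∃ θ, (rotationAtI θ • w).re = 0 := by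
  have hc : Continuous fun θ : ℝ => (rotationAtI θ • w).re :=
    UpperHalfPlane.continuous_re.comp (continuous_sl_smul continuous_rotationAtI continuous_const)
  have h0 : (rotationAtI 0 • w).re = w.re := by
    have : rotationAtI 0 = 1 := by
      ext i j; fin_cases i <;> fin_cases j <;> simp [rotationAtI]
    rw [this, one_smul]
  have h1 : (rotationAtI Real.pi • w).re = -w.re / Complex.normSq (w : ℂ) := by
    rw [re_sl_smul]
    have e10 : rotationAtI Real.pi 1 0 = -1 := by simp [rotationAtI]
    have e11 : rotationAtI Real.pi 1 1 = 0 := by simp [rotationAtI]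
    have e00 : rotationAtI Real.pi 0 0 = 0 := by simp [rotationAtI]
    have e01 : rotationAtI Real.pi 0 1 = 1 := by simp [rotationAtI]
    have e : autFactor (rotationAtI Real.pi) w = -w := by simp [autFactor, e10, e11]
    rw [e, e10, e11, e00, e01, Complex.normSq_neg]; simp
  have hn : 0 < Complex.normSq (w : ℂ) := Complex.normSq_pos.2 w.ne_zero
  have hpi := Real.pi_pos.le
  rcases le_total 0 w.re with h | h
  · obtain ⟨θ, -, hθ⟩ := intermediate_value_Icc' hpi hc.continuousOn
      (show (0 : ℝ) ∈ Set.Icc _ _ from ⟨by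
        rw [h1]; exact div_nonpos_of_nonpos_of_nonneg (by linarith) hn.le, by rw [h0]; exact h⟩)
    exact ⟨θ, hθ⟩
  · obtain ⟨θ, -, hθ⟩ := intermediate_value_Icc hpi hc.continuousOn
      (show (0 : ℝ) ∈ Set.Icc _ _ from ⟨by rw [h0]; exact h, by
        rw [h1]; exact div_nonneg (by linarith) hn.le⟩)
    exact ⟨θ, hθ⟩

lemma rotationAtI_pi_smul_translation (s : ℝ) :
    rotationAtI Real.pi • translation s • UpperHalfPlane.I =
      translation (-s) • UpperHalfPlane.I := by
  have e10 : rotationAtI Real.pi 1 0 = -1 := by simp [rotationAtI]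
  have e11 : rotationAtI Real.pi 1 1 = 0 := by simp [rotationAtI]
  have e00 : rotationAtI Real.pi 0 0 = 0 := by simp [rotationAtI]
  have e01 : rotationAtI Real.pi 0 1 = 1 := by simp [rotationAtI]
  apply upperHalfPlane_ext
  · rw [re_sl_smul, translation_smul_I_re, translation_smul_I_re, e10, e11, e00, e01]; simp
  · rw [im_sl_smul, Complex.normSq_apply, autFactor_re, autFactor_im, translation_smul_I_re,
      translation_smul_I_im, translation_smul_I_im, e10, e11, Real.exp_neg]
    field_simp
    simp

/-- Any two points of the hyperbolic plane are joined by a geodesic. -/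
lemma exists_geodesic (y w : ℍ) : ∃ (g : SL(2, ℝ)) (d : ℝ), 0 ≤ d ∧ g • UpperHalfPlane.I = y ∧
    g • translation d • UpperHalfPlane.I = w := by
  obtain ⟨θ, hθ⟩ := exists_rotationAtI_smul_re_eq_zero (y.toSL2R⁻¹ • w)
  have h := eq_translation_smul_I hθ
  set s := Real.log (rotationAtI θ • y.toSL2R⁻¹ • w).im with hs
  have hw : w = (y.toSL2R * rotationAtI (-θ)) • translation s • UpperHalfPlane.I := by
    rw [← h, mul_smul, ← rotationAtI_inv, inv_smul_smul, smul_inv_smul]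
  rcases le_total 0 s with h0 | h0
  · exact ⟨_, s, h0, by rw [mul_smul, rotationAtI_smul_I, UpperHalfPlane.toSL2R_smul_I], hw.symm⟩
  · refine ⟨y.toSL2R * rotationAtI (-θ) * rotationAtI Real.pi, -s, by linarith, ?_, ?_⟩
    · rw [mul_smul, mul_smul, rotationAtI_smul_I, rotationAtI_smul_I,
        UpperHalfPlane.toSL2R_smul_I]
    · rw [mul_smul _ (rotationAtI Real.pi), rotationAtI_pi_smul_translation, neg_neg]
      exact hw.symm

/-- Translations along the imaginary axis have a positive factor and contribute no angle. What
remains is the motion of the base point under `g` and half the rotation `θ`. -/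
lemma polar_vectorField (g : SL(2, ℝ)) (d : ℝ) (θ : C(I, ℝ)) (t : I) :
    autFactor (vectorField g d θ t) UpperHalfPlane.I =
      ‖autFactor (vectorField g d θ t) UpperHalfPlane.I‖ * Complex.exp
        ((Complex.arg (autFactor g UpperHalfPlane.I) +
          turn g (translation (t * d) • UpperHalfPlane.I) UpperHalfPlane.I + -(θ t / 2) : ℝ)
            * Complex.I) := by
  have e : vectorField g d θ t = g * translation (t * d) * rotationAtI (θ t) := rfl
  have h0 := autFactor_ne_zero g UpperHalfPlane.I
  have e2 : autFactor (vectorField g d θ t) UpperHalfPlane.I =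
      autFactor g UpperHalfPlane.I *
      (autFactor g (translation (t * d) • UpperHalfPlane.I) / autFactor g UpperHalfPlane.I) *
      (((Real.exp (-(t * d / 2)) : ℝ) : ℂ) *
        Complex.exp ((-(θ t / 2) : ℝ) * Complex.I)) := by
    rw [e, autFactor_mul, rotationAtI_smul_I, autFactor_mul, autFactor_translation,
      autFactor_rotationAtI]
    field_simp
  rw [e2]
  refine polar_mul (polar_mul (eq_norm_mul_exp_arg _) (polar_turn _ _ _)) ?_
  rw [norm_mul, Complex.norm_exp_ofReal_mul_I, Complex.norm_real, Real.norm_eq_abs,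
    abs_of_pos (Real.exp_pos _), mul_one]

lemma vectorField_zero_smul_I (g : SL(2, ℝ)) (d : ℝ) (θ : C(I, ℝ)) :
    vectorField g d θ 0 • UpperHalfPlane.I = g • UpperHalfPlane.I := by
  have e : vectorField g d θ 0 = g * translation (((0 : I) : ℝ) * d) * rotationAtI (θ 0) := rfl
  rw [e, Set.Icc.coe_zero, zero_mul, translation_zero, mul_one, mul_smul, rotationAtI_smul_I]

lemma vectorField_one_smul_I (g : SL(2, ℝ)) (d : ℝ) (θ : C(I, ℝ)) :
    vectorField g d θ 1 • UpperHalfPlane.I = g • translation d • UpperHalfPlane.I := by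
  have e : vectorField g d θ 1 = g * translation (((1 : I) : ℝ) * d) * rotationAtI (θ 1) := rfl
  rw [e, Set.Icc.coe_one, one_mul, mul_smul, rotationAtI_smul_I, mul_smul]

lemma dirVariation_vectorField (g : SL(2, ℝ)) (d : ℝ) (θ : C(I, ℝ)) :
    dirVariation (UniversalCover.ofPath (vectorField g d θ)) (g • UpperHalfPlane.I) =
      θ 1 - θ 0 - 2 * turn g (translation d • UpperHalfPlane.I) UpperHalfPlane.I := by
  have h := dirVariation_ofPath (vectorField g d θ) _ (by
    refine (continuous_const.add (continuous_turn continuous_const (continuous_sl_smul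
      (continuous_translation.comp (continuous_subtype_val.mul continuous_const))
      continuous_const) continuous_const)).add (θ.continuous.div_const 2).neg)
    (polar_vectorField g d θ)
  rw [vectorField_zero_smul_I] at h
  rw [h]
  simp only [Set.Icc.coe_one, Set.Icc.coe_zero, one_mul, zero_mul, translation_zero, one_smul,
    turn_self]
  ring

lemma proj_ofPath_smul (h : C(I, SL(2, ℝ))) :
    UniversalCover.proj (UniversalCover.ofPath h) • h 0 • UpperHalfPlane.I =
      h 1 • UpperHalfPlane.I := by
  have e : UniversalCover.proj (UniversalCover.ofPath h) = h 1 * (h 0)⁻¹ := rfl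
  rw [e, mul_smul, inv_smul_smul]

lemma horArea_translation (s t : ℝ) :
    horArea (translation s • UpperHalfPlane.I) (translation t • UpperHalfPlane.I) = 0 := by
  simp [horArea, translation_smul_I_re]

/-- The vector field turns by `dirVariation` and the velocity by `-horArea`, both relative to the
Euclidean direction; the twist is the difference. In particular it does not depend on the choices in
`IsTwist`. -/
lemma IsTwist.eq {a : PSLCover} {y : ℍ} {τ : ℝ} (h : IsTwist a y τ) :
    τ = dirVariation a y + horArea y (UniversalCover.proj a • y) := by
  obtain ⟨g, d, θ, -, rfl, rfl, rfl⟩ := h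
  have h1 := dirVariation_vectorField g d θ
  have h2 := proj_ofPath_smul (vectorField g d θ)
  rw [vectorField_zero_smul_I, vectorField_one_smul_I] at h2
  rw [h1, h2, horArea_smul]
  have h3 := horArea_translation 0 d
  rw [translation_zero, one_smul] at h3
  rw [h3, turn, turn]; ring

lemma exists_rotationAtI_of_smul_I {g : SL(2, ℝ)} (h : g • UpperHalfPlane.I = UpperHalfPlane.I) :
    ∃ φ, g = rotationAtI φ := by
  refine ⟨-2 * (autFactor g UpperHalfPlane.I).arg, ?_⟩
  apply sl_ext_of_smul_I
  · rw [h, rotationAtI_smul_I]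
  · have h1 := congrArg UpperHalfPlane.im h
    rw [im_sl_smul, Complex.normSq_eq_norm_sq, UpperHalfPlane.I_im] at h1
    have h0 : 0 < ‖autFactor g UpperHalfPlane.I‖ := norm_pos_iff.2 (autFactor_ne_zero _ _)
    have h2 : ‖autFactor g UpperHalfPlane.I‖ = 1 := by
      field_simp at h1
      nlinarith
    rw [autFactor_rotationAtI]
    conv_lhs => rw [eq_norm_mul_exp_arg (autFactor g UpperHalfPlane.I), h2]
    push_cast
    rw [one_mul]; congr 2; ring

/-- The period is `4π` and not `2π` because the matrices live in `SL(2, ℝ)`, where a full turn is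
`-1`. -/
lemma rotationAtI_periodic (φ : ℝ) (k : ℤ) :
    rotationAtI (φ + k * (4 * Real.pi)) = rotationAtI φ := by
  have e : (φ + k * (4 * Real.pi)) / 2 = φ / 2 + k * (2 * Real.pi) := by ring
  apply Subtype.ext
  simp only [rotationAtI, e, Real.cos_add_int_mul_two_pi, Real.sin_add_int_mul_two_pi]

/-- Elements with the same image differ by a deck transformation. The argument of the factor then
changes by a multiple of `2π`, and the direction by twice as much. -/
lemma dirVariation_sub_of_proj_eq {a b : PSLCover}
    (h : UniversalCover.proj a = UniversalCover.proj b) (y : ℍ) :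
    ∃ k : ℤ, dirVariation a y - dirVariation b y = k * (4 * Real.pi) := by
  rw [dirVariation, dirVariation, h]
  obtain ⟨γ, rfl⟩ := exists_mk_eq a
  obtain ⟨δ, rfl⟩ := exists_mk_eq b
  obtain ⟨ℓ, hℓ⟩ := exists_isArgLift γ
  obtain ⟨m, hm⟩ := exists_isArgLift δ
  rw [hℓ.argVariation_eq, hm.argVariation_eq]
  replace h : γ.1 1 = δ.1 1 := h
  have e1 := hℓ.eq 1
  have e2 := hm.eq 1
  rw [h] at e1
  have h0 : (‖autFactor (δ.1 1) UpperHalfPlane.I‖ : ℂ) ≠ 0 := by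
    simpa using autFactor_ne_zero _ _
  have e3 := mul_left_cancel₀ h0 (e1.symm.trans e2)
  rw [Complex.exp_eq_exp_iff_exists_int] at e3
  obtain ⟨n, hn⟩ := e3
  have : (ℓ 1 : ℂ) = m 1 + n * (2 * Real.pi) := by
    have : (ℓ 1 : ℂ) * Complex.I = (m 1 + n * (2 * Real.pi)) * Complex.I := by
      rw [hn]; ring
    exact mul_right_cancel₀ Complex.I_ne_zero this
  have this' : ℓ 1 = m 1 + n * (2 * Real.pi) := by exact_mod_cast this
  refine ⟨-n, ?_⟩
  rw [this']; push_cast; ring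

lemma eq_of_dirVariation_eq {a b : PSLCover}
    (h : UniversalCover.proj a = UniversalCover.proj b) {y : ℍ}
    (h2 : dirVariation a y = dirVariation b y) : a = b := by
  refine cover_ext h ?_
  rw [dirVariation, dirVariation, h] at h2
  linarith

/-- A rotation angle `φ` with the right endpoint in `SL(2, ℝ)` exists because stabilizers of points
are rotations. Adding a suitable multiple of `4π` corrects the sheet of the cover. -/
lemma exists_isTwist (a : PSLCover) (y : ℍ) : ∃ τ, IsTwist a y τ := by
  obtain ⟨g, d, hd, hg, hgd⟩ := exists_geodesic y (UniversalCover.proj a • y)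
  obtain ⟨φ, hφ⟩ := exists_rotationAtI_of_smul_I
    (g := (g * translation d)⁻¹ * UniversalCover.proj a * g) (by
      rw [mul_smul, hg, mul_smul, ← hgd, ← mul_smul g, inv_smul_smul])
  have hφ' : UniversalCover.proj a = g * translation d * rotationAtI φ * g⁻¹ := by
    rw [← hφ]; group
  let θ (τ : ℝ) : C(I, ℝ) := ⟨fun t => t * τ, continuous_subtype_val.mul continuous_const⟩
  have hproj (k : ℤ) : UniversalCover.proj (UniversalCover.ofPath
      (vectorField g d (θ (φ + k * (4 * Real.pi))))) = UniversalCover.proj a := by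
    change (g * translation (((1 : I) : ℝ) * d) *
        rotationAtI (((1 : I) : ℝ) * (φ + k * (4 * Real.pi)))) *
      (g * translation (((0 : I) : ℝ) * d) *
        rotationAtI (((0 : I) : ℝ) * (φ + k * (4 * Real.pi))))⁻¹ = _
    have r0 : rotationAtI 0 = 1 := by
      ext i j; fin_cases i <;> fin_cases j <;> simp [rotationAtI]
    simp only [Set.Icc.coe_one, one_mul, Set.Icc.coe_zero, zero_mul, translation_zero, r0,
      mul_one, rotationAtI_periodic, hφ']
  obtain ⟨k, hk⟩ := dirVariation_sub_of_proj_eq (hproj 0).symm y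
  refine ⟨_, g, d, θ (φ + k * (4 * Real.pi)), hd, hg, ?_, rfl⟩
  refine eq_of_dirVariation_eq (hproj k) (y := y) ?_
  have h1 := dirVariation_vectorField g d (θ (φ + (0 : ℤ) * (4 * Real.pi)))
  have h2 := dirVariation_vectorField g d (θ (φ + k * (4 * Real.pi)))
  rw [hg] at h1 h2
  rw [h2]
  rw [h1] at hk
  have e (τ : ℝ) : θ τ 1 - θ τ 0 = τ := by simp [θ]
  rw [e] at hk ⊢
  push_cast at hk
  linarith

lemma innerTwist_eq (a : PSLCover) (y : ℍ) :
    innerTwist a y = dirVariation a y + horArea y (UniversalCover.proj a • y) :=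
  (Classical.epsilon_spec (exists_isTwist a y) : IsTwist a y (innerTwist a y)).eq

/-! ### The boundary sum of the polygon of a relator -/

/-- The action of the universal cover on the hyperbolic plane. -/
instance coverActionPlane : MulAction PSLCover ℍ :=
  MulAction.compHom ℍ (UniversalCover.proj : PSLCover →* SL(2, ℝ))

lemma cover_smul_def (a : PSLCover) (y : ℍ) : a • y = UniversalCover.proj a • y := rfl

lemma cover_smul_inl (a : PSLCover) (y : ℍ) :
    a • (Sum.inl y : ClosedPlane) = Sum.inl (a • y) := rfl

lemma innerTwist_eq' (a : PSLCover) (y : ℍ) :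
    innerTwist a y = dirVariation a y + horArea y (a • y) := innerTwist_eq a y

lemma dirVariation_mul' (a b : PSLCover) (y : ℍ) :
    dirVariation (a * b) y = dirVariation a (b • y) + dirVariation b y := dirVariation_mul a b y

lemma dirVariation_one (y : ℍ) : dirVariation 1 y = 0 := by
  have := dirVariation_mul' 1 1 y
  rw [one_mul, one_smul] at this
  linarith

lemma dirVariation_inv (a : PSLCover) (y : ℍ) :
    dirVariation a⁻¹ y = -dirVariation a (a⁻¹ • y) := by
  have := dirVariation_mul' a a⁻¹ y
  rw [mul_inv_cancel, dirVariation_one] at this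
  linarith

lemma dirVariation_sub_smul (a : PSLCover) (u v : ℍ) :
    dirVariation a u - dirVariation a v = horArea (a • u) (a • v) - horArea u v :=
  dirVariation_sub a u v

/-- Expanding the cocycle, `a` and `a⁻¹` contribute the difference of `dirVariation a` at two
points, and likewise `b` and `b⁻¹`. By `dirVariation_sub_smul` only `horArea` terms survive, so a
commutator contributes no twist terms. -/
lemma dirVariation_commutator (a b : PSLCover) (y : ℍ) :
    dirVariation ⁅a, b⁆ y = horArea (⁅a, b⁆ • y) (b⁻¹ • y) + horArea (b⁻¹ • y) ((a⁻¹ * b⁻¹) • y) +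
      horArea ((a⁻¹ * b⁻¹) • y) ((b * a⁻¹ * b⁻¹) • y) + horArea ((b * a⁻¹ * b⁻¹) • y) y := by
  have h1 := dirVariation_sub_smul a ((b * a⁻¹ * b⁻¹) • y) ((a⁻¹ * b⁻¹) • y)
  have h2 := dirVariation_sub_smul b ((a⁻¹ * b⁻¹) • y) (b⁻¹ • y)
  have e1 : a • (b * a⁻¹ * b⁻¹) • y = ⁅a, b⁆ • y := by
    rw [← mul_smul, commutatorElement_def]; congr 1; group
  have e2 : a • (a⁻¹ * b⁻¹) • y = b⁻¹ • y := by
    rw [← mul_smul]; congr 1; group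
  have e3 : b • (a⁻¹ * b⁻¹) • y = (b * a⁻¹ * b⁻¹) • y := by
    rw [← mul_smul]; congr 1; group
  have e4 : b • b⁻¹ • y = y := smul_inv_smul _ _
  rw [e1, e2] at h1
  rw [e3, e4] at h2
  have e5 : dirVariation ⁅a, b⁆ y = dirVariation a ((b * a⁻¹ * b⁻¹) • y)
      + dirVariation b ((a⁻¹ * b⁻¹) • y) - dirVariation a ((a⁻¹ * b⁻¹) • y)
      - dirVariation b (b⁻¹ • y) := by
    rw [commutatorElement_def, dirVariation_mul', dirVariation_mul', dirVariation_mul',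
      dirVariation_inv, dirVariation_inv]
    have s1 : a⁻¹ • b⁻¹ • y = (a⁻¹ * b⁻¹) • y := (mul_smul _ _ _).symm
    have s2 : b • (a⁻¹ * b⁻¹) • y = (b * a⁻¹ * b⁻¹) • y := e3
    rw [s1, s2]; ring
  have h3 := horArea_swap ((b * a⁻¹ * b⁻¹) • y) ((a⁻¹ * b⁻¹) • y)
  have h4 := horArea_swap (b⁻¹ • y) ((a⁻¹ * b⁻¹) • y)
  linarith

/-! ### Edge sums and the group elements behind the vertices. -/

/-- The sum of `f` over the successive pairs of a list. -/
def chainSum {X : Type*} (f : X → X → ℝ) : List X → ℝ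
  | x :: y :: l => f x y + chainSum f (y :: l)
  | _ => 0

/-- The sum of `f` over the edges of the closed polygon with vertices `l`. -/
def cycleSum {X : Type*} (f : X → X → ℝ) (l : List X) : ℝ :=
  chainSum f (l ++ l.head?.toList)

@[simp] lemma chainSum_nil {X : Type*} (f : X → X → ℝ) : chainSum f [] = 0 := rfl
@[simp] lemma chainSum_singleton {X : Type*} (f : X → X → ℝ) (x : X) : chainSum f [x] = 0 := rfl
@[simp] lemma chainSum_cons_cons {X : Type*} (f : X → X → ℝ) (x y : X) (l : List X) :
    chainSum f (x :: y :: l) = f x y + chainSum f (y :: l) := rfl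

lemma chainSum_append {X : Type*} (f : X → X → ℝ) (l : List X) (y : X) (m : List X) :
    chainSum f (l ++ y :: m) = chainSum f (l ++ [y]) + chainSum f (y :: m) := by
  induction l with
  | nil => simp
  | cons a l ih => cases l with
    | nil => simp
    | cons b l => simp at ih ⊢; rw [ih]; ring

lemma chainSum_map {X Y : Type*} (f : Y → Y → ℝ) (h : X → Y) (l : List X) :
    chainSum f (l.map h) = chainSum (fun x y => f (h x) (h y)) l := by
  induction l with
  | nil => rfl
  | cons a l ih => cases l with
    | nil => rfl
    | cons b l => simp at ih ⊢; rw [ih]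

/-- The successive tail products `c₁ ⋯ c_n, c₂ ⋯ c_n, …, c_n`. -/
def tailWords : List PSLCover → List PSLCover
  | [] => []
  | c :: l => (c :: l).prod :: tailWords l

/-- The vertices contributed by the commutators, followed by `r`. -/
def commutatorWords (r : PSLCover) : List (PSLCover × PSLCover) → List PSLCover
  | [] => []
  | p :: l =>
    let q := (l.map fun p => ⁅p.1, p.2⁆).prod * r
    [⁅p.1, p.2⁆ * q, p.2⁻¹ * q, (p.1⁻¹ * p.2⁻¹) * q, (p.2 * p.1⁻¹ * p.2⁻¹) * q] ++
      commutatorWords r l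

/-- The elements of the universal cover carrying the base point to the vertices of the polygon. -/
def relatorWords (A : List (PSLCover × PSLCover)) (C : List PSLCover) : List PSLCover :=
  1 :: (commutatorWords C.prod A ++ tailWords C)

/-- The sum of the twists of the entries of `C` at the tail images of `x`. -/
def tailTwist : List PSLCover → ℍ → ℝ
  | [], _ => 0
  | c :: l, x => innerTwist c (l.prod • x) + tailTwist l x

lemma tailWords_append_one (C : List PSLCover) :
    ∃ t, tailWords C ++ [1] = C.prod :: t := by
  cases C with
  | nil => exact ⟨[], rfl⟩
  | cons c l => exact ⟨_, rfl⟩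

lemma commutatorWords_append (r : PSLCover) (A : List (PSLCover × PSLCover)) :
    ∃ t, commutatorWords r A ++ [r] = (A.map fun p => ⁅p.1, p.2⁆).prod * r :: t := by
  cases A with
  | nil => exact ⟨[], by simp [commutatorWords]⟩
  | cons p A =>
    rw [commutatorWords, List.map_cons, List.prod_cons, mul_assoc ⁅p.1, p.2⁆]
    exact ⟨_, rfl⟩

lemma chainSum_tailWords (C : List PSLCover) (x : ℍ) :
    chainSum (fun v w : PSLCover => horArea (v • x) (w • x)) (tailWords C ++ [1]) =
      dirVariation C.prod x - tailTwist C x := by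
  induction C with
  | nil => simp [tailWords, tailTwist, dirVariation_one]
  | cons c l ih =>
    obtain ⟨t, ht⟩ := tailWords_append_one l
    rw [tailWords, List.cons_append, ht, chainSum_cons_cons, ← ht, ih, tailTwist, List.prod_cons,
      dirVariation_mul', innerTwist_eq', ← mul_smul, horArea_swap (l.prod • x)]
    ring

lemma chainSum_commutatorWords (r : PSLCover) (A : List (PSLCover × PSLCover)) (x : ℍ) :
    chainSum (fun v w : PSLCover => horArea (v • x) (w • x)) (commutatorWords r A ++ [r]) =
      dirVariation (A.map fun p => ⁅p.1, p.2⁆).prod (r • x) := by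
  induction A with
  | nil => simp [commutatorWords, dirVariation_one]
  | cons p l ih =>
    obtain ⟨t, ht⟩ := commutatorWords_append r l
    rw [commutatorWords, List.append_assoc, ht]
    simp only [List.cons_append, List.nil_append, chainSum_cons_cons]
    rw [← ht, ih, List.map_cons, List.prod_cons, dirVariation_mul', dirVariation_commutator]
    simp only [mul_smul]
    ring

/-- The theorem at an inner point before areas are interpreted: the edges from `[α₁, β₁] q₁` to `γ₁
⋯ γ_n x` and from there back to `x` give the two factors of the cocycle, and the first edge is the
`horArea` term of the twist of the product. -/
lemma cycleSum_relatorWords (A : List (PSLCover × PSLCover)) (C : List PSLCover) (x : ℍ) :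
    innerTwist ((A.map fun p => ⁅p.1, p.2⁆).prod * C.prod) x = tailTwist C x +
      cycleSum (fun v w : PSLCover => horArea (v • x) (w • x)) (relatorWords A C) := by
  obtain ⟨t, ht⟩ := tailWords_append_one C
  obtain ⟨s, hs⟩ := commutatorWords_append C.prod A
  have h1 := chainSum_tailWords C x
  have h2 := chainSum_commutatorWords C.prod A x
  have e : relatorWords A C ++ [1] =
      1 :: (commutatorWords C.prod A ++ C.prod :: t) := by
    rw [relatorWords, List.cons_append, List.append_assoc, ht]
  have e2 : ∃ u, commutatorWords C.prod A ++ C.prod :: t =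
      (A.map fun p => ⁅p.1, p.2⁆).prod * C.prod :: u :=
    ⟨s ++ t, by rw [← List.cons_append, ← hs]; simp⟩
  obtain ⟨u, hu⟩ := e2
  have h3 : cycleSum (fun v w : PSLCover => horArea (v • x) (w • x)) (relatorWords A C) =
      horArea x (((A.map fun p => ⁅p.1, p.2⁆).prod * C.prod) • x) +
      (dirVariation (A.map fun p => ⁅p.1, p.2⁆).prod (C.prod • x) +
        (dirVariation C.prod x - tailTwist C x)) := by
    have : cycleSum (fun v w : PSLCover => horArea (v • x) (w • x)) (relatorWords A C) =
      chainSum (fun v w : PSLCover => horArea (v • x) (w • x)) (relatorWords A C ++ [1]) := rfl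
    rw [this, e, hu, chainSum_cons_cons, ← hu, chainSum_append, h2, ← ht, h1, one_smul]
  rw [h3, innerTwist_eq', dirVariation_mul']
  ring

/-! ### Comparison with the frozen definitions -/

lemma tailWords_ofFn {n : ℕ} (γ : Fin n → PSLCover) :
    tailWords (List.ofFn γ) = List.ofFn fun j : Fin n => tailProd γ (j : ℕ) := by
  induction n with
  | zero => rfl
  | succ n ih =>
    rw [List.ofFn_succ (f := γ), tailWords, ih, List.ofFn_succ (f := fun j : Fin (n + 1) =>
      tailProd γ (j : ℕ))]
    simp [tailProd]

lemma tailTwist_ofFn {n : ℕ} (γ : Fin n → PSLCover) (x : ℍ) :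
    tailTwist (List.ofFn γ) x =
      ∑ j : Fin n, innerTwist (γ j) (tailProd γ ((j : ℕ) + 1) • x) := by
  induction n with
  | zero => rfl
  | succ n ih =>
    rw [List.ofFn_succ (f := γ), tailTwist, ih, Fin.sum_univ_succ]
    simp [tailProd]

lemma commutatorWords_ofFn {g : ℕ} (r : PSLCover) (α β : Fin g → PSLCover) :
    commutatorWords r (List.ofFn fun i => (α i, β i)) = (List.ofFn fun i : Fin g =>
      let q := tailProd (fun k => ⁅α k, β k⁆) ((i : ℕ) + 1) * r
      [⁅α i, β i⁆ * q, (β i)⁻¹ * q, ((α i)⁻¹ * (β i)⁻¹) * q,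
        (β i * (α i)⁻¹ * (β i)⁻¹) * q]).flatten := by
  induction g with
  | zero => rfl
  | succ g ih =>
    rw [List.ofFn_succ (f := fun i => (α i, β i)), commutatorWords, ih]
    conv_rhs => rw [List.ofFn_succ]
    simp [tailProd, List.map_ofFn, Function.comp_def]

lemma relatorPolygon_eq {g n : ℕ} (α β : Fin g → PSLCover) (γ : Fin n → PSLCover)
    (p : ClosedPlane) : relatorPolygon α β γ p =
      (relatorWords (List.ofFn fun i => (α i, β i)) (List.ofFn γ)).map (· • p) := by
  rw [relatorWords, commutatorWords_ofFn, tailWords_ofFn, relatorPolygon]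
  simp only [List.map_cons, one_smul, List.map_append, List.map_flatten, List.map_ofFn,
    Function.comp_def, mul_smul, List.map_nil]
  rfl

/-! ### The twist at an ideal point -/

/-- A family of points tending to `∞` along a vertical geodesic. -/
structure VerticalLimit {X : Type*} (l : Filter X) (z : X → ℍ) (x₀ : ℝ) : Prop where
  re_eq : ∀ s, (z s).re = x₀
  im_tendsto : Tendsto (fun s => (z s).im) l atTop

section limits

variable {X : Type*} {l : Filter X} {z : X → ℍ} {x₀ : ℝ}

lemma normSq_autFactor (g : SL(2, ℝ)) (z : ℍ) : Complex.normSq (autFactor g z) =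
    (g 1 0 * z.re + g 1 1) ^ 2 + (g 1 0 * z.im) ^ 2 := by
  rw [Complex.normSq_apply, autFactor_re, autFactor_im]; ring

lemma VerticalLimit.re_smul_const (hz : VerticalLimit l z x₀) {g : SL(2, ℝ)} (hc : g 1 0 = 0) :
    ∃ r, ∀ s, (g • z s).re = r := by
  refine ⟨(g 0 0 * x₀ + g 0 1) * g 1 1 / g 1 1 ^ 2, fun s => ?_⟩
  rw [re_sl_smul, normSq_autFactor, hz.re_eq, hc]; simp

/-- This is the real part of `g z - a / c = -1 / (c (c z + d))`, where `a / c` is the image of `∞`.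
-/
lemma re_smul_sub {g : SL(2, ℝ)} (hc : g 1 0 ≠ 0) (z : ℍ) :
    (g • z).re - g 0 0 / g 1 0 =
      -((g 1 0 * z.re + g 1 1) / g 1 0) / Complex.normSq (autFactor g z) := by
  have h0 : Complex.normSq (autFactor g z) ≠ 0 := by simpa using autFactor_ne_zero g z
  have hd := sl_det g
  rw [re_sl_smul]
  field_simp
  rw [normSq_autFactor]
  linear_combination (-g 1 0 * z.re - g 1 1) * hd

lemma VerticalLimit.normSq_tendsto (hz : VerticalLimit l z x₀) {g : SL(2, ℝ)} (hc : g 1 0 ≠ 0) :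
    Tendsto (fun s => Complex.normSq (autFactor g (z s))) l atTop := by
  have h1 : Tendsto (fun s => (g 1 0) ^ 2 * (z s).im ^ 2) l atTop :=
    ((tendsto_pow_atTop (two_ne_zero)).comp hz.im_tendsto).const_mul_atTop (by positivity)
  refine tendsto_atTop_mono (fun s => ?_) h1
  rw [normSq_autFactor]
  nlinarith [sq_nonneg (g 1 0 * (z s).re + g 1 1)]

lemma VerticalLimit.re_smul_tendsto (hz : VerticalLimit l z x₀) {g : SL(2, ℝ)} (hc : g 1 0 ≠ 0) :
    Tendsto (fun s => (g • z s).re) l (𝓝 (g 0 0 / g 1 0)) := by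
  have h : Tendsto (fun s => g 0 0 / g 1 0 +
      -((g 1 0 * x₀ + g 1 1) / g 1 0) / Complex.normSq (autFactor g (z s))) l
      (𝓝 (g 0 0 / g 1 0 + 0)) :=
    tendsto_const_nhds.add ((hz.normSq_tendsto hc).const_div_atTop _)
  rw [add_zero] at h
  refine h.congr fun s => ?_
  have := re_smul_sub hc (z s)
  rw [hz.re_eq] at this
  linarith

lemma VerticalLimit.re_div_im_tendsto (hz : VerticalLimit l z x₀) {g : SL(2, ℝ)}
    (hc : g 1 0 ≠ 0) :
    Tendsto (fun s => ((g • z s).re - g 0 0 / g 1 0) / (g • z s).im) l (𝓝 0) := by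
  have h : Tendsto (fun s => -((g 1 0 * x₀ + g 1 1) / g 1 0) / (z s).im) l (𝓝 0) :=
    hz.im_tendsto.const_div_atTop _
  refine h.congr fun s => ?_
  have h0 : Complex.normSq (autFactor g (z s)) ≠ 0 := by simpa using autFactor_ne_zero g (z s)
  have := (z s).im_ne_zero
  rw [re_smul_sub hc, im_sl_smul, hz.re_eq]
  field_simp

lemma VerticalLimit.im_smul_tendsto_zero (hz : VerticalLimit l z x₀) {g : SL(2, ℝ)}
    (hc : g 1 0 ≠ 0) : Tendsto (fun s => (g • z s).im) l (𝓝 0) := by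
  have h : Tendsto (fun s => (1 / (g 1 0) ^ 2) / (z s).im) l (𝓝 0) :=
    hz.im_tendsto.const_div_atTop _
  refine tendsto_of_tendsto_of_tendsto_of_le_of_le tendsto_const_nhds h
    (fun s => (g • z s).im_pos.le) (fun s => ?_)
  have hp := (z s).im_pos
  simp only
  rw [im_sl_smul, normSq_autFactor, div_div, div_le_div_iff₀ (by positivity) (by positivity)]
  nlinarith [sq_nonneg (g 1 0 * (z s).re + g 1 1)]

lemma VerticalLimit.im_smul_tendsto_atTop (hz : VerticalLimit l z x₀) {g : SL(2, ℝ)}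
    (hc : g 1 0 = 0) : Tendsto (fun s => (g • z s).im) l atTop := by
  have hd : g 1 1 ≠ 0 := by
    intro h; have := sl_det g; simp [hc, h] at this
  have h := hz.im_tendsto.atTop_div_const (r := g 1 1 ^ 2) (by positivity)
  refine h.congr fun s => ?_
  rw [im_sl_smul, normSq_autFactor, hc]; simp

lemma tendsto_horArea_zero_of {u v : X → ℍ}
    (h : Tendsto (fun s => ((v s).re - (u s).re) / ((u s).im + (v s).im)) l (𝓝 0)) :
    Tendsto (fun s => horArea (u s) (v s)) l (𝓝 0) := by
  have := ((Real.continuous_arctan.tendsto 0).comp h).const_mul 2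
  rwa [Real.arctan_zero, mul_zero] at this

lemma VerticalLimit.exists_re_tendsto (hz : VerticalLimit l z x₀) (g : SL(2, ℝ)) :
    ∃ r, Tendsto (fun s => (g • z s).re) l (𝓝 r) := by
  by_cases hc : g 1 0 = 0
  · obtain ⟨r, hr⟩ := hz.re_smul_const hc
    exact ⟨r, by simp_rw [hr]; exact tendsto_const_nhds⟩
  · exact ⟨_, hz.re_smul_tendsto hc⟩

/-- `horArea` at two points one of which tends to `∞`. -/
lemma VerticalLimit.horArea_tendsto_zero (hz : VerticalLimit l z x₀) {g : SL(2, ℝ)}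
    (hc : g 1 0 = 0) (h : SL(2, ℝ)) :
    Tendsto (fun s => horArea (g • z s) (h • z s)) l (𝓝 0) := by
  obtain ⟨r, hr⟩ := hz.exists_re_tendsto g
  obtain ⟨r', hr'⟩ := hz.exists_re_tendsto h
  refine tendsto_horArea_zero_of ((hr'.sub hr).div_atTop ?_)
  exact tendsto_atTop_mono (fun s => le_add_of_nonneg_right (h • z s).im_pos.le)
    (hz.im_smul_tendsto_atTop hc)

/-- `horArea` at two points tending to the same finite ideal point. -/
lemma VerticalLimit.horArea_tendsto_zero' (hz : VerticalLimit l z x₀) {g h : SL(2, ℝ)}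
    (hg : g 1 0 ≠ 0) (hh : h 1 0 ≠ 0) (e : g 0 0 / g 1 0 = h 0 0 / h 1 0) :
    Tendsto (fun s => horArea (g • z s) (h • z s)) l (𝓝 0) := by
  refine tendsto_horArea_zero_of ?_
  have h1 := (hz.re_div_im_tendsto hg).abs.add (hz.re_div_im_tendsto hh).abs
  rw [abs_zero, add_zero] at h1
  refine squeeze_zero_norm (fun s => ?_) h1
  have p1 := (g • z s).im_pos
  have p2 := (h • z s).im_pos
  set a := (g • z s).re - g 0 0 / g 1 0
  set b := (h • z s).re - h 0 0 / h 1 0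
  have e1 : (h • z s).re - (g • z s).re = b - a := by simp only [a, b, e]; ring
  rw [e1, Real.norm_eq_abs, abs_div, abs_div, abs_div, abs_of_pos p1, abs_of_pos p2,
    abs_of_pos (add_pos p1 p2)]
  calc |b - a| / ((g • z s).im + (h • z s).im) ≤ (|a| + |b|) / ((g • z s).im + (h • z s).im) := by
        gcongr; rw [add_comm]; exact abs_sub _ _
    _ = |a| / ((g • z s).im + (h • z s).im) + |b| / ((g • z s).im + (h • z s).im) := add_div _ _ _
    _ ≤ _ := by gcongr <;> linarith

/-- `horArea` at two points tending to different finite ideal points. -/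
lemma VerticalLimit.horArea_tendsto_pi (hz : VerticalLimit l z x₀) {g h : SL(2, ℝ)}
    (hg : g 1 0 ≠ 0) (hh : h 1 0 ≠ 0) (e : g 0 0 / g 1 0 < h 0 0 / h 1 0) :
    Tendsto (fun s => horArea (g • z s) (h • z s)) l (𝓝 Real.pi) := by
  have h1 := (hz.re_smul_tendsto hh).sub (hz.re_smul_tendsto hg)
  have h2 := (hz.im_smul_tendsto_zero hg).add (hz.im_smul_tendsto_zero hh)
  rw [add_zero] at h2
  have h3 : Tendsto (fun s => (g • z s).im + (h • z s).im) l (𝓝[>] 0) :=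
    tendsto_nhdsWithin_iff.2 ⟨h2, Eventually.of_forall fun s =>
      add_pos (g • z s).im_pos (h • z s).im_pos⟩
  have h4 := h1.pos_mul_atTop (sub_pos.2 e) h3.inv_tendsto_nhdsGT_zero
  have h5 := ((Real.tendsto_arctan_atTop.mono_right nhdsWithin_le_nhds).comp h4).const_mul 2
  have e2 : 2 * (Real.pi / 2) = Real.pi := by ring
  rw [e2] at h5
  exact h5

lemma VerticalLimit.arg_tendsto (hz : VerticalLimit l z x₀) (g : SL(2, ℝ)) :
    Tendsto (fun s => Complex.arg (autFactor g (z s))) l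
      (𝓝 (if g 1 0 = 0 then Complex.arg (g 1 1) else Complex.arg (g 1 0 * Complex.I))) := by
  split_ifs with hc
  · simp only [autFactor, hc]
    simp [tendsto_const_nhds]
  · have h1 : Tendsto (fun s => (((g 1 0 * x₀ + g 1 1) / (z s).im : ℝ) : ℂ) + g 1 0 * Complex.I) l
        (𝓝 (((0 : ℝ) : ℂ) + g 1 0 * Complex.I)) :=
      ((Complex.continuous_ofReal.tendsto _).comp
        (hz.im_tendsto.const_div_atTop _)).add tendsto_const_nhds
    rw [Complex.ofReal_zero, zero_add] at h1
    have h2 : (g 1 0 * Complex.I : ℂ) ∈ Complex.slitPlane := by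
      rw [Complex.mem_slitPlane_iff]; right; simpa using hc
    refine ((Complex.continuousAt_arg h2).tendsto.comp h1).congr fun s => ?_
    have hp := (z s).im_pos
    rw [Function.comp, ← Complex.arg_real_mul _ hp]
    congr 1
    apply Complex.ext
    · rw [autFactor_re, hz.re_eq]
      simp only [Complex.mul_re, Complex.ofReal_re, Complex.add_re, Complex.ofReal_im, zero_mul,
        Complex.I_re, mul_zero, Complex.I_im, mul_one]
      field_simp
      ring
    · rw [autFactor_im]; simp; ring

/-- The directions of `c z + d` converge, and `horArea z (g z)` tends to `0` since one vertex goes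
to `∞`. The limit is the same for all vertical lines, which makes the twist at `∞` independent of
the geodesic. -/
lemma VerticalLimit.exists_innerTwist_tendsto (b : PSLCover) :
    ∃ τ, ∀ {X : Type} {l : Filter X} {z : X → ℍ} {x₀ : ℝ}, VerticalLimit l z x₀ →
      Tendsto (fun s => innerTwist b (z s)) l (𝓝 τ) := by
  set g := UniversalCover.proj b with hg
  refine ⟨-2 * (argVariation b + ((if g 1 0 = 0 then Complex.arg (g 1 1) else
    Complex.arg (g 1 0 * Complex.I)) - Complex.arg (autFactor g UpperHalfPlane.I))) + 0, ?_⟩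
  intro X l z x₀ hz
  simp_rw [innerTwist_eq, dirVariation, turn]
  refine Tendsto.add (((hz.arg_tendsto g).sub tendsto_const_nhds).const_add _ |>.const_mul _) ?_
  have := hz.horArea_tendsto_zero (g := 1) (by simp) g
  simpa using this

end limits

/-! ### Transport of the limit at infinity to any ideal point. -/

lemma innerTwist_conj (c a : PSLCover) (x : ℍ) :
    innerTwist (c * a * c⁻¹) (c • x) = innerTwist a x := by
  have h := dirVariation_sub_smul c (a • x) x
  have e : (c * a * c⁻¹) • c • x = c • a • x := by
    rw [← mul_smul, ← mul_smul]; congr 1; group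
  rw [innerTwist_eq', innerTwist_eq', e, dirVariation_mul', dirVariation_mul', dirVariation_inv,
    inv_smul_smul]
  have h2 := horArea_swap (c • x) (c • a • x)
  have h3 := horArea_swap x (a • x)
  linarith

lemma proj_surjective : Function.Surjective (UniversalCover.proj : PSLCover → SL(2, ℝ)) := by
  intro g
  obtain hφ := eq_frame (eq_norm_mul_exp_arg (autFactor g UpperHalfPlane.I))
  set z := g • UpperHalfPlane.I
  set φ := Complex.arg (autFactor g UpperHalfPlane.I)
  let γ : C(I, SL(2, ℝ)) := ⟨fun t => frame (interp t UpperHalfPlane.I z) (t * φ),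
    continuous_frame (continuous_interp continuous_id continuous_const continuous_const)
      (continuous_subtype_val.mul continuous_const)⟩
  have h0 : γ 0 = 1 := by
    apply sl_ext_of_smul_I
    · change frame _ _ • _ = _
      rw [frame_smul_I, one_smul]
      apply upperHalfPlane_ext
      · rw [interp_re]; simp
      · rw [interp_im]; simp
    · change autFactor (frame _ _) _ = _
      rw [autFactor_frame, interp_im, autFactor_one]; simp
  refine ⟨((⟨γ, h0⟩ : basedPaths SL(2, ℝ)) : PSLCover), ?_⟩
  change frame (interp 1 UpperHalfPlane.I z) (((1 : I) : ℝ) * φ) = g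
  rw [hφ, Set.Icc.coe_one, one_mul]
  congr 1
  apply upperHalfPlane_ext
  · rw [interp_re]; simp
  · rw [interp_im]; simp

lemma verticalLimit_translation {g : SL(2, ℝ)} (hc : g 1 0 = 0) :
    ∃ x₀, VerticalLimit atTop (fun s : ℝ => g • translation s • UpperHalfPlane.I) x₀ := by
  have h : VerticalLimit atTop (fun s : ℝ => translation s • UpperHalfPlane.I) 0 :=
    ⟨translation_smul_I_re, by simp_rw [translation_smul_I_im]; exact Real.tendsto_exp_atTop⟩
  obtain ⟨r, hr⟩ := h.re_smul_const hc
  exact ⟨r, hr, h.im_smul_tendsto_atTop hc⟩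

lemma exists_smul_infty (ξ : OnePoint ℝ) :
    ∃ θ, (rotationAtI θ : GL (Fin 2) ℝ) • (OnePoint.infty : OnePoint ℝ) = ξ := by
  induction ξ using OnePoint.rec with
  | infty =>
    refine ⟨0, ?_⟩
    rw [OnePoint.smul_infty_eq_self_iff]
    change rotationAtI 0 1 0 = 0
    simp [rotationAtI]
  | coe x =>
    -- Rotation through `θ` sends `∞` to `-cot (θ / 2)`, which equals `x` for this angle.
    refine ⟨Real.pi + 2 * Real.arctan x, ?_⟩
    have e : (Real.pi + 2 * Real.arctan x) / 2 = Real.arctan x + Real.pi / 2 := by ring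
    have hpos := Real.cos_arctan_pos x
    rw [OnePoint.smul_infty_eq_ite]
    have e1 : (rotationAtI (Real.pi + 2 * Real.arctan x) : GL (Fin 2) ℝ) 1 0 =
        -Real.cos (Real.arctan x) := by
      change -Real.sin ((Real.pi + 2 * Real.arctan x) / 2) = _
      rw [e, Real.sin_add_pi_div_two]
    have e2 : (rotationAtI (Real.pi + 2 * Real.arctan x) : GL (Fin 2) ℝ) 0 0 =
        -Real.sin (Real.arctan x) := by
      change Real.cos ((Real.pi + 2 * Real.arctan x) / 2) = _
      rw [e, Real.cos_add_pi_div_two]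
    rw [e1, e2, if_neg (by simpa using hpos.ne'), neg_div_neg_eq, ← Real.tan_eq_sin_div_cos,
      Real.tan_arctan]

lemma smul_infty_eq_iff {g : SL(2, ℝ)} :
    (g : GL (Fin 2) ℝ) • (OnePoint.infty : OnePoint ℝ) = OnePoint.infty ↔ g 1 0 = 0 :=
  OnePoint.smul_infty_eq_self_iff

/-- The twists at points tending to an ideal point converge to the twist there. -/
lemma tendsto_idealTwist (a : PSLCover) {ξ : OnePoint ℝ} {g : SL(2, ℝ)}
    (hg : (g : GL (Fin 2) ℝ) • OnePoint.infty = ξ) :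
    Tendsto (fun s : ℝ => innerTwist a (g • translation s • UpperHalfPlane.I)) atTop
      (𝓝 (idealTwist a ξ)) := by
  have key : ∃ τ : ℝ, ∀ h : SL(2, ℝ), (h : GL (Fin 2) ℝ) • OnePoint.infty = ξ →
      Tendsto (fun s : ℝ => innerTwist a (h • translation s • UpperHalfPlane.I)) atTop (𝓝 τ) := by
    -- Conjugation by a lift of `g` moves `ξ` to `∞`. Any other geodesic ending at `ξ` then becomes
    -- a vertical line, and `exists_innerTwist_tendsto` gives a common limit.
    obtain ⟨c, hc⟩ := proj_surjective g
    obtain ⟨τ, hτ⟩ := VerticalLimit.exists_innerTwist_tendsto (c⁻¹ * a * c)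
    refine ⟨τ, fun h hh => ?_⟩
    have h1 : (g⁻¹ * h) 1 0 = 0 := by
      rw [← smul_infty_eq_iff, map_mul, map_inv, mul_smul, hh, ← hg, inv_smul_smul]
    obtain ⟨x₀, hx⟩ := verticalLimit_translation h1
    refine (hτ hx).congr fun s => ?_
    have := innerTwist_conj c (c⁻¹ * a * c) ((g⁻¹ * h) • translation s • UpperHalfPlane.I)
    rw [← this]
    have e1 : c * (c⁻¹ * a * c) * c⁻¹ = a := by group
    rw [e1, cover_smul_def, hc, mul_smul, smul_inv_smul]
  exact Classical.epsilon_spec key g hg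

/-! ### Limits of triangles -/

/-- Applying `g₁⁻¹` sends the first vertex to `∞`. The two `horArea` terms of the sides at that
vertex vanish in the limit, so only the opposite side counts. -/
lemma tendsto_triArea {g₁ g₂ g₃ : SL(2, ℝ)} {c : ℝ}
    (h : Tendsto (fun s : ℝ => horArea ((g₁⁻¹ * g₂) • translation s • UpperHalfPlane.I)
      ((g₁⁻¹ * g₃) • translation s • UpperHalfPlane.I)) atTop (𝓝 c)) :
    Tendsto (fun s : ℝ => triArea (g₁ • translation s • UpperHalfPlane.I)
      (g₂ • translation s • UpperHalfPlane.I) (g₃ • translation s • UpperHalfPlane.I)) atTop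
      (𝓝 c) := by
  obtain ⟨x₀, hz⟩ := verticalLimit_translation (g := 1) (by simp)
  simp only [one_smul] at hz
  have h1 := hz.horArea_tendsto_zero (g := 1) (by simp) (g₁⁻¹ * g₂)
  have h3 := hz.horArea_tendsto_zero (g := 1) (by simp) (g₁⁻¹ * g₃)
  have h4 := (h1.add h).sub h3
  rw [zero_add, sub_zero] at h4
  refine h4.congr fun s => ?_
  rw [← triArea_smul g₁⁻¹ (g₁ • _), inv_smul_smul, ← mul_smul g₁⁻¹ g₂, ← mul_smul g₁⁻¹ g₃,
    triArea, one_smul, horArea_swap (translation s • UpperHalfPlane.I)]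
  ring

lemma tendsto_triArea_zero {g₁ g₂ g₃ : SL(2, ℝ)}
    (h : (g₁⁻¹ * g₂) 1 0 = 0 ∨ (g₁⁻¹ * g₃) 1 0 = 0 ∨
      (g₁⁻¹ * g₂) 0 0 / (g₁⁻¹ * g₂) 1 0 = (g₁⁻¹ * g₃) 0 0 / (g₁⁻¹ * g₃) 1 0) :
    Tendsto (fun s : ℝ => triArea (g₁ • translation s • UpperHalfPlane.I)
      (g₂ • translation s • UpperHalfPlane.I) (g₃ • translation s • UpperHalfPlane.I)) atTop
      (𝓝 0) := by
  obtain ⟨x₀, hz⟩ := verticalLimit_translation (g := 1) (by simp)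
  simp only [one_smul] at hz
  refine tendsto_triArea ?_
  by_cases c2 : (g₁⁻¹ * g₂) 1 0 = 0
  · exact hz.horArea_tendsto_zero c2 _
  by_cases c3 : (g₁⁻¹ * g₃) 1 0 = 0
  · have := (hz.horArea_tendsto_zero c3 (g₁⁻¹ * g₂)).neg
    rw [neg_zero] at this
    refine this.congr fun s => ?_
    rw [← horArea_swap]
  · exact hz.horArea_tendsto_zero' c2 c3 ((h.resolve_left c2).resolve_left c3)

lemma tendsto_triArea_pi {g₁ g₂ g₃ : SL(2, ℝ)}
    (c2 : (g₁⁻¹ * g₂) 1 0 ≠ 0) (c3 : (g₁⁻¹ * g₃) 1 0 ≠ 0)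
    (h : (g₁⁻¹ * g₂) 0 0 / (g₁⁻¹ * g₂) 1 0 < (g₁⁻¹ * g₃) 0 0 / (g₁⁻¹ * g₃) 1 0) :
    Tendsto (fun s : ℝ => triArea (g₁ • translation s • UpperHalfPlane.I)
      (g₂ • translation s • UpperHalfPlane.I) (g₃ • translation s • UpperHalfPlane.I)) atTop
      (𝓝 Real.pi) := by
  obtain ⟨x₀, hz⟩ := verticalLimit_translation (g := 1) (by simp)
  simp only [one_smul] at hz
  exact tendsto_triArea (hz.horArea_tendsto_pi c2 c3 h)

/-! ### The linear model of the closed hyperbolic plane -/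

/-- The vector of the linear model representing a point of the closed hyperbolic plane. -/
def modelVec : ClosedPlane → ℝ × ℝ × ℝ
  | Sum.inl z => (z.re, z.re ^ 2 + z.im ^ 2, 1)
  | Sum.inr ξ => OnePoint.elim ξ (0, 1, 0) (fun x : ℝ => (x, x ^ 2, 1))

@[simp] lemma modelVec_inl (z : ℍ) : modelVec (Sum.inl z) = (z.re, z.re ^ 2 + z.im ^ 2, 1) := rfl
@[simp] lemma modelVec_infty : modelVec (Sum.inr OnePoint.infty) = (0, 1, 0) := rfl
@[simp] lemma modelVec_real (x : ℝ) : modelVec (Sum.inr (x : OnePoint ℝ)) = (x, x ^ 2, 1) := rfl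

/-- The determinant of three vectors. -/
def det3 (u v w : ℝ × ℝ × ℝ) : ℝ :=
  u.1 * (v.2.1 * w.2.2 - v.2.2 * w.2.1) - u.2.1 * (v.1 * w.2.2 - v.2.2 * w.1) +
    u.2.2 * (v.1 * w.2.1 - v.2.1 * w.1)

/-- The action of an isometry on the linear model. -/
def modelMap (g : SL(2, ℝ)) (v : ℝ × ℝ × ℝ) : ℝ × ℝ × ℝ :=
  (g 0 0 * g 1 0 * v.2.1 + (g 0 0 * g 1 1 + g 0 1 * g 1 0) * v.1 + g 0 1 * g 1 1 * v.2.2,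
    g 0 0 ^ 2 * v.2.1 + 2 * (g 0 0 * g 0 1) * v.1 + g 0 1 ^ 2 * v.2.2,
    g 1 0 ^ 2 * v.2.1 + 2 * (g 1 0 * g 1 1) * v.1 + g 1 1 ^ 2 * v.2.2)

lemma modelMap_add (g : SL(2, ℝ)) (u v : ℝ × ℝ × ℝ) :
    modelMap g (u + v) = modelMap g u + modelMap g v := by
  ext <;> simp [modelMap] <;> ring

lemma modelMap_smul (g : SL(2, ℝ)) (c : ℝ) (v : ℝ × ℝ × ℝ) :
    modelMap g (c • v) = c • modelMap g v := by
  ext <;> simp [modelMap] <;> ring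

lemma det3_modelMap (g : SL(2, ℝ)) (u v w : ℝ × ℝ × ℝ) :
    det3 (modelMap g u) (modelMap g v) (modelMap g w) = det3 u v w := by
  have h := sl_det g
  have : det3 (modelMap g u) (modelMap g v) (modelMap g w) =
      (g 0 0 * g 1 1 - g 0 1 * g 1 0) ^ 3 * det3 u v w := by
    simp only [det3, modelMap]; ring
  rw [this, h]; ring

lemma det3_smul₁ (c : ℝ) (u v w : ℝ × ℝ × ℝ) : det3 (c • u) v w = c * det3 u v w := by
  simp [det3]; ring
lemma det3_smul₂ (c : ℝ) (u v w : ℝ × ℝ × ℝ) : det3 u (c • v) w = c * det3 u v w := by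
  simp [det3]; ring
lemma det3_smul₃ (c : ℝ) (u v w : ℝ × ℝ × ℝ) : det3 u v (c • w) = c * det3 u v w := by
  simp [det3]; ring
lemma det3_add₂ (u v v' w : ℝ × ℝ × ℝ) : det3 u (v + v') w = det3 u v w + det3 u v' w := by
  simp [det3]; ring
lemma det3_add₃ (u v w w' : ℝ × ℝ × ℝ) : det3 u v (w + w') = det3 u v w + det3 u v w' := by
  simp [det3]; ring
lemma det3_rotate (u v w : ℝ × ℝ × ℝ) : det3 v w u = det3 u v w := by
  simp [det3]; ring
lemma det3_swap (u v w : ℝ × ℝ × ℝ) : det3 u w v = -det3 u v w := by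
  simp [det3]; ring
lemma det3_self (u v : ℝ × ℝ × ℝ) : det3 u v v = 0 := by
  simp [det3]; ring
lemma det3_self' (u v : ℝ × ℝ × ℝ) : det3 u v u = 0 := by
  simp [det3]; ring

/-- Cramer's rule. -/
lemma det3_cramer (u v w z : ℝ × ℝ × ℝ) :
    det3 u v w • z = det3 v w z • u + det3 w u z • v + det3 u v z • w := by
  ext <;> simp [det3] <;> ring

/-- Points are rays in the symmetric square of the plane, with inner points as definite forms and
ideal points as squares. The scale is positive, being `|c z + d|²` at an inner point, so signs of
determinants are invariant. -/
lemma modelMap_modelVec (g : SL(2, ℝ)) (p : ClosedPlane) :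
    ∃ k : ℝ, 0 < k ∧ modelMap g (modelVec p) = k • modelVec (g • p) := by
  have hd := sl_det g
  rcases p with z | ξ
  · have hp : 0 < Complex.normSq (autFactor g z) := Complex.normSq_pos.2 (autFactor_ne_zero g z)
    have hn := normSq_autFactor g z
    refine ⟨_, hp, ?_⟩
    have e : g • (Sum.inl z : ClosedPlane) = Sum.inl (g • z) := rfl
    rw [e, modelVec_inl, modelVec_inl, re_sl_smul, im_sl_smul]
    have key : g 0 0 ^ 2 * (z.re ^ 2 + z.im ^ 2) + 2 * (g 0 0 * g 0 1) * z.re + g 0 1 ^ 2 =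
        ((((g 0 0 * z.re + g 0 1) * (g 1 0 * z.re + g 1 1) + g 0 0 * g 1 0 * z.im ^ 2)) ^ 2 +
          z.im ^ 2) / Complex.normSq (autFactor g z) := by
      rw [eq_div_iff hp.ne', hn]
      linear_combination z.im ^ 2 * (g 0 0 * g 1 1 - g 0 1 * g 1 0 + 1) * hd
    refine Prod.ext ?_ (Prod.ext ?_ ?_)
    · simp only [modelMap, Prod.smul_mk, smul_eq_mul]
      field_simp
      ring
    · simp only [modelMap, Prod.smul_mk, smul_eq_mul, mul_one]
      rw [key]
      field_simp
    · simp only [modelMap, Prod.smul_mk, smul_eq_mul, mul_one]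
      rw [hn]; ring
  · have e : g • (Sum.inr ξ : ClosedPlane) = Sum.inr ((g : GL (Fin 2) ℝ) • ξ) := rfl
    rw [e]
    have e00 : (g : GL (Fin 2) ℝ) 0 0 = g 0 0 := rfl
    have e01 : (g : GL (Fin 2) ℝ) 0 1 = g 0 1 := rfl
    have e10 : (g : GL (Fin 2) ℝ) 1 0 = g 1 0 := rfl
    have e11 : (g : GL (Fin 2) ℝ) 1 1 = g 1 1 := rfl
    induction ξ using OnePoint.rec with
    | infty =>
      rw [OnePoint.smul_infty_eq_ite, e00, e10]
      split_ifs with hc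
      · have ha : g 0 0 ≠ 0 := by intro h; simp [h, hc] at hd
        refine ⟨g 0 0 ^ 2, by positivity, ?_⟩
        simp [modelMap, hc]
      · refine ⟨g 1 0 ^ 2, by positivity, ?_⟩
        rw [modelVec_real]
        simp [modelMap]
        constructor <;> field_simp
    | coe x =>
      rw [OnePoint.smul_some_eq_ite, e00, e10, e01, e11]
      split_ifs with hc
      · have ha : g 0 0 * x + g 0 1 ≠ 0 := by
          intro h
          have : (g 0 0 * g 1 1 - g 0 1 * g 1 0) = 0 := by
            have h1 : g 1 1 = -(g 1 0 * x) := by linarith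
            have h2 : g 0 1 = -(g 0 0 * x) := by linarith
            rw [h1, h2]; ring
          rw [this] at hd; norm_num at hd
        refine ⟨(g 0 0 * x + g 0 1) ^ 2, by positivity, ?_⟩
        have h1 : g 1 1 = -(g 1 0 * x) := by linarith
        simp [modelMap, h1]
        refine ⟨?_, ?_, ?_⟩ <;> ring
      · refine ⟨(g 1 0 * x + g 1 1) ^ 2, by positivity, ?_⟩
        rw [modelVec_real]
        simp [modelMap]
        refine ⟨?_, ?_, ?_⟩
        · field_simp; ring
        · rw [div_pow, mul_div_cancel₀ _ (pow_ne_zero 2 hc)]; ring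
        · ring

/-- A linear form positive on all points: the cone they span contains no line, and coefficients in
positive combinations can be bounded. -/
lemma modelVec_height_pos (p : ClosedPlane) : 0 < (modelVec p).2.1 + (modelVec p).2.2 := by
  rcases p with z | ξ
  · simp; positivity
  · induction ξ using OnePoint.rec with
    | infty => simp
    | coe x => simp; positivity

lemma modelVec_injective {p q : ClosedPlane} {k : ℝ} (hk : 0 < k)
    (h : modelVec p = k • modelVec q) : p = q := by
  rcases p with z | ξ <;> rcases q with w | η
  · simp at h
    obtain ⟨h1, h2, h3⟩ := h
    rw [← h3] at h1 h2
    rw [one_mul] at h1 h2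
    congr 1
    refine upperHalfPlane_ext h1 ?_
    rw [h1] at h2
    nlinarith [z.im_pos, w.im_pos]
  · exfalso
    induction η using OnePoint.rec with
    | infty => simp at h
    | coe x =>
      simp at h
      obtain ⟨h1, h2, h3⟩ := h
      rw [← h3] at h1 h2
      rw [one_mul] at h1 h2
      rw [h1] at h2
      nlinarith [z.im_pos]
  · exfalso
    induction ξ using OnePoint.rec with
    | infty => simp at h; exact hk.ne' h.2.2.symm
    | coe x =>
      simp at h
      obtain ⟨h1, h2, h3⟩ := h
      rw [← h3] at h1 h2
      rw [one_mul] at h1 h2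
      rw [h1] at h2
      nlinarith [w.im_pos]
  · induction ξ using OnePoint.rec with
    | infty =>
      induction η using OnePoint.rec with
      | infty => rfl
      | coe y => simp at h; exact absurd h.2.2.symm hk.ne'
    | coe x =>
      induction η using OnePoint.rec with
      | infty => simp at h
      | coe y =>
        simp at h
        obtain ⟨h1, h2, h3⟩ := h
        rw [← h3, one_mul] at h1
        rw [h1]

/-- Orientation of three points of the closed hyperbolic plane: positive when anticlockwise. -/
def orient (p q r : ClosedPlane) : ℝ := det3 (modelVec p) (modelVec q) (modelVec r)

lemma orient_smul (g : SL(2, ℝ)) (p q r : ClosedPlane) :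
    ∃ k : ℝ, 0 < k ∧ orient p q r = k * orient (g • p) (g • q) (g • r) := by
  obtain ⟨a, ha, ea⟩ := modelMap_modelVec g p
  obtain ⟨b, hb, eb⟩ := modelMap_modelVec g q
  obtain ⟨c, hc, ec⟩ := modelMap_modelVec g r
  refine ⟨a * b * c, by positivity, ?_⟩
  rw [orient, ← det3_modelMap g, ea, eb, ec, det3_smul₁, det3_smul₂, det3_smul₃, orient]
  ring

lemma orient_smul_pos_iff (g : SL(2, ℝ)) (p q r : ClosedPlane) :
    0 < orient (g • p) (g • q) (g • r) ↔ 0 < orient p q r := by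
  obtain ⟨k, hk, e⟩ := orient_smul g p q r
  rw [e, mul_pos_iff_of_pos_left hk]

lemma orient_smul_eq_zero_iff (g : SL(2, ℝ)) (p q r : ClosedPlane) :
    orient (g • p) (g • q) (g • r) = 0 ↔ orient p q r = 0 := by
  obtain ⟨k, hk, e⟩ := orient_smul g p q r
  rw [e, mul_eq_zero, or_iff_right hk.ne']

lemma orient_rotate (p q r : ClosedPlane) : orient q r p = orient p q r := det3_rotate _ _ _
lemma orient_swap (p q r : ClosedPlane) : orient p r q = -orient p q r := det3_swap _ _ _
lemma orient_self (p q : ClosedPlane) : orient p q q = 0 := det3_self _ _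
lemma orient_self' (p q : ClosedPlane) : orient p q p = 0 := det3_self' _ _

/-! ### The standard geodesic -/

/-- Homogeneous coordinates on the imaginary axis. -/
def axisNum : EReal → ℝ
  | ⊥ => 0
  | ⊤ => 1
  -- The second model coordinate is `|z|²`, whence the exponent `2 s` at the point `i e^s`.
  | (s : ℝ) => Real.exp (2 * s)

/-- Homogeneous coordinates on the imaginary axis. -/
def axisDen : EReal → ℝ
  | ⊥ => 1
  | ⊤ => 0
  | (_ : ℝ) => 1

@[simp] lemma axisNum_bot : axisNum ⊥ = 0 := rfl
@[simp] lemma axisNum_top : axisNum ⊤ = 1 := rfl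
@[simp] lemma axisNum_coe (s : ℝ) : axisNum s = Real.exp (2 * s) := rfl
@[simp] lemma axisDen_bot : axisDen ⊥ = 1 := rfl
@[simp] lemma axisDen_top : axisDen ⊤ = 0 := rfl
@[simp] lemma axisDen_coe (s : ℝ) : axisDen s = 1 := rfl

lemma geodesic_eq_smul (g : SL(2, ℝ)) (s : EReal) : geodesic g s = g • geodesic 1 s := by
  induction s using EReal.rec with
  | bot => exact congrArg (g • ·) (one_smul SL(2, ℝ) (_ : ClosedPlane)).symm
  | top => exact congrArg (g • ·) (one_smul SL(2, ℝ) (_ : ClosedPlane)).symm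
  | coe s => exact congrArg (g • ·) (one_smul SL(2, ℝ) (_ : ClosedPlane)).symm

lemma geodesic_mul (g h : SL(2, ℝ)) (s : EReal) : geodesic (g * h) s = g • geodesic h s := by
  rw [geodesic_eq_smul, geodesic_eq_smul h, mul_smul]

lemma geodesic_one_coe (s : ℝ) :
    geodesic 1 (s : EReal) = Sum.inl (translation s • UpperHalfPlane.I) := by
  have : geodesic 1 (s : EReal) =
    (1 : SL(2, ℝ)) • (Sum.inl (translation s • UpperHalfPlane.I) : ClosedPlane) := rfl
  rw [this, one_smul]

lemma geodesic_one_bot : geodesic 1 ⊥ = Sum.inr ((0 : ℝ) : OnePoint ℝ) :=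
  one_smul SL(2, ℝ) (Sum.inr ((0 : ℝ) : OnePoint ℝ) : ClosedPlane)

lemma geodesic_one_top : geodesic 1 ⊤ = Sum.inr OnePoint.infty :=
  one_smul SL(2, ℝ) (Sum.inr OnePoint.infty : ClosedPlane)

lemma modelVec_geodesic_one (s : EReal) : modelVec (geodesic 1 s) = (0, axisNum s, axisDen s) := by
  induction s using EReal.rec with
  | bot => rw [geodesic_one_bot]; simp
  | top => rw [geodesic_one_top]; simp
  | coe s =>
    rw [geodesic_one_coe, modelVec_inl, translation_smul_I_re, translation_smul_I_im]
    simp [← Real.exp_nat_mul]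

lemma axis_nonneg (s : EReal) : 0 ≤ axisNum s ∧ 0 ≤ axisDen s := by
  induction s using EReal.rec with
  | bot => simp
  | top => simp
  | coe s => simp [(Real.exp_pos _).le]

/-- The parameter increases with the ratio `axisNum / axisDen`; cross multiplication includes the
two ideal ends. -/
lemma axis_lt_iff (s t : EReal) : s < t ↔ axisNum s * axisDen t < axisNum t * axisDen s := by
  induction s using EReal.rec <;> induction t using EReal.rec <;> simp [Real.exp_pos]
  exact (Real.exp_pos _).le

lemma axis_le_iff (s t : EReal) : s ≤ t ↔ axisNum s * axisDen t ≤ axisNum t * axisDen s := by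
  rw [← not_lt, ← not_lt, axis_lt_iff]

lemma exists_axis {p q : ℝ} (hp : 0 ≤ p) (hq : 0 ≤ q) (h : p ≠ 0 ∨ q ≠ 0) :
    ∃ (s : EReal) (k : ℝ), 0 < k ∧ p = k * axisNum s ∧ q = k * axisDen s := by
  rcases hp.eq_or_lt with rfl | hp
  · have hq' : 0 < q := lt_of_le_of_ne hq (h.resolve_left (by simp)).symm
    exact ⟨⊥, q, hq', by simp, by simp⟩
  rcases hq.eq_or_lt with rfl | hq
  · exact ⟨⊤, p, hp, by simp, by simp⟩
  · refine ⟨((Real.log (p / q) / 2 : ℝ) : EReal), q, hq, ?_, by simp⟩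
    rw [axisNum_coe, mul_div_cancel₀ _ two_ne_zero, Real.exp_log (by positivity)]
    field_simp

/-- A point of the standard geodesic between two others is a positive combination of them. -/
lemma modelVec_geodesic_between {a s b : EReal} (h1 : a ≤ s) (h2 : s ≤ b) :
    ∃ α β : ℝ, 0 ≤ α ∧ 0 ≤ β ∧ modelVec (geodesic 1 s) =
      α • modelVec (geodesic 1 a) + β • modelVec (geodesic 1 b) := by
  simp only [modelVec_geodesic_one]
  rcases (h1.trans h2).eq_or_lt with h | h
  · have : s = a := le_antisymm (h ▸ h2) h1
    exact ⟨1, 0, zero_le_one, le_rfl, by simp [this]⟩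
  · rw [axis_lt_iff] at h
    rw [axis_le_iff] at h1 h2
    have hd := sub_pos.2 h
    have hne := hd.ne'
    refine ⟨(axisNum b * axisDen s - axisNum s * axisDen b) /
      (axisNum b * axisDen a - axisNum a * axisDen b),
      (axisNum s * axisDen a - axisNum a * axisDen s) /
      (axisNum b * axisDen a - axisNum a * axisDen b),
      div_nonneg (sub_nonneg.2 h2) hd.le, div_nonneg (sub_nonneg.2 h1) hd.le, ?_⟩
    refine Prod.ext (by simp) (Prod.ext ?_ ?_)
    · simp only [Prod.smul_mk, smul_eq_mul, Prod.mk_add_mk]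
      rw [div_mul_eq_mul_div, div_mul_eq_mul_div, ← add_div, eq_div_iff hne]
      ring
    · simp only [Prod.smul_mk, smul_eq_mul, Prod.mk_add_mk]
      rw [div_mul_eq_mul_div, div_mul_eq_mul_div, ← add_div, eq_div_iff hne]
      ring

/-- A nonnegative combination of two points of the standard geodesic is between them. -/
lemma exists_geodesic_between {a b : EReal} (hab : a ≤ b) {α β : ℝ} (hα : 0 ≤ α) (hβ : 0 ≤ β)
    (h : α • modelVec (geodesic 1 a) + β • modelVec (geodesic 1 b) ≠ 0) :
    ∃ (s : EReal) (k : ℝ), a ≤ s ∧ s ≤ b ∧ 0 < k ∧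
      α • modelVec (geodesic 1 a) + β • modelVec (geodesic 1 b) = k • modelVec (geodesic 1 s) := by
  simp only [modelVec_geodesic_one] at h ⊢
  have na := axis_nonneg a
  have nb := axis_nonneg b
  obtain ⟨s, k, hk, e1, e2⟩ := exists_axis
    (p := α * axisNum a + β * axisNum b) (q := α * axisDen a + β * axisDen b)
    (add_nonneg (mul_nonneg hα na.1) (mul_nonneg hβ nb.1))
    (add_nonneg (mul_nonneg hα na.2) (mul_nonneg hβ nb.2)) (by
      by_contra hcon
      push Not at hcon
      exact h (by simp [hcon.1, hcon.2]))
  rw [axis_le_iff] at hab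
  refine ⟨s, k, ?_, ?_, hk, by simp [← e1, ← e2]⟩
  · rw [axis_le_iff, ← mul_le_mul_iff_of_pos_left hk]
    have : k * (axisNum a * axisDen s) = axisNum a * (k * axisDen s) := by ring
    rw [this, ← e2, ← mul_assoc, ← e1]
    nlinarith
  · rw [axis_le_iff, ← mul_le_mul_iff_of_pos_left hk]
    have : k * (axisNum b * axisDen s) = axisNum b * (k * axisDen s) := by ring
    rw [this, ← e2, ← mul_assoc, ← e1]
    nlinarith

/-! ### Geodesics through two points and convex hulls -/

lemma smul_inl (g : SL(2, ℝ)) (z : ℍ) : g • (Sum.inl z : ClosedPlane) = Sum.inl (g • z) := rfl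
lemma smul_inr (g : SL(2, ℝ)) (ξ : OnePoint ℝ) :
    g • (Sum.inr ξ : ClosedPlane) = Sum.inr ((g : GL (Fin 2) ℝ) • ξ) := rfl

lemma geodesic_zero (g : SL(2, ℝ)) : geodesic g 0 = Sum.inl (g • UpperHalfPlane.I) := by
  rw [geodesic_eq_smul, ← EReal.coe_zero, geodesic_one_coe, translation_zero, one_smul]; rfl

lemma exists_geodesic_inl (y : ℍ) {q : ClosedPlane} (h : Sum.inl y ≠ q) :
    ∃ (g : SL(2, ℝ)) (b : EReal), 0 < b ∧ geodesic g 0 = Sum.inl y ∧ geodesic g b = q := by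
  rcases q with w | ξ
  · obtain ⟨g, d, hd, h1, h2⟩ := exists_geodesic y w
    refine ⟨g, d, ?_, by rw [geodesic_zero, h1], by
      rw [geodesic_eq_smul, geodesic_one_coe, smul_inl, h2]⟩
    rcases hd.eq_or_lt with rfl | hd
    · rw [translation_zero, one_smul, h1] at h2
      exact absurd (congrArg Sum.inl h2) h
    · exact_mod_cast hd
  · obtain ⟨θ, hθ⟩ := exists_smul_infty ((y.toSL2R : GL (Fin 2) ℝ)⁻¹ • ξ)
    refine ⟨y.toSL2R * rotationAtI θ, ⊤, EReal.zero_lt_top, ?_, ?_⟩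
    · rw [geodesic_zero, mul_smul, rotationAtI_smul_I, UpperHalfPlane.toSL2R_smul_I]
    · rw [geodesic_eq_smul, geodesic_one_top, smul_inr, map_mul, mul_smul, hθ, smul_inv_smul]

/-- Used to reverse a geodesic, so that one may start at an ideal point and end at an inner one. -/
lemma geodesic_rotationAtI_pi (s : EReal) :
    geodesic (rotationAtI Real.pi) s = geodesic 1 (-s) := by
  have e10 : rotationAtI Real.pi 1 0 = -1 := by simp [rotationAtI]
  have e11 : rotationAtI Real.pi 1 1 = 0 := by simp [rotationAtI]
  have e00 : rotationAtI Real.pi 0 0 = 0 := by simp [rotationAtI]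
  have e01 : rotationAtI Real.pi 0 1 = 1 := by simp [rotationAtI]
  obtain ⟨k, hk, e⟩ := modelMap_modelVec (rotationAtI Real.pi) (geodesic 1 s)
  rw [← geodesic_eq_smul] at e
  obtain ⟨t, ht, et⟩ : ∃ t : ℝ, 0 < t ∧
      modelMap (rotationAtI Real.pi) (modelVec (geodesic 1 s)) = t • modelVec (geodesic 1 (-s)) := by
    simp only [modelVec_geodesic_one, modelMap, e10, e11, e00, e01]
    induction s using EReal.rec with
    | bot => exact ⟨1, one_pos, by simp⟩
    | top => exact ⟨1, one_pos, by simp⟩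
    | coe s =>
      refine ⟨Real.exp (2 * s), Real.exp_pos _, ?_⟩
      have e2 : Real.exp (2 * s) * Real.exp (2 * -s) = 1 := by
        rw [← Real.exp_add]; simp
      rw [← EReal.coe_neg]
      simp only [axisNum_coe, axisDen_coe, Prod.smul_mk, smul_eq_mul, e2]
      simp
  refine modelVec_injective (k := k⁻¹ * t) (by positivity) ?_
  rw [mul_smul, ← et, e, inv_smul_smul₀ hk.ne']

lemma exists_geodesic_closed {p q : ClosedPlane} (h : p ≠ q) :
    ∃ (g : SL(2, ℝ)) (a b : EReal), a < b ∧ geodesic g a = p ∧ geodesic g b = q := by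
  rcases p with y | ξ
  · obtain ⟨g, b, hb, h1, h2⟩ := exists_geodesic_inl y h
    exact ⟨g, 0, b, hb, h1, h2⟩
  rcases q with w | η
  · obtain ⟨g, b, hb, h1, h2⟩ := exists_geodesic_inl w h.symm
    refine ⟨g * rotationAtI Real.pi, -b, 0, by rwa [EReal.neg_lt_comm, neg_zero], ?_, ?_⟩
    · rw [geodesic_mul, geodesic_rotationAtI_pi, neg_neg, ← geodesic_eq_smul, h2]
    · rw [geodesic_mul, geodesic_rotationAtI_pi, neg_zero, ← geodesic_eq_smul, h1]
  · obtain ⟨θ, hθ⟩ := exists_smul_infty η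
    set r := rotationAtI θ
    obtain ⟨ζ, hζ⟩ : ∃ ζ, ζ = (r : GL (Fin 2) ℝ)⁻¹ • ξ := ⟨_, rfl⟩
    have hζ' : (r : GL (Fin 2) ℝ) • ζ = ξ := by
      rw [hζ, smul_inv_smul]
    induction ζ using OnePoint.rec with
    | infty => exact absurd (by rw [← hθ, ← hζ']) h
    | coe x =>
      let n : SL(2, ℝ) := ⟨!![1, x; 0, 1], by simp [Matrix.det_fin_two]⟩
      have hn1 : (n : GL (Fin 2) ℝ) • (OnePoint.infty : OnePoint ℝ) = OnePoint.infty := by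
        rw [OnePoint.smul_infty_eq_self_iff]; rfl
      have hn0 : (n : GL (Fin 2) ℝ) • ((0 : ℝ) : OnePoint ℝ) = (x : OnePoint ℝ) := by
        rw [OnePoint.smul_some_eq_ite]
        have e00 : (n : GL (Fin 2) ℝ) 0 0 = 1 := rfl
        have e01 : (n : GL (Fin 2) ℝ) 0 1 = x := rfl
        have e10 : (n : GL (Fin 2) ℝ) 1 0 = 0 := rfl
        have e11 : (n : GL (Fin 2) ℝ) 1 1 = 1 := rfl
        rw [e00, e01, e10, e11]; simp
      refine ⟨r * n, ⊥, ⊤, bot_lt_top, ?_, ?_⟩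
      · rw [geodesic_eq_smul, geodesic_one_bot, mul_smul, smul_inr, hn0, smul_inr, hζ']
      · rw [geodesic_eq_smul, geodesic_one_top, mul_smul, smul_inr, hn1, smul_inr, hθ]

lemma comb_modelVec_ne_zero {p q : ClosedPlane} {α β : ℝ} (hα : 0 ≤ α) (hβ : 0 ≤ β)
    (h : 0 < α ∨ 0 < β) : α • modelVec p + β • modelVec q ≠ 0 := by
  intro e
  have h1 := congrArg (fun v : ℝ × ℝ × ℝ => v.2.1 + v.2.2) e
  have h2 := modelVec_height_pos p
  have h3 := modelVec_height_pos q
  simp at h1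
  rcases h with h | h <;> nlinarith [mul_nonneg hα h2.le, mul_nonneg hβ h3.le, mul_pos h h2,
    mul_pos h h3]

/-- A nonnegative combination of two points is a multiple of a point of the segment. -/
lemma exists_mem_segment (p q : ClosedPlane) {α β : ℝ} (hα : 0 ≤ α) (hβ : 0 ≤ β)
    (h : 0 < α ∨ 0 < β) : ∃ w ∈ geodesicSegment p q, ∃ k : ℝ, 0 < k ∧
      α • modelVec p + β • modelVec q = k • modelVec w := by
  have key : ∀ (g : SL(2, ℝ)) (a b : EReal), a ≤ b → ∃ w ∈ geodesicSegment (geodesic g a)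
      (geodesic g b), ∃ k : ℝ, 0 < k ∧
      α • modelVec (geodesic g a) + β • modelVec (geodesic g b) = k • modelVec w := by
    intro g a b hab
    obtain ⟨c, hc, ec⟩ := modelMap_modelVec g (geodesic 1 a)
    obtain ⟨d, hd, ed⟩ := modelMap_modelVec g (geodesic 1 b)
    rw [← geodesic_eq_smul] at ec ed
    have ec' : modelVec (geodesic g a) = c⁻¹ • modelMap g (modelVec (geodesic 1 a)) := by
      rw [ec, inv_smul_smul₀ hc.ne']
    have ed' : modelVec (geodesic g b) = d⁻¹ • modelMap g (modelVec (geodesic 1 b)) := by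
      rw [ed, inv_smul_smul₀ hd.ne']
    have pc := inv_pos.2 hc
    have pd := inv_pos.2 hd
    obtain ⟨s, k, h1, h2, hk, e⟩ := exists_geodesic_between hab (mul_nonneg hα pc.le)
      (mul_nonneg hβ pd.le) (comb_modelVec_ne_zero (mul_nonneg hα pc.le)
      (mul_nonneg hβ pd.le) (h.imp (fun h => mul_pos h pc) (fun h => mul_pos h pd)))
    obtain ⟨m, hm, em⟩ := modelMap_modelVec g (geodesic 1 s)
    rw [← geodesic_eq_smul] at em
    refine ⟨geodesic g s, ⟨g, a, s, b, h1, h2, rfl, rfl, rfl⟩, k * m, by positivity, ?_⟩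
    rw [ec', ed', mul_smul k m, ← em, ← modelMap_smul g k, ← e, modelMap_add, modelMap_smul,
      modelMap_smul, mul_smul, mul_smul]
  by_cases hpq : p = q
  · have hp : ∃ (g : SL(2, ℝ)) (a : EReal), geodesic g a = p := by
      by_cases h0 : p = Sum.inr OnePoint.infty
      · exact ⟨1, ⊤, by rw [geodesic_one_top, h0]⟩
      · obtain ⟨g, a, b, -, h1, -⟩ := exists_geodesic_closed h0
        exact ⟨g, a, h1⟩
    obtain ⟨g, a, rfl⟩ := hp
    subst hpq
    exact key g a a le_rfl
  · obtain ⟨g, a, b, hab, rfl, rfl⟩ := exists_geodesic_closed hpq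
    exact key g a b hab.le

lemma mem_segment_comb {p q w : ClosedPlane} (h : w ∈ geodesicSegment p q) :
    ∃ α β : ℝ, 0 ≤ α ∧ 0 ≤ β ∧ modelVec w = α • modelVec p + β • modelVec q := by
  obtain ⟨g, a, s, b, h1, h2, rfl, rfl, rfl⟩ := h
  obtain ⟨α, β, hα, hβ, e⟩ := modelVec_geodesic_between h1 h2
  obtain ⟨c, hc, ec⟩ := modelMap_modelVec g (geodesic 1 a)
  obtain ⟨d, hd, ed⟩ := modelMap_modelVec g (geodesic 1 b)
  obtain ⟨m, hm, em⟩ := modelMap_modelVec g (geodesic 1 s)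
  rw [← geodesic_eq_smul] at ec ed em
  refine ⟨m⁻¹ * (α * c), m⁻¹ * (β * d), by positivity, by positivity, ?_⟩
  rw [mul_smul, mul_smul, mul_smul, mul_smul, ← ec, ← ed, ← smul_add, ← modelMap_smul,
    ← modelMap_smul, ← modelMap_add, ← e, em, inv_smul_smul₀ hm.ne']

/-! ### Convex hulls as cones in the linear model. -/

/-- The cone of the nonnegative combinations of the points of `S`. -/
def modelCone (S : Set ClosedPlane) : Submodule ℝ≥0 (ℝ × ℝ × ℝ) :=
  Submodule.span ℝ≥0 (modelVec '' S)

/-- Segments consist of nonnegative combinations of their ends, so the points in the cone form a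
geodesically convex set containing `S`. -/
lemma geodesicHull_subset_cone {S : Set ClosedPlane} {p : ClosedPlane}
    (h : p ∈ geodesicHull S) : modelVec p ∈ modelCone S := by
  refine h {p | modelVec p ∈ modelCone S} ⟨fun q hq => Submodule.subset_span ⟨q, hq, rfl⟩, ?_⟩
  intro x hx y hy w hw
  obtain ⟨α, β, hα, hβ, e⟩ := mem_segment_comb hw
  change modelVec w ∈ modelCone S
  rw [e]
  exact add_mem ((modelCone S).smul_mem ⟨α, hα⟩ hx) ((modelCone S).smul_mem ⟨β, hβ⟩ hy)

/-- The open geodesic triangle, if its vertices are in anticlockwise order. -/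
def openTriangle (u v w : ClosedPlane) : Set ℍ :=
  {z | 0 < orient u v (Sum.inl z) ∧ 0 < orient v w (Sum.inl z) ∧ 0 < orient w u (Sum.inl z)}

/-- Evaluate the height form on Cramer's rule: the right side is positive, and so is the height of
`z`. -/
lemma orient_pos_of_openTriangle {u v w : ClosedPlane} {z : ℍ} (h : z ∈ openTriangle u v w) :
    0 < orient u v w := by
  obtain ⟨h1, h2, h3⟩ := h
  have e := congrArg (fun v : ℝ × ℝ × ℝ => v.2.1 + v.2.2)
    (det3_cramer (modelVec u) (modelVec v) (modelVec w) (modelVec (Sum.inl z)))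
  have hu := modelVec_height_pos u
  have hv := modelVec_height_pos v
  have hw := modelVec_height_pos w
  have hz := modelVec_height_pos (Sum.inl z)
  have p1 := mul_pos h1 hw
  have p2 := mul_pos h2 hu
  have p3 := mul_pos h3 hv
  simp only [Prod.smul_fst, Prod.smul_snd, Prod.fst_add, Prod.snd_add, smul_eq_mul] at e
  change orient u v w * _ + orient u v w * _ = orient v w _ * _ + orient w u _ * _ +
    orient u v _ * _ + (orient v w _ * _ + orient w u _ * _ + orient u v _ * _) at e
  by_contra hcon
  push Not at hcon
  nlinarith [mul_nonneg (neg_nonneg.2 hcon) hz.le]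

/-- By Cramer's rule `z` is a positive combination of the vertices. Combining `v` and `w` gives a
point `x` of the side, and combining `u` with `x` gives `z`. -/
lemma openTriangle_subset_hull {S : Set ClosedPlane} {u v w : ClosedPlane} (hu : u ∈ S)
    (hv : v ∈ S) (hw : w ∈ S) {z : ℍ} (h : z ∈ openTriangle u v w) :
    Sum.inl z ∈ geodesicHull S := by
  rintro T ⟨hST, hT⟩
  have hD := orient_pos_of_openTriangle h
  obtain ⟨h1, h2, h3⟩ := h
  have e := det3_cramer (modelVec u) (modelVec v) (modelVec w) (modelVec (Sum.inl z))
  obtain ⟨x, hx, k, hk, ex⟩ := exists_mem_segment v w h3.le h1.le (Or.inl h3)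
  have hxT := hT v (hST hv) w (hST hw) hx
  obtain ⟨y, hy, m, hm, ey⟩ := exists_mem_segment u x h2.le hk.le (Or.inl h2)
  have hyT := hT u (hST hu) x hxT hy
  rw [← ex, ← add_assoc] at ey
  have e2 := e.trans ey
  have : Sum.inl z = y := by
    refine modelVec_injective (k := (orient u v w)⁻¹ * m) (by positivity) ?_
    rw [mul_smul, ← e2]
    exact (inv_smul_smul₀ hD.ne' _).symm
  rw [this]
  exact hyT

/-- With `p` and `q` moved to the imaginary axis, the determinant is a negative multiple of the
first coordinate of `r`. -/
lemma clockwiseTriangle_of_orient_neg {p q r : ClosedPlane} (h : orient p q r < 0) :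
    ClockwiseTriangle p q r := by
  have hpq : p ≠ q := by
    rintro rfl
    rw [← orient_rotate, orient_self'] at h
    exact lt_irrefl _ h
  obtain ⟨g, a, b, hab, rfl, rfl⟩ := exists_geodesic_closed hpq
  refine ⟨g, a, b, hab, rfl, rfl, ?_⟩
  obtain ⟨k, hk, e⟩ := orient_smul g⁻¹ (geodesic g a) (geodesic g b) r
  rw [geodesic_eq_smul g a, geodesic_eq_smul g b, inv_smul_smul, inv_smul_smul,
    ← geodesic_eq_smul, ← geodesic_eq_smul] at e
  rw [e] at h
  have h2 : orient (geodesic 1 a) (geodesic 1 b) (g⁻¹ • r) < 0 := by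
    by_contra hcon; push Not at hcon
    nlinarith [mul_nonneg hk.le hcon]
  rw [orient, modelVec_geodesic_one, modelVec_geodesic_one] at h2
  rw [axis_lt_iff] at hab
  have h3 : 0 < (modelVec (g⁻¹ • r)).1 := by
    by_contra hcon; push Not at hcon
    simp only [det3] at h2
    nlinarith [mul_nonneg (neg_nonneg.2 hcon) (sub_nonneg.2 hab.le)]
  rcases hr : g⁻¹ • r with z | ξ
  · rw [hr] at h3
    exact Or.inl ⟨z, h3, rfl⟩
  · rw [hr] at h3
    induction ξ using OnePoint.rec with
    | infty => simp at h3
    | coe x => exact Or.inr ⟨x, h3, rfl⟩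

/-! ### The fan triangulation of a convex polygon -/

lemma mem_modelCone_induction {S : Set ClosedPlane} {P : ℝ × ℝ × ℝ → Prop} (h0 : P 0)
    (hS : ∀ p ∈ S, P (modelVec p)) (hadd : ∀ v w, P v → P w → P (v + w))
    (hsmul : ∀ (c : ℝ) (v), 0 ≤ c → P v → P (c • v)) {v : ℝ × ℝ × ℝ} (hv : v ∈ modelCone S) :
    P v := by
  refine Submodule.span_induction (p := fun v _ => P v) ?_ h0 (fun v w _ _ => hadd v w)
    (fun (c : ℝ≥0) v _ h => hsmul c v c.2 h) hv
  rintro _ ⟨p, hp, rfl⟩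
  exact hS p hp

lemma det3_cone_nonneg {S : Set ClosedPlane} {u v w : ℝ × ℝ × ℝ}
    (h : ∀ p ∈ S, 0 ≤ det3 u v (modelVec p)) (hw : w ∈ modelCone S) : 0 ≤ det3 u v w := by
  refine mem_modelCone_induction (P := fun w => 0 ≤ det3 u v w) ?_ h ?_ ?_ hw
  · simp [det3]
  · intro v w h1 h2; rw [det3_add₃]; exact add_nonneg h1 h2
  · intro c v hc h1; rw [det3_smul₃]; exact mul_nonneg hc h1

lemma det3_cone_cone_nonneg {S T : Set ClosedPlane} {u v w : ℝ × ℝ × ℝ}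
    (h : ∀ p ∈ S, ∀ q ∈ T, 0 ≤ det3 u (modelVec p) (modelVec q)) (hv : v ∈ modelCone S)
    (hw : w ∈ modelCone T) : 0 ≤ det3 u v w := by
  refine mem_modelCone_induction (P := fun v => 0 ≤ det3 u v w) ?_ ?_ ?_ ?_ hv
  · simp [det3]
  · intro p hp; exact det3_cone_nonneg (h p hp) hw
  · intro v w h1 h2; rw [det3_add₂]; exact add_nonneg h1 h2
  · intro c v hc h1; rw [det3_smul₂]; exact mul_nonneg hc h1

/-- The number `ε = ±1` selects a side of the line `x z`. A sum of terms of one sign vanishes only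
if each does, and then only multiples of `x` have been added. -/
lemma det3_cone_strict {S : Set ClosedPlane} {x : ClosedPlane} {z w : ℝ × ℝ × ℝ} (ε : ℝ)
    (h : ∀ p ∈ S, 0 ≤ ε * det3 (modelVec x) (modelVec p) z ∧
      (det3 (modelVec x) (modelVec p) z = 0 → p = x)) (hε : ε ≠ 0) (hw : w ∈ modelCone S) :
    0 ≤ ε * det3 (modelVec x) w z ∧
      (det3 (modelVec x) w z = 0 → ∃ c : ℝ, w = c • modelVec x) := by
  refine mem_modelCone_induction (P := fun w => 0 ≤ ε * det3 (modelVec x) w z ∧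
      (det3 (modelVec x) w z = 0 → ∃ c : ℝ, w = c • modelVec x)) ?_ ?_ ?_ ?_ hw
  · exact ⟨by simp [det3], fun _ => ⟨0, by simp⟩⟩
  · intro p hp
    exact ⟨(h p hp).1, fun e => ⟨1, by rw [(h p hp).2 e, one_smul]⟩⟩
  · rintro v w ⟨v1, v2⟩ ⟨w1, w2⟩
    rw [det3_add₂]
    refine ⟨by rw [mul_add]; exact add_nonneg v1 w1, fun e => ?_⟩
    have e1 : ε * det3 (modelVec x) v z + ε * det3 (modelVec x) w z = 0 := by
      rw [← mul_add, e, mul_zero]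
    have e2 : ε * det3 (modelVec x) v z = 0 := by linarith
    have e3 : ε * det3 (modelVec x) w z = 0 := by linarith
    obtain ⟨a, ha⟩ := v2 ((mul_eq_zero.1 e2).resolve_left hε)
    obtain ⟨b, hb⟩ := w2 ((mul_eq_zero.1 e3).resolve_left hε)
    exact ⟨a + b, by rw [ha, hb, add_smul]⟩
  · rintro c v hc ⟨v1, v2⟩
    rw [det3_smul₂]
    refine ⟨by rw [mul_left_comm]; exact mul_nonneg hc v1, fun e => ?_⟩
    rcases mul_eq_zero.1 e with rfl | e
    · exact ⟨0, by simp⟩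
    · obtain ⟨a, ha⟩ := v2 e
      exact ⟨c * a, by rw [ha, mul_smul]⟩

/-- The polygon with vertices `x :: l` is convex and described anticlockwise. -/
def OrientedConvex (l : List ClosedPlane) : Prop :=
  ∀ a b c : ClosedPlane, [a, b, c].Sublist l → 0 ≤ orient a b c

/-- A point on no line through two different vertices. -/
def GenericPoint (l : List ClosedPlane) (z : ℍ) : Prop :=
  (∀ a ∈ l, Sum.inl z ≠ a) ∧ ∀ a ∈ l, ∀ b ∈ l, a ≠ b → orient a b (Sum.inl z) ≠ 0

/-! ### Sign changes along a list. -/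

lemma pair_sublist {X : Type*} {a b : X} {P Q : List X} (ha : a ∈ P) (hb : b ∈ Q) :
    [a, b].Sublist (P ++ Q) :=
  (List.singleton_sublist.2 ha).append (List.singleton_sublist.2 hb)

lemma exists_sign_split {X : Type*} (s : X → ℝ) (L : List X)
    (h : ∀ a b, [a, b].Sublist L → 0 < s a → 0 ≤ s b) :
    ∃ N P, L = N ++ P ∧ (∀ a ∈ N, s a ≤ 0) ∧ ∀ a ∈ P, 0 ≤ s a := by
  induction L with
  | nil => exact ⟨[], [], rfl, by simp, by simp⟩
  | cons c L ih =>
    by_cases hc : s c ≤ 0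
    · obtain ⟨N, P, rfl, hN, hP⟩ := ih fun a b hab => h a b (hab.cons c)
      exact ⟨c :: N, P, rfl, by simpa [hc] using hN, hP⟩
    · push Not at hc
      refine ⟨[], c :: L, rfl, by simp, ?_⟩
      intro a ha
      rcases List.mem_cons.1 ha with rfl | ha
      · exact hc.le
      · exact h c a ((List.singleton_sublist.2 ha).cons_cons c) hc

/-- A discrete intermediate value theorem: `hmid` forbids zeros between a positive and a later
negative value, so the sign must jump between neighbours. -/
lemma exists_adjacent {X : Type*} (s : X → ℝ) (L : List X)
    (hmid : ∀ a k b, [a, k, b].Sublist L → 0 < s a → s b < 0 → s k ≠ 0)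
    (h : ∃ a b, [a, b].Sublist L ∧ 0 < s a ∧ s b < 0) :
    ∃ a b, [a, b] <:+: L ∧ 0 < s a ∧ s b < 0 := by
  induction L with
  | nil => obtain ⟨a, b, h, -⟩ := h; simp at h
  | cons c L ih =>
    have step : (∃ a b, [a, b].Sublist L ∧ 0 < s a ∧ s b < 0) →
        ∃ a b, [a, b] <:+: c :: L ∧ 0 < s a ∧ s b < 0 := fun h' => by
      obtain ⟨a, b, hab, h1, h2⟩ := ih (fun a k b hs => hmid a k b (hs.cons c)) h'
      exact ⟨a, b, hab.trans (List.suffix_cons c L).isInfix, h1, h2⟩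
    obtain ⟨a, b, hab, ha, hb⟩ := h
    rcases List.sublist_cons_iff.1 hab with hab | ⟨r, hr, hrL⟩
    · exact step ⟨a, b, hab, ha, hb⟩
    · obtain ⟨rfl, rfl⟩ := List.cons.inj hr
      have hbL := List.singleton_sublist.1 hrL
      cases L with
      | nil => simp at hbL
      | cons d L =>
        rcases lt_trichotomy (s d) 0 with hd | hd | hd
        · exact ⟨a, d, (List.prefix_append [a, d] L).isInfix, ha, hd⟩
        · have hbd : b ≠ d := by rintro rfl; linarith
          have hbL' := (List.mem_cons.1 hbL).resolve_left hbd
          exact absurd hd (hmid a d b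
            (((List.singleton_sublist.2 hbL').cons_cons d).cons_cons a) ha hb)
        · have hbd : b ≠ d := by rintro rfl; linarith
          have hbL' := (List.mem_cons.1 hbL).resolve_left hbd
          exact step ⟨d, b, (List.singleton_sublist.2 hbL').cons_cons d, hd, hb⟩

section fan

variable {x : ClosedPlane} {L : List ClosedPlane} {z : ℍ}

/-- Otherwise `L` is a part `N` with signs `≤ 0` followed by a part `P` with signs `≥ 0`. Write `z`
as a multiple of `x` plus `n` and `q` from their cones. Then `det (x, n, z) = det (x, n, q)` is
nonpositive by the signs and nonnegative by convexity. So both vanish, `n` and `q` are multiples of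
`x`, and `z = x`. -/
lemma exists_sign_change (hconv : OrientedConvex (x :: L)) (hgen : GenericPoint (x :: L) z)
    (hz : modelVec (Sum.inl z) ∈ modelCone {p | p ∈ x :: L}) :
    ∃ a b, [a, b].Sublist L ∧ 0 < orient x a (Sum.inl z) ∧ orient x b (Sum.inl z) < 0 := by
  by_contra hcon
  push Not at hcon
  obtain ⟨N, P, rfl, hN, hP⟩ := exists_sign_split (fun a => orient x a (Sum.inl z)) L hcon
  have hset : modelVec '' {p | p ∈ x :: (N ++ P)} =
      insert (modelVec x) (modelVec '' {p | p ∈ N} ∪ modelVec '' {p | p ∈ P}) := by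
    rw [← Set.image_union, ← Set.image_insert_eq]
    congr 1
    ext p; simp
  rw [modelCone, hset, Submodule.mem_span_insert, Submodule.span_union] at hz
  obtain ⟨c, v, hv, e⟩ := hz
  obtain ⟨n, hn, q, hq, rfl⟩ := Submodule.mem_sup.1 hv
  set X := modelVec x
  set Z := modelVec (Sum.inl z)
  have hzero : ∀ p ∈ N ++ P, det3 X (modelVec p) Z = 0 → p = x := by
    intro p hp h
    by_contra hne
    exact hgen.2 x (by simp) p (List.mem_cons_of_mem _ hp) (Ne.symm hne) h
  have h1 := det3_cone_strict (S := {p | p ∈ N}) (x := x) (z := Z) (-1) (fun p hp =>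
    ⟨by have := hN p hp; rw [neg_one_mul]; exact neg_nonneg.2 this,
      hzero p (List.mem_append_left _ hp)⟩)
    (by norm_num) hn
  have h2 := det3_cone_strict (S := {p | p ∈ P}) (x := x) (z := Z) 1 (fun p hp =>
    ⟨by have := hP p hp; rw [one_mul]; exact this, hzero p (List.mem_append_right _ hp)⟩)
    (by norm_num) hq
  have h3 : 0 ≤ det3 X n q := det3_cone_cone_nonneg (S := {p | p ∈ N}) (T := {p | p ∈ P})
    (fun a ha b hb => hconv x a b ((pair_sublist ha hb).cons_cons x)) hn hq
  have hc : (c • X : ℝ × ℝ × ℝ) = (c : ℝ) • X := rfl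
  have en : det3 X n Z = det3 X n q := by
    rw [e, det3_add₃, det3_add₃, hc, det3_smul₃, det3_self', det3_self]; ring
  have eq : det3 X q Z = -det3 X n q := by
    rw [e, det3_add₃, det3_add₃, hc, det3_smul₃, det3_self', det3_self, det3_swap]; ring
  have e0 : det3 X n q = 0 := by
    have := h1.1; have h4 := h2.1
    rw [en] at this
    linarith
  obtain ⟨a, rfl⟩ := h1.2 (en.trans e0)
  obtain ⟨b, rfl⟩ := h2.2 (by rw [eq, e0, neg_zero])
  have e' : Z = (c + (a + b)) • X := by rw [e, hc]; module
  have hpos : 0 < (c + (a + b) : ℝ) := by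
    have p1 := modelVec_height_pos x
    have p2 := modelVec_height_pos (Sum.inl z)
    have := congrArg (fun v : ℝ × ℝ × ℝ => v.2.1 + v.2.2) e'
    simp only [Prod.smul_snd, Prod.smul_fst, smul_eq_mul, ← mul_add] at this
    change 0 < Z.2.1 + Z.2.2 at p2
    rw [this] at p2
    exact (pos_iff_pos_of_mul_pos p2).2 p1
  exact hgen.1 x (by simp) (modelVec_injective hpos e')

lemma det3_plucker (x a j b w : ℝ × ℝ × ℝ) :
    det3 x a j * det3 x b w - det3 x a b * det3 x j w + det3 x a w * det3 x j b = 0 := by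
  simp only [det3]; ring

/-- For generic `z` a zero can occur only if `x` itself recurs in `L`, between `a` and `b`.
Convexity then forces all vertices onto the line `x a`; the hull lies on it, while `z` does not. -/
lemma orient_middle_ne_zero (hconv : OrientedConvex (x :: L)) (hgen : GenericPoint (x :: L) z)
    (hz : modelVec (Sum.inl z) ∈ modelCone {p | p ∈ x :: L}) (a k b : ClosedPlane)
    (hs : [a, k, b].Sublist L) (ha : 0 < orient x a (Sum.inl z))
    (hb : orient x b (Sum.inl z) < 0) : orient x k (Sum.inl z) ≠ 0 := by
  intro hk
  have hkL : k ∈ L := hs.subset (by simp)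
  have hkx : k = x := by
    by_contra hne
    exact hgen.2 x (by simp) k (List.mem_cons_of_mem _ hkL) (Ne.symm hne) hk
  subst hkx
  obtain ⟨r, t, rfl, har, hs'⟩ := List.cons_sublist_iff.1 hs
  obtain ⟨u, w, rfl, hku, hs''⟩ := List.cons_sublist_iff.1 hs'
  have hbw := List.singleton_sublist.1 hs''
  obtain ⟨v, v', rfl⟩ := List.append_of_mem hku
  -- The vertex `k` occurs both before `j` and between `j` and `l`, so both orders of the triple
  -- occur and their opposite orientations are nonnegative.
  have hP : ∀ j ∈ r ++ v, ∀ l ∈ v' ++ w, orient k j l = 0 := by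
    intro j hj l hl
    have e : r ++ (v ++ k :: v' ++ w) = (r ++ v) ++ k :: (v' ++ w) := by simp
    have s1 : [k, j, l].Sublist (k :: (r ++ (v ++ k :: v' ++ w))) := by
      rw [e]
      exact (pair_sublist hj (List.mem_cons_of_mem k hl)).cons_cons k
    have s2 : [j, k, l].Sublist (k :: (r ++ (v ++ k :: v' ++ w))) := by
      rw [e]
      exact ((List.singleton_sublist.2 hj).append
        ((List.singleton_sublist.2 hl).cons_cons k)).cons k
    have h1 := hconv _ _ _ s1
    have h2 := hconv _ _ _ s2
    have h3 : orient j k l = -orient k j l := by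
      rw [← orient_rotate j k l, orient_swap]
    linarith
  have haP : a ∈ r ++ v := List.mem_append_left _ har
  have hbQ : b ∈ v' ++ w := List.mem_append_right _ hbw
  have hall : ∀ j ∈ k :: (r ++ (v ++ k :: v' ++ w)), orient k a j = 0 := by
    intro j hj
    have : j = k ∨ j ∈ r ++ v ∨ j ∈ v' ++ w := by
      simp only [List.mem_cons, List.mem_append] at hj ⊢; tauto
    rcases this with rfl | hj | hj
    · exact orient_self' _ _
    · have h1 := hP a haP b hbQ
      have h2 := hP j hj b hbQ
      have h3 := det3_plucker (modelVec k) (modelVec a) (modelVec j) (modelVec b)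
        (modelVec (Sum.inl z))
      change orient k a j * orient k b (Sum.inl z) - orient k a b * _ + _ * orient k j b = 0 at h3
      rw [h1, h2, zero_mul, mul_zero, sub_zero, add_zero] at h3
      exact (mul_eq_zero.1 h3).resolve_right hb.ne
    · exact hP a haP j hj
  have h1 : 0 ≤ det3 (modelVec a) (modelVec k) (modelVec (Sum.inl z)) :=
    det3_cone_nonneg (fun p hp => by
      have := hall p hp
      have h3 : orient a k p = -orient k a p := by rw [← orient_rotate a k p, orient_swap]
      change 0 ≤ orient a k p
      rw [h3, this, neg_zero]) hz
  have h3 : orient a k (Sum.inl z) = -orient k a (Sum.inl z) := by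
    rw [← orient_rotate a k, orient_swap]
  change 0 ≤ orient a k (Sum.inl z) at h1
  linarith

/-- A generic point of the hull of a convex polygon is in a triangle of the fan. -/
lemma exists_fan_triangle (hconv : OrientedConvex (x :: L)) (hgen : GenericPoint (x :: L) z)
    (hz : modelVec (Sum.inl z) ∈ modelCone {p | p ∈ x :: L}) :
    ∃ a b, [a, b] <:+: L ∧ z ∈ openTriangle x a b := by
  obtain ⟨a, b, hab, ha, hb⟩ := exists_adjacent (fun a => orient x a (Sum.inl z)) L
    (orient_middle_ne_zero hconv hgen hz) (exists_sign_change hconv hgen hz)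
  have hne : a ≠ b := by rintro rfl; exact lt_asymm ha hb
  have haL : a ∈ L := hab.subset (by simp)
  have hbL : b ∈ L := hab.subset (by simp)
  refine ⟨a, b, hab, ha, ?_, ?_⟩
  · refine lt_of_le_of_ne ?_ (hgen.2 a (List.mem_cons_of_mem _ haL) b
      (List.mem_cons_of_mem _ hbL) hne).symm
    refine det3_cone_nonneg (fun j hj => ?_) hz
    change 0 ≤ orient a b j
    obtain ⟨P, Q, rfl⟩ := hab
    have : j ∈ x :: P ∨ j = a ∨ j = b ∨ j ∈ Q := by
      simp only [Set.mem_ofPred_eq, List.mem_cons, List.mem_append, List.not_mem_nil, or_false]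
        at hj ⊢
      tauto
    have e : x :: (P ++ [a, b] ++ Q) = (x :: P) ++ ([a, b] ++ Q) := by simp
    rcases this with hj | rfl | rfl | hj
    · rw [orient_rotate]
      refine hconv _ _ _ ?_
      rw [e]
      exact (List.singleton_sublist.2 hj).append (List.sublist_append_left _ _)
    · rw [orient_self']
    · rw [orient_self]
    · refine hconv _ _ _ ?_
      rw [e]
      exact ((List.Sublist.refl [a, b]).append (List.singleton_sublist.2 hj)).trans
        (List.sublist_append_right _ _)
  · have h3 : orient b x (Sum.inl z) = -orient x b (Sum.inl z) := by
      rw [← orient_rotate b x, orient_swap]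
    rw [h3]; exact neg_pos.2 hb

/-- Pair Cramer's expression of `z` in `x, c, d` with `det (x, e, ·)`: both surviving terms are
nonpositive. Hence no later triangle of the fan contains `z`. -/
lemma orient_nonpos_of_later {c d e : ClosedPlane} (h : z ∈ openTriangle x c d)
    (h1 : 0 ≤ orient x c e) (h2 : 0 ≤ orient x d e) : orient x e (Sum.inl z) ≤ 0 := by
  have hD := orient_pos_of_openTriangle h
  obtain ⟨a1, a2, a3⟩ := h
  have e1 := congrArg (det3 (modelVec x) (modelVec e))
    (det3_cramer (modelVec x) (modelVec c) (modelVec d) (modelVec (Sum.inl z)))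
  rw [det3_add₃, det3_add₃, det3_smul₃, det3_smul₃, det3_smul₃, det3_smul₃, det3_self',
    det3_swap (modelVec x) (modelVec c) (modelVec e),
    det3_swap (modelVec x) (modelVec d) (modelVec e)] at e1
  change orient x c d * orient x e (Sum.inl z) = _ * 0 + orient d x (Sum.inl z) * -orient x c e +
    orient x c (Sum.inl z) * -orient x d e at e1
  by_contra hcon
  push Not at hcon
  nlinarith [mul_pos hD hcon, mul_nonneg a3.le h1, mul_nonneg a1.le h2]

lemma chainSum_eq_zero {X : Type*} {f : X → X → ℝ} {L : List X}
    (h : ∀ a b, [a, b] <:+: L → f a b = 0) : chainSum f L = 0 := by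
  induction L with
  | nil => rfl
  | cons c L ih => cases L with
    | nil => rfl
    | cons d L =>
      rw [chainSum_cons_cons, h c d (List.prefix_append [c, d] L).isInfix,
        ih fun a b hab => h a b (hab.trans (List.suffix_cons c _).isInfix), add_zero]

/-- A point is in at most one triangle of the fan. -/
lemma chainSum_indicator (hpair : ∀ a b, [a, b].Sublist L → 0 ≤ orient x a b)
    (h : ∃ a b, [a, b] <:+: L ∧ z ∈ openTriangle x a b) :
    chainSum (fun a b => (openTriangle x a b).indicator (fun _ => (1 : ℝ)) z) L = 1 := by
  induction L with
  | nil => obtain ⟨a, b, h, -⟩ := h; simp at h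
  | cons c L ih => cases L with
    | nil =>
      obtain ⟨a, b, h, -⟩ := h
      have := h.length_le
      simp at this
    | cons d L =>
      rw [chainSum_cons_cons]
      by_cases hcd : z ∈ openTriangle x c d
      · rw [Set.indicator_of_mem hcd, chainSum_eq_zero, add_zero]
        intro a b hab
        refine Set.indicator_of_notMem (fun hz => ?_) _
        have ha : a ∈ d :: L := hab.subset (by simp)
        have h1 : 0 ≤ orient x c a := hpair c a ((List.singleton_sublist.2 ha).cons_cons c)
        have h2 : 0 ≤ orient x d a := by
          rcases List.mem_cons.1 ha with rfl | ha
          · rw [orient_self]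
          · exact hpair d a (((List.singleton_sublist.2 ha).cons_cons d).cons c)
        exact absurd hz.1 (not_lt.2 (orient_nonpos_of_later hcd h1 h2))
      · rw [Set.indicator_of_notMem hcd, zero_add]
        refine ih (fun a b hab => hpair a b (hab.cons c)) ?_
        obtain ⟨a, b, hab, hz⟩ := h
        rcases List.infix_cons_iff.1 hab with hp | hi
        · have := List.cons_prefix_cons.1 hp
          have h2 := List.cons_prefix_cons.1 this.2
          rw [this.1, h2.1] at hz
          exact absurd hz hcd
        · exact ⟨a, b, hi, hz⟩

lemma OrientedConvex.pair (hconv : OrientedConvex (x :: L)) (a b : ClosedPlane)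
    (h : [a, b].Sublist L) : 0 ≤ orient x a b := hconv x a b (h.cons_cons x)

/-- The part of the hull of `l` in the hyperbolic plane. -/
def hullRegion (l : List ClosedPlane) : Set ℍ :=
  {z : ℍ | (Sum.inl z : ClosedPlane) ∈ geodesicHull {p | p ∈ l}}

/-- The indicator of the hull of a convex polygon is the sum of those of the triangles of the
fan. -/
lemma indicator_hull (hconv : OrientedConvex (x :: L)) (hgen : GenericPoint (x :: L) z) :
    (hullRegion (x :: L)).indicator (fun _ => (1 : ℝ)) z =
    chainSum (fun a b => (openTriangle x a b).indicator (fun _ => (1 : ℝ)) z) L := by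
  by_cases hz : z ∈ hullRegion (x :: L)
  · rw [chainSum_indicator hconv.pair
      (exists_fan_triangle hconv hgen (geodesicHull_subset_cone hz)), Set.indicator_of_mem hz]
  · rw [chainSum_eq_zero, Set.indicator_of_notMem hz]
    intro a b hab
    refine Set.indicator_of_notMem (fun h => hz ?_) _
    exact openTriangle_subset_hull (S := {p | p ∈ x :: L}) (by simp)
      (List.mem_cons_of_mem _ (hab.subset (by simp)))
      (List.mem_cons_of_mem _ (hab.subset (by simp))) h

end fan

/-! ### Areas -/

lemma lintegral_Ioi_inv_sq {c : ℝ} (hc : 0 < c) :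
    ∫⁻ y in Set.Ioi c, ENNReal.ofReal (1 / y ^ 2) = ENNReal.ofReal (1 / c) := by
  have hd : ∀ x ∈ Set.Ici c, HasDerivAt (fun y : ℝ => -y⁻¹) (1 / x ^ 2) x := by
    intro x hx
    have hx0 : x ≠ 0 := (hc.trans_le hx).ne'
    have := (hasDerivAt_inv hx0).neg
    rwa [neg_neg, ← one_div] at this
  have hl : Tendsto (fun y : ℝ => -y⁻¹) atTop (𝓝 0) := by
    simpa using (tendsto_inv_atTop_zero (𝕜 := ℝ)).neg
  have hnn : ∀ x ∈ Set.Ioi c, (0 : ℝ) ≤ 1 / x ^ 2 := fun x _ => by positivity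
  rw [← ofReal_integral_eq_lintegral_ofReal
    (integrableOn_Ioi_deriv_of_nonneg ((hd c Set.self_mem_Ici).continuousAt.continuousWithinAt)
      (fun x hx => hd x (Set.Ioi_subset_Ici_self hx)) hnn hl)
    ((ae_restrict_iff' measurableSet_Ioi).2 (ae_of_all _ hnn)),
    integral_Ioi_of_hasDerivAt_of_nonneg' hd hnn hl]
  congr 1; rw [one_div]; ring

/-- The derivative is required only inside the interval, because the integrand of an ideal triangle
blows up at both ends. -/
lemma lintegral_Ioo_of_hasDerivAt {F f : ℝ → ℝ} {a b : ℝ} (hab : a ≤ b)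
    (hc : ContinuousOn F (Set.Icc a b)) (hd : ∀ x ∈ Set.Ioo a b, HasDerivAt F (f x) x)
    (hnn : ∀ x ∈ Set.Ioo a b, 0 ≤ f x) :
    ∫⁻ x in Set.Ioo a b, ENNReal.ofReal (f x) = ENNReal.ofReal (F b - F a) := by
  have hi := intervalIntegral.integrableOn_deriv_of_nonneg hc hd hnn
  rw [← intervalIntegral.integral_eq_sub_of_hasDerivAt_of_le hab hc hd
    ((intervalIntegrable_iff_integrableOn_Ioc_of_le hab).2 hi),
    intervalIntegral.integral_of_le hab, integral_Ioc_eq_integral_Ioo,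
    ofReal_integral_eq_lintegral_ofReal (hi.mono_set Set.Ioo_subset_Ioc_self)
    ((ae_restrict_iff' measurableSet_Ioo).2 (ae_of_all _ hnn))]

/-- The area of the region above a graph. -/
lemma volume_above {a b : ℝ} {h : ℝ → ℝ} (hm : Measurable h)
    (hpos : ∀ x ∈ Set.Ioo a b, 0 < h x) :
    volume {z : ℍ | z.re ∈ Set.Ioo a b ∧ h z.re < z.im} =
      ∫⁻ x in Set.Ioo a b, ENNReal.ofReal (1 / h x) := by
  set R : Set (ℝ × ℝ) := {p | p.1 ∈ Set.Ioo a b ∧ h p.1 < p.2} with hR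
  have hRm : MeasurableSet R :=
    (measurable_fst measurableSet_Ioo).inter
      (measurableSet_lt (hm.comp measurable_fst) measurable_snd)
  have himg : UpperHalfPlane.coe '' {z : ℍ | z.re ∈ Set.Ioo a b ∧ h z.re < z.im} =
      Complex.measurableEquivRealProd ⁻¹' R := by
    ext w
    constructor
    · rintro ⟨z, hz, rfl⟩; exact hz
    · intro hw
      have hw' : w.re ∈ Set.Ioo a b ∧ h w.re < w.im := hw
      exact ⟨⟨w, (hpos _ hw'.1).trans hw'.2⟩, hw', rfl⟩
  rw [UpperHalfPlane.volume_eq_lintegral, himg,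
    ← lintegral_indicator (Complex.measurableEquivRealProd.measurable hRm)]
  have e : ((Complex.measurableEquivRealProd ⁻¹' R).indicator
      fun z : ℂ => (((1 / ‖z.im‖₊) ^ 2 : NNReal) : ENNReal)) =
      fun z : ℂ => R.indicator (fun p : ℝ × ℝ => ENNReal.ofReal (1 / p.2 ^ 2))
        (Complex.measurableEquivRealProd z) := by
    funext z
    simp only [Set.indicator, Set.mem_preimage]
    split_ifs with hz
    · rw [ENNReal.ofReal, Complex.measurableEquivRealProd_apply]
      congr 1
      apply NNReal.eq
      rw [Real.coe_toNNReal _ (by positivity)]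
      simp
    · rfl
  rw [e, Complex.volume_preserving_equiv_real_prod.lintegral_comp_emb
    Complex.measurableEquivRealProd.measurableEmbedding (fun p => R.indicator _ p),
    Measure.volume_eq_prod, lintegral_prod, ← lintegral_indicator measurableSet_Ioo]
  · congr 1
    funext x
    by_cases hx : x ∈ Set.Ioo a b
    · rw [Set.indicator_of_mem hx, ← lintegral_Ioi_inv_sq (hpos x hx),
        ← lintegral_indicator measurableSet_Ioi]
      congr 1
      funext y
      simp only [Set.indicator, hR, Set.mem_ofPred_eq, hx, true_and, Set.mem_Ioi]
    · rw [Set.indicator_of_notMem hx]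
      have : ∀ y : ℝ, R.indicator (fun p : ℝ × ℝ => ENNReal.ofReal (1 / p.2 ^ 2)) (x, y) = 0 :=
        fun y => Set.indicator_of_notMem (fun h => hx h.1) _
      simp only [this, lintegral_zero]
  · exact (Measurable.indicator (by fun_prop) hRm).aemeasurable

/-- The square of the height at `x` of the geodesic from `i t` to `X + i Y`. -/
def heightSq (t X Y x : ℝ) : ℝ := x * (X - x) + (Y ^ 2 * x + t ^ 2 * (X - x)) / X

lemma heightSq_pos {t X Y x : ℝ} (hx : x ∈ Set.Ioo 0 X) : 0 < heightSq t X Y x := by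
  obtain ⟨h1, h2⟩ := hx
  have := sub_pos.2 h2
  have hX : 0 < X := h1.trans h2
  unfold heightSq
  positivity

lemma hasDerivAt_heightSq {t X Y : ℝ} (x : ℝ) :
    HasDerivAt (heightSq t X Y) (X - 2 * x + (Y ^ 2 - t ^ 2) / X) x := by
  unfold heightSq
  have h1 : HasDerivAt (fun x : ℝ => X - x) (-1) x := by
    simpa using (hasDerivAt_id x).const_sub X
  have h2 := (((hasDerivAt_id x).mul h1)).add
    ((((hasDerivAt_id x).const_mul (Y ^ 2)).add (h1.const_mul (t ^ 2))).div_const X)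
  refine h2.congr_deriv ?_
  simp only [id]
  ring

lemma continuous_heightSq {t X Y : ℝ} : Continuous (heightSq t X Y) := by
  unfold heightSq; fun_prop

/-- The primitive is `horArea` from `i t` to the point of the geodesic above `x`: the area
accumulated so far. -/
lemma hasDerivAt_area {t X Y : ℝ} (ht : 0 < t) {x : ℝ} (hx : x ∈ Set.Ioo 0 X) :
    HasDerivAt (fun x => 2 * Real.arctan (x / (t + √(heightSq t X Y x))))
      (1 / √(heightSq t X Y x)) x := by
  have hf := heightSq_pos (t := t) (Y := Y) hx
  have hX : 0 < X := hx.1.trans hx.2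
  have hs := Real.sqrt_pos.2 hf
  have hsq := Real.sq_sqrt hf.le
  set s := √(heightSq t X Y x) with hsdef
  have h1 := ((hasDerivAt_heightSq (t := t) (X := X) (Y := Y) x).sqrt hf.ne').const_add t
  have h2 := (((hasDerivAt_id x).div h1 (by positivity)).arctan).const_mul 2
  refine h2.congr_deriv ?_
  simp only [Pi.div_apply, id, ← hsdef]
  have hne : t + s ≠ 0 := by positivity
  set c := X - 2 * x + (Y ^ 2 - t ^ 2) / X with hc
  have hsc : s ^ 2 = t ^ 2 + c * x + x ^ 2 := by
    rw [hsq, hc]; unfold heightSq; field_simp; ring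
  have hden : 0 < (t + s) ^ 2 + x ^ 2 := by positivity
  have e : 1 + (x / (t + s)) ^ 2 = ((t + s) ^ 2 + x ^ 2) / (t + s) ^ 2 := by field_simp
  rw [e]
  field_simp
  linear_combination hsc

/-- The area above a geodesic segment issuing from a point of the imaginary axis. -/
lemma volume_above_geodesic {t X Y : ℝ} (ht : 0 < t) (hX : 0 < X) (hY : 0 < Y) :
    volume {z : ℍ | z.re ∈ Set.Ioo 0 X ∧ √(heightSq t X Y z.re) < z.im} =
      ENNReal.ofReal (2 * Real.arctan (X / (t + Y))) := by
  rw [volume_above (h := fun x => √(heightSq t X Y x)) continuous_heightSq.sqrt.measurable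
    (fun x hx => Real.sqrt_pos.2 (heightSq_pos hx)),
    lintegral_Ioo_of_hasDerivAt hX.le (F := fun x => 2 * Real.arctan
      (x / (t + √(heightSq t X Y x)))) _ (fun x hx => hasDerivAt_area ht hx)
      (fun x _ => by positivity)]
  · have e : heightSq t X Y X = Y ^ 2 := by unfold heightSq; field_simp; ring
    rw [e, Real.sqrt_sq hY.le]; simp
  · refine (continuous_const.mul (Real.continuous_arctan.comp
      (continuous_id.div (continuous_const.add continuous_heightSq.sqrt) fun x => ?_))).continuousOn
    have := Real.sqrt_nonneg (heightSq t X Y x)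
    change t + √(heightSq t X Y x) ≠ 0
    positivity

/-- The area of a triangle with three ideal vertices. -/
lemma volume_above_ideal {X : ℝ} (hX : 0 < X) :
    volume {z : ℍ | z.re ∈ Set.Ioo 0 X ∧ √(z.re * (X - z.re)) < z.im} =
      ENNReal.ofReal Real.pi := by
  have hpos : ∀ x ∈ Set.Ioo 0 X, 0 < x * (X - x) := fun x hx => mul_pos hx.1 (sub_pos.2 hx.2)
  rw [volume_above (h := fun x => √(x * (X - x))) (by fun_prop)
    (fun x hx => Real.sqrt_pos.2 (hpos x hx)),
    lintegral_Ioo_of_hasDerivAt hX.le (F := fun x => Real.arcsin ((2 * x - X) / X)) _ _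
      (fun x _ => by positivity)]
  · have e1 : (2 * X - X) / X = 1 := by field_simp; ring
    have e2 : (2 * 0 - X) / X = -1 := by field_simp; ring
    rw [e1, e2, Real.arcsin_neg, Real.arcsin_one]
    congr 1; ring
  · exact (Real.continuous_arcsin.comp (by fun_prop)).continuousOn
  · intro x hx
    have h := hpos x hx
    have h1 : HasDerivAt (fun x : ℝ => (2 * x - X) / X) (2 / X) x := by
      have := (((hasDerivAt_id x).const_mul 2).sub_const X).div_const X
      simpa using this
    have hs : 1 - ((2 * x - X) / X) ^ 2 = (2 / X) ^ 2 * (x * (X - x)) := by field_simp; ring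
    have b1 : (2 * x - X) / X ≠ -1 := by
      intro e; rw [e] at hs; have := mul_pos (show 0 < (2 / X) ^ 2 by positivity) h; linarith
    have b2 : (2 * x - X) / X ≠ 1 := by
      intro e; rw [e] at hs; have := mul_pos (show 0 < (2 / X) ^ 2 by positivity) h; linarith
    have h2 := (Real.hasDerivAt_arcsin b1 b2).comp x h1
    refine h2.congr_deriv ?_
    rw [hs, Real.sqrt_mul (by positivity), Real.sqrt_sq (by positivity)]
    have := Real.sqrt_pos.2 h
    field_simp

/-! ### Null sets -/

lemma volume_re_eq_zero : volume {z : ℍ | z.re = 0} = 0 := by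
  rw [UpperHalfPlane.volume_eq_lintegral]
  refine setLIntegral_measure_zero _ _ ?_
  refine measure_mono_null (t := Complex.measurableEquivRealProd ⁻¹' ({0} ×ˢ Set.univ)) ?_ ?_
  · rintro _ ⟨z, hz, rfl⟩
    exact ⟨hz, trivial⟩
  · rw [Complex.volume_preserving_equiv_real_prod.measure_preimage
      ((measurableSet_singleton 0).prod MeasurableSet.univ).nullMeasurableSet,
      Measure.volume_eq_prod, Measure.prod_prod]
    simp

lemma volume_preimage_smul (g : SL(2, ℝ)) (s : Set ℍ) :
    volume ((fun z : ℍ => g • z) ⁻¹' s) = volume s :=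
  measure_preimage_smul (volume : Measure ℍ) (g : GL (Fin 2) ℝ) s

/-- An isometry, which preserves the area, takes the line to the imaginary axis. -/
lemma volume_orient_eq_zero {p q : ClosedPlane} (h : p ≠ q) :
    volume {z : ℍ | orient p q (Sum.inl z) = 0} = 0 := by
  obtain ⟨g, a, b, hab, rfl, rfl⟩ := exists_geodesic_closed h
  have : {z : ℍ | orient (geodesic g a) (geodesic g b) (Sum.inl z) = 0} =
      (fun z : ℍ => g⁻¹ • z) ⁻¹' {z : ℍ | z.re = 0} := by
    ext z
    rw [Set.mem_ofPred_eq, ← orient_smul_eq_zero_iff g⁻¹, geodesic_eq_smul g a,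
      geodesic_eq_smul g b, inv_smul_smul, inv_smul_smul, orient, modelVec_geodesic_one,
      modelVec_geodesic_one, smul_inl, modelVec_inl]
    rw [axis_lt_iff] at hab
    simp only [det3, Set.mem_preimage, Set.mem_ofPred_eq]
    constructor
    · intro h
      have h' : (axisNum b * axisDen a - axisNum a * axisDen b) * (g⁻¹ • z).re = 0 := by linarith
      exact (mul_eq_zero.1 h').resolve_left (sub_pos.2 hab).ne'
    · intro h; rw [h]; ring
  rw [this, volume_preimage_smul, volume_re_eq_zero]

lemma volume_singleton_upperHalfPlane (z : ℍ) : volume ({z} : Set ℍ) = 0 := by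
  have h : (Sum.inr OnePoint.infty : ClosedPlane) ≠ Sum.inr (z.re : OnePoint ℝ) := by simp
  refine measure_mono_null ?_ (volume_orient_eq_zero h)
  rintro w rfl
  simp [orient, det3]

lemma ae_genericPoint (l : List ClosedPlane) : ∀ᵐ z : ℍ, GenericPoint l z := by
  have hc : {p | p ∈ l}.Countable := l.finite_toSet.countable
  have h1 : ∀ᵐ z : ℍ, ∀ a (_ : a ∈ {p | p ∈ l}), Sum.inl z ≠ a := by
    rw [ae_ball_iff hc]
    intro a _
    rcases a with w | ξ
    · refine measure_mono_null ?_ (volume_singleton_upperHalfPlane w)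
      intro z hz
      simpa using hz
    · exact ae_of_all _ fun z => by simp
  have h2 : ∀ᵐ z : ℍ, ∀ a (_ : a ∈ {p | p ∈ l}), ∀ b (_ : b ∈ {p | p ∈ l}), a ≠ b →
      orient a b (Sum.inl z) ≠ 0 := by
    rw [ae_ball_iff hc]
    intro a _
    rw [ae_ball_iff hc]
    intro b _
    by_cases hab : a = b
    · exact ae_of_all _ fun z h => absurd hab h
    · refine measure_mono_null ?_ (volume_orient_eq_zero hab)
      intro z hz
      simp only [Set.mem_compl_iff, Set.mem_ofPred_eq] at hz ⊢
      by_contra hcon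
      exact hz fun _ => hcon
  filter_upwards [h1, h2] with z hz1 hz2 using ⟨hz1, hz2⟩

/-! ### The area of a triangle -/

lemma openTriangle_smul (g : SL(2, ℝ)) (u v w : ClosedPlane) :
    openTriangle u v w = (fun z : ℍ => g • z) ⁻¹' openTriangle (g • u) (g • v) (g • w) := by
  ext z
  simp only [openTriangle, Set.mem_ofPred_eq, Set.mem_preimage, ← smul_inl, orient_smul_pos_iff]

lemma volume_openTriangle_smul (g : SL(2, ℝ)) (u v w : ClosedPlane) :
    volume (openTriangle (g • u) (g • v) (g • w)) = volume (openTriangle u v w) := by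
  rw [openTriangle_smul g u v w, volume_preimage_smul]

lemma measurableSet_openTriangle (u v w : ClosedPlane) : MeasurableSet (openTriangle u v w) := by
  have h (p q : ClosedPlane) : Continuous fun z : ℍ => orient p q (Sum.inl z) := by
    have h1 := UpperHalfPlane.continuous_re
    have h2 := UpperHalfPlane.continuous_im
    simp only [orient, modelVec_inl, det3]
    fun_prop
  exact ((isOpen_lt continuous_const (h u v)).inter ((isOpen_lt continuous_const (h v w)).inter
    (isOpen_lt continuous_const (h w u)))).measurableSet

lemma openTriangle_eq_empty {u v w : ClosedPlane} (h : orient u v w ≤ 0) :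
    openTriangle u v w = ∅ := by
  ext z
  simp only [Set.mem_empty_iff_false, iff_false]
  exact fun hz => absurd (orient_pos_of_openTriangle hz) (not_lt.2 h)

/-! ### Triangles as differences of regions above geodesics. -/

lemma orient_axis_left (s : ℝ) {w z : ℍ} (hw : 0 < w.re) :
    orient (Sum.inl (translation s • UpperHalfPlane.I)) (Sum.inl w) (Sum.inl z) =
      w.re * (z.im ^ 2 - heightSq (Real.exp s) w.re w.im z.re) := by
  simp only [orient, modelVec_inl, det3, translation_smul_I_re, translation_smul_I_im, heightSq]
  field_simp
  ring

lemma orient_axis_left_pos_iff (s : ℝ) {w z : ℍ} (hw : 0 < w.re) :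
    0 < orient (Sum.inl (translation s • UpperHalfPlane.I)) (Sum.inl w) (Sum.inl z) ↔
      heightSq (Real.exp s) w.re w.im z.re < z.im ^ 2 := by
  rw [orient_axis_left s hw, mul_pos_iff_of_pos_left hw, sub_pos]

lemma orient_axis_left_neg_iff (s : ℝ) {w z : ℍ} (hw : 0 < w.re) :
    orient (Sum.inl (translation s • UpperHalfPlane.I)) (Sum.inl w) (Sum.inl z) < 0 ↔
      z.im ^ 2 < heightSq (Real.exp s) w.re w.im z.re := by
  rw [orient_axis_left s hw, ← neg_pos, ← mul_neg, mul_pos_iff_of_pos_left hw, neg_sub, sub_pos]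

lemma sqrt_lt_im_iff {z : ℍ} {y : ℝ} : √y < z.im ↔ y < z.im ^ 2 :=
  Real.sqrt_lt' z.im_pos

/-- The area of a triangle with a side on the imaginary axis. -/
lemma volume_openTriangle_axis {a b : ℝ} (hab : a < b) {w : ℍ} (hw : 0 < w.re) :
    volume (openTriangle (Sum.inl (translation b • UpperHalfPlane.I))
      (Sum.inl (translation a • UpperHalfPlane.I)) (Sum.inl w)) =
    ENNReal.ofReal (triArea (translation b • UpperHalfPlane.I)
      (translation a • UpperHalfPlane.I) w) := by
  set u := translation b • UpperHalfPlane.I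
  set v := translation a • UpperHalfPlane.I
  set A : ℝ → Set ℍ := fun s =>
    {z : ℍ | z.re ∈ Set.Ioo 0 w.re ∧ √(heightSq (Real.exp s) w.re w.im z.re) < z.im} with hA
  have hvol (s : ℝ) : volume (A s) =
      ENNReal.ofReal (horArea (translation s • UpperHalfPlane.I) w) := by
    rw [hA, volume_above_geodesic (Real.exp_pos s) hw w.im_pos, horArea, translation_smul_I_re,
      translation_smul_I_im, sub_zero]
  have hpos (s : ℝ) : 0 ≤ horArea (translation s • UpperHalfPlane.I) w := by
    rw [horArea, translation_smul_I_re, sub_zero]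
    exact mul_nonneg two_pos.le (Real.arctan_nonneg.2
      (div_nonneg hw.le (add_pos (UpperHalfPlane.im_pos _) w.im_pos).le))
  have hmeas (s : ℝ) : MeasurableSet (A s) := by
    have h1 := UpperHalfPlane.continuous_re.measurable
    have h2 := UpperHalfPlane.continuous_im.measurable
    exact (h1 measurableSet_Ioo).inter (measurableSet_lt
      ((continuous_heightSq.sqrt.comp UpperHalfPlane.continuous_re).measurable) h2)
  have hexp : Real.exp a ^ 2 < Real.exp b ^ 2 := by
    have := Real.exp_lt_exp.2 hab
    gcongr
  have hdiff (x : ℝ) : heightSq (Real.exp b) w.re w.im x - heightSq (Real.exp a) w.re w.im x =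
      (Real.exp b ^ 2 - Real.exp a ^ 2) * (w.re - x) / w.re := by
    unfold heightSq; field_simp; ring
  have hsub : A b ⊆ A a := by
    rintro z ⟨hz, h⟩
    refine ⟨hz, (Real.sqrt_le_sqrt ?_).trans_lt h⟩
    have : 0 ≤ (Real.exp b ^ 2 - Real.exp a ^ 2) * (w.re - z.re) / w.re :=
      div_nonneg (mul_nonneg (sub_pos.2 hexp).le (sub_pos.2 hz.2).le) hw.le
    linarith [hdiff z.re]
  have hne : (Sum.inl u : ClosedPlane) ≠ Sum.inl w := by
    intro h
    have := congrArg UpperHalfPlane.re (Sum.inl_injective h)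
    rw [translation_smul_I_re] at this
    exact hw.ne this
  have huv (z : ℍ) : 0 < orient (Sum.inl u) (Sum.inl v) (Sum.inl z) ↔ 0 < z.re := by
    have : orient (Sum.inl u) (Sum.inl v) (Sum.inl z) =
        z.re * (Real.exp b ^ 2 - Real.exp a ^ 2) := by
      simp only [u, v, orient, modelVec_inl, det3, translation_smul_I_re, translation_smul_I_im]
      ring
    rw [this]
    exact mul_pos_iff_of_pos_right (sub_pos.2 hexp)
  have hwu (z : ℍ) : orient (Sum.inl w) (Sum.inl u) (Sum.inl z) =
      -orient (Sum.inl u) (Sum.inl w) (Sum.inl z) := by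
    rw [← orient_rotate (Sum.inl w), orient_swap]
  -- The triangle is the region above its lower side `v w` minus the region above its upper side `u
  -- w`, up to points of the latter.
  obtain ⟨B, hB⟩ : ∃ B : Set ℍ, B = A a \ A b := ⟨_, rfl⟩
  have hae : openTriangle (Sum.inl u) (Sum.inl v) (Sum.inl w) =ᵐ[volume] B := by
    have hnull : ∀ᵐ z : ℍ, orient (Sum.inl u) (Sum.inl w) (Sum.inl z) ≠ 0 :=
      measure_eq_zero_iff_ae_notMem.1 (volume_orient_eq_zero hne)
    refine eventuallyEq_set.2 ?_
    filter_upwards [hnull] with z hz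
    have key : z ∈ openTriangle (Sum.inl u) (Sum.inl v) (Sum.inl w) ↔
        0 < z.re ∧ heightSq (Real.exp a) w.re w.im z.re < z.im ^ 2 ∧
          z.im ^ 2 < heightSq (Real.exp b) w.re w.im z.re := by
      simp only [openTriangle, Set.mem_ofPred_eq]
      rw [huv, orient_axis_left_pos_iff a hw, hwu, Left.neg_pos_iff, orient_axis_left_neg_iff b hw]
    rw [key]
    simp only [hB, hA, Set.mem_sdiff, Set.mem_ofPred_eq, sqrt_lt_im_iff, Set.mem_Ioo]
    constructor
    · rintro ⟨h1, h2, h3⟩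
      have h4 := hdiff z.re
      have h5 : 0 < (Real.exp b ^ 2 - Real.exp a ^ 2) * (w.re - z.re) / w.re := by linarith
      have h6 : 0 < w.re - z.re := by
        rw [div_pos_iff_of_pos_right hw, mul_pos_iff_of_pos_left (sub_pos.2 hexp)] at h5
        exact h5
      exact ⟨⟨⟨h1, sub_pos.1 h6⟩, h2⟩, fun h => lt_asymm h3 h.2⟩
    · rintro ⟨⟨h1, h2⟩, h3⟩
      refine ⟨h1.1, h2, ?_⟩
      by_contra hcon
      push Not at hcon
      rcases hcon.eq_or_lt with h | h
      · apply hz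
        rw [orient_axis_left b hw, h, sub_self, mul_zero]
      · exact h3 ⟨h1, h⟩
  rw [measure_congr hae, hB, measure_sdiff hsub (hmeas b).nullMeasurableSet
    (by rw [hvol]; exact ENNReal.ofReal_ne_top), hvol, hvol, ← ENNReal.ofReal_sub _ (hpos b)]
  congr 1
  rw [triArea, horArea_translation, horArea_swap u w]
  ring

/-- The area of a triangle in the hyperbolic plane. -/
lemma volume_openTriangle_inl {u v w : ℍ} (h : 0 ≤ orient (Sum.inl u) (Sum.inl v) (Sum.inl w)) :
    volume (openTriangle (Sum.inl u) (Sum.inl v) (Sum.inl w)) = ENNReal.ofReal (triArea u v w) ∧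
      0 ≤ triArea u v w := by
  -- Normalize so that `v` is `i` and `u` is at distance `d` above it; the orientation then becomes
  -- the sign of `w'.re`, except when `d = 0`.
  obtain ⟨g, d, hd, hv, hu⟩ := exists_geodesic v u
  obtain ⟨w', rfl⟩ : ∃ w', w = g • w' := ⟨g⁻¹ • w, (smul_inv_smul g w).symm⟩
  have hv' : v = g • translation 0 • UpperHalfPlane.I := by rw [translation_zero, one_smul, hv]
  have horient := orient_smul g (Sum.inl (translation d • UpperHalfPlane.I))
    (Sum.inl (translation 0 • UpperHalfPlane.I)) (Sum.inl w')
  obtain ⟨k, hk, e⟩ := horient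
  simp only [smul_inl] at e
  rw [hv', ← hu, triArea_smul]
  simp only [← smul_inl]
  rw [volume_openTriangle_smul]
  rw [hv', ← hu] at h
  have h' : 0 ≤ orient (Sum.inl (translation d • UpperHalfPlane.I))
      (Sum.inl (translation 0 • UpperHalfPlane.I)) (Sum.inl w') := by
    rw [e]; exact mul_nonneg hk.le h
  have e2 : orient (Sum.inl (translation d • UpperHalfPlane.I))
      (Sum.inl (translation 0 • UpperHalfPlane.I)) (Sum.inl w') =
      w'.re * (Real.exp d ^ 2 - 1) := by
    simp only [orient, modelVec_inl, det3, translation_smul_I_re, translation_smul_I_im,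
      Real.exp_zero]
    ring
  have hzero : triArea (translation d • UpperHalfPlane.I) (translation 0 • UpperHalfPlane.I) w' = 0
      → orient (Sum.inl (translation d • UpperHalfPlane.I))
      (Sum.inl (translation 0 • UpperHalfPlane.I)) (Sum.inl w') = 0 →
      volume (openTriangle (Sum.inl (translation d • UpperHalfPlane.I))
        (Sum.inl (translation 0 • UpperHalfPlane.I)) (Sum.inl w')) = ENNReal.ofReal
        (triArea (translation d • UpperHalfPlane.I) (translation 0 • UpperHalfPlane.I) w') ∧
      0 ≤ triArea (translation d • UpperHalfPlane.I) (translation 0 • UpperHalfPlane.I) w' := by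
    intro h1 h2
    rw [h1, openTriangle_eq_empty h2.le]; simp
  rcases hd.eq_or_lt with rfl | hd
  · refine hzero ?_ ?_
    · rw [triArea, horArea_self, horArea_swap w']; ring
    · rw [e2]; simp
  · have hd2 : 0 < Real.exp d ^ 2 - 1 := by
      have : 1 < Real.exp d := Real.one_lt_exp_iff.2 hd
      nlinarith
    rw [e2] at h'
    have hw : 0 ≤ w'.re := nonneg_of_mul_nonneg_left h' hd2
    rcases hw.eq_or_lt with hw | hw
    · refine hzero ?_ ?_
      · simp [triArea, horArea, translation_smul_I_re, ← hw]
      · rw [e2, ← hw, zero_mul]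
    · refine ⟨volume_openTriangle_axis hd hw, ?_⟩
      have h1 : horArea (translation d • UpperHalfPlane.I) w' ≤
          horArea (translation 0 • UpperHalfPlane.I) w' := by
        unfold horArea
        rw [translation_smul_I_re, translation_smul_I_re, translation_smul_I_im,
          translation_smul_I_im, sub_zero]
        have p1 := w'.im_pos
        have p2 := Real.exp_pos (0 : ℝ)
        have p3 := Real.exp_le_exp.2 hd.le
        refine mul_le_mul_of_nonneg_left (Real.arctan_mono ?_) two_pos.le
        gcongr
      rw [triArea, horArea_translation, horArea_swap (translation d • UpperHalfPlane.I) w']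
      linarith

/-- The area of an ideal triangle. -/
lemma volume_openTriangle_ideal {X Y : ℝ} (h : X < Y) :
    volume (openTriangle (Sum.inr OnePoint.infty) (Sum.inr (X : OnePoint ℝ))
      (Sum.inr (Y : OnePoint ℝ))) = ENNReal.ofReal Real.pi := by
  let n : SL(2, ℝ) := ⟨!![1, X; 0, 1], by simp [Matrix.det_fin_two]⟩
  have hn1 : (n : GL (Fin 2) ℝ) • (OnePoint.infty : OnePoint ℝ) = OnePoint.infty := by
    rw [OnePoint.smul_infty_eq_self_iff]; rfl
  have hn (y : ℝ) : (n : GL (Fin 2) ℝ) • (y : OnePoint ℝ) = ((y + X : ℝ) : OnePoint ℝ) := by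
    rw [OnePoint.smul_some_eq_ite]
    have e00 : (n : GL (Fin 2) ℝ) 0 0 = 1 := rfl
    have e01 : (n : GL (Fin 2) ℝ) 0 1 = X := rfl
    have e10 : (n : GL (Fin 2) ℝ) 1 0 = 0 := rfl
    have e11 : (n : GL (Fin 2) ℝ) 1 1 = 1 := rfl
    rw [e00, e01, e10, e11]; simp
  have e := volume_openTriangle_smul n (Sum.inr OnePoint.infty) (Sum.inr ((0 : ℝ) : OnePoint ℝ))
    (Sum.inr ((Y - X : ℝ) : OnePoint ℝ))
  rw [smul_inr, smul_inr, smul_inr, hn1, hn, hn, zero_add, sub_add_cancel] at e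
  have hZ : 0 < Y - X := sub_pos.2 h
  rw [e, ← volume_above_ideal hZ]
  congr 1
  ext z
  simp only [openTriangle, orient, det3, modelVec_infty, modelVec_real, modelVec_inl,
    Set.mem_ofPred_eq, sqrt_lt_im_iff, Set.mem_Ioo]
  constructor
  · rintro ⟨h1, h2, h3⟩
    refine ⟨⟨by linarith, by linarith⟩, ?_⟩
    have h4 : 0 < (Y - X) * (z.im ^ 2 - z.re * (Y - X - z.re)) := by nlinarith
    exact sub_pos.1 ((mul_pos_iff_of_pos_left hZ).1 h4)
  · rintro ⟨⟨h1, h2⟩, h3⟩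
    refine ⟨by linarith, ?_, by linarith⟩
    have := mul_pos hZ (sub_pos.2 h3)
    nlinarith

/-! ### The area of a convex polygon -/

lemma measurable_chainSum_indicator (x : ClosedPlane) (L : List ClosedPlane) :
    Measurable fun z : ℍ =>
      chainSum (fun a b => (openTriangle x a b).indicator (fun _ => (1 : ℝ)) z) L := by
  induction L with
  | nil => exact measurable_const
  | cons a L ih => cases L with
    | nil => exact measurable_const
    | cons b L =>
      exact (measurable_const.indicator (measurableSet_openTriangle x a b)).add ih

lemma integral_chainSum_indicator {x : ClosedPlane} {L : List ClosedPlane}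
    (hfin : ∀ a b, [a, b].Sublist L → volume (openTriangle x a b) ≠ ⊤) :
    Integrable (fun z : ℍ =>
      chainSum (fun a b => (openTriangle x a b).indicator (fun _ => (1 : ℝ)) z) L) ∧
    ∫ z : ℍ, chainSum (fun a b => (openTriangle x a b).indicator (fun _ => (1 : ℝ)) z) L =
      chainSum (fun a b => volume.real (openTriangle x a b)) L := by
  induction L with
  | nil => simp
  | cons a L ih => cases L with
    | nil => simp
    | cons b L =>
      obtain ⟨h1, h2⟩ := ih fun c d h => hfin c d (h.cons a)
      have hi : Integrable ((openTriangle x a b).indicator fun _ => (1 : ℝ)) :=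
        (integrable_indicator_iff (measurableSet_openTriangle x a b)).2
          (integrableOn_const (hfin a b (((List.nil_sublist L).cons_cons b).cons_cons a)))
      simp only [chainSum_cons_cons]
      refine ⟨hi.add h1, ?_⟩
      rw [integral_add hi h1, h2, integral_indicator_const _ (measurableSet_openTriangle x a b),
        smul_eq_mul, mul_one]

/-- The area of a convex polygon is the sum of the areas of the triangles of its fan. -/
lemma regionArea_eq_chainSum {x : ClosedPlane} {L : List ClosedPlane}
    (hconv : OrientedConvex (x :: L))
    (hfin : ∀ a b, [a, b].Sublist L → volume (openTriangle x a b) ≠ ⊤) :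
    regionArea (x :: L) = chainSum (fun a b => volume.real (openTriangle x a b)) L := by
  have hae : (hullRegion (x :: L)).indicator (fun _ => (1 : ℝ)) =ᵐ[volume] fun z =>
      chainSum (fun a b => (openTriangle x a b).indicator (fun _ => (1 : ℝ)) z) L := by
    filter_upwards [ae_genericPoint (x :: L)] with z hz using indicator_hull hconv hz
  -- Measurability of the hull is read off from its almost everywhere description by triangles.
  have hm : NullMeasurableSet (hullRegion (x :: L)) :=
    (aemeasurable_indicator_const_iff (1 : ℝ)).1
      ((measurable_chainSum_indicator x L).aemeasurable.congr hae.symm)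
  rw [← (integral_chainSum_indicator hfin).2, ← integral_congr_ae hae, integral_indicator₀ hm,
    setIntegral_const, smul_eq_mul, mul_one]
  rfl

lemma regionArea_reverse (l : List ClosedPlane) : regionArea l.reverse = regionArea l := by
  simp [regionArea]

lemma IsAnticlockwiseConvex.orientedConvex {l : List ClosedPlane} (h : IsAnticlockwiseConvex l) :
    OrientedConvex l := by
  intro a b c habc
  by_contra hcon
  exact h a b c habc (clockwiseTriangle_of_orient_neg (not_le.1 hcon))

/-! ### Antisymmetric sums around a closed polygon. -/

section cycle

variable {X : Type*} {f : X → X → ℝ}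

lemma chainSum_reverse (hf : ∀ x y, f y x = -f x y) (l : List X) :
    chainSum f l.reverse = -chainSum f l := by
  induction l with
  | nil => simp
  | cons a l ih => cases l with
    | nil => simp
    | cons b l =>
      rw [List.reverse_cons, List.reverse_cons, List.append_assoc, List.singleton_append,
        chainSum_append, ← List.reverse_cons, ih, chainSum_cons_cons, chainSum_cons_cons,
        chainSum_singleton, hf a b]
      ring

lemma cycleSum_cons (x : X) (l : List X) : cycleSum f (x :: l) = chainSum f (x :: l ++ [x]) := rfl

lemma cycleSum_reverse (hf : ∀ x y, f y x = -f x y) (l : List X) :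
    cycleSum f l.reverse = -cycleSum f l := by
  have h0 (x : X) : f x x = 0 := by linarith [hf x x]
  rcases l with _ | ⟨a, l⟩
  · simp [cycleSum]
  rcases List.eq_nil_or_concat l with rfl | ⟨l, b, rfl⟩
  · simp [cycleSum_cons, h0]
  · have e : (a :: (l ++ [b])).reverse = b :: (l.reverse ++ [a]) := by simp
    rw [List.concat_eq_append, e, cycleSum_cons, cycleSum_cons]
    have e1 : b :: (l.reverse ++ [a]) ++ [b] = (b :: l.reverse) ++ a :: [b] := by simp
    have e2 : a :: (l ++ [b]) ++ [a] = (a :: l) ++ b :: [a] := by simp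
    have e3 := chainSum_reverse hf (a :: (l ++ [b]))
    rw [e] at e3
    rw [e1, e2, chainSum_append f (b :: l.reverse), chainSum_append f (a :: l), List.cons_append, List.cons_append, e3]
    simp [hf a b, add_comm]

/-- The boundary sum of a polygon is the sum over the triangles of its fan. -/
lemma cycleSum_eq_fan (hf : ∀ x y, f y x = -f x y) (x : X) (l : List X) :
    cycleSum f (x :: l) = chainSum (fun a b => f x a + f a b + f b x) l := by
  have h0 : f x x = 0 := by linarith [hf x x]
  cases l with
  | nil => simp [cycleSum_cons, h0]
  | cons a l =>
    rw [cycleSum_cons, List.cons_append, List.cons_append, chainSum_cons_cons,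
      ← List.cons_append]
    induction l generalizing a with
    | nil => simp [hf x a]
    | cons b l ih =>
      have := ih b
      rw [List.cons_append, List.cons_append, chainSum_cons_cons, chainSum_cons_cons,
        ← List.cons_append]
      linarith [hf x b]

end cycle

/-! ### Passage to the limit -/

/-- The points `x s` of the hyperbolic plane tend to `p` in such a way that the twists, and the
areas of the triangles with vertices in the orbit, converge. -/
structure Approximates (x : ℝ → ℍ) (p : ClosedPlane) : Prop where
  tendsto_twist (a b : PSLCover) :
    Tendsto (fun s => innerTwist a (b • x s)) atTop (𝓝 (twist a (b • p)))
  volume_ne_top (u v w : PSLCover) (h : 0 ≤ orient (u • p) (v • p) (w • p)) :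
    volume (openTriangle (u • p) (v • p) (w • p)) ≠ ⊤
  tendsto_triArea (u v w : PSLCover) (h : 0 ≤ orient (u • p) (v • p) (w • p)) :
    Tendsto (fun s => triArea (u • x s) (v • x s) (w • x s)) atTop
      (𝓝 (volume.real (openTriangle (u • p) (v • p) (w • p))))

lemma approximates_inl (y : ℍ) : Approximates (fun _ => y) (Sum.inl y) where
  tendsto_twist a b := tendsto_const_nhds
  volume_ne_top u v w h := by
    rw [cover_smul_inl, cover_smul_inl, cover_smul_inl] at h ⊢
    rw [(volume_openTriangle_inl h).1]
    exact ENNReal.ofReal_ne_top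
  tendsto_triArea u v w h := by
    rw [cover_smul_inl, cover_smul_inl, cover_smul_inl] at h ⊢
    obtain ⟨h1, h2⟩ := volume_openTriangle_inl h
    rw [measureReal_def, h1, ENNReal.toReal_ofReal h2]
    exact tendsto_const_nhds

lemma smul_infty_of_ne {g : SL(2, ℝ)} (h : g 1 0 ≠ 0) :
    (g : GL (Fin 2) ℝ) • (OnePoint.infty : OnePoint ℝ) = ((g 0 0 / g 1 0 : ℝ) : OnePoint ℝ) := by
  rw [OnePoint.smul_infty_eq_ite]
  exact if_neg h

/-- Convergence of the areas of triangles to the area of an ideal triangle. -/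
lemma ideal_triangle (g₁ g₂ g₃ : SL(2, ℝ))
    (h : 0 ≤ orient (g₁ • (Sum.inr OnePoint.infty : ClosedPlane)) (g₂ • Sum.inr OnePoint.infty)
      (g₃ • Sum.inr OnePoint.infty)) :
    volume (openTriangle (g₁ • (Sum.inr OnePoint.infty : ClosedPlane))
      (g₂ • Sum.inr OnePoint.infty) (g₃ • Sum.inr OnePoint.infty)) ≠ ⊤ ∧
    Tendsto (fun s : ℝ => triArea (g₁ • translation s • UpperHalfPlane.I)
      (g₂ • translation s • UpperHalfPlane.I) (g₃ • translation s • UpperHalfPlane.I)) atTop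
      (𝓝 (volume.real (openTriangle (g₁ • (Sum.inr OnePoint.infty : ClosedPlane))
      (g₂ • Sum.inr OnePoint.infty) (g₃ • Sum.inr OnePoint.infty)))) := by
  set P : ClosedPlane := Sum.inr OnePoint.infty with hP
  -- After `g₁⁻¹` the first vertex is `∞`. Either two vertices coincide and the triangle is empty,
  -- or the others are finite and the orientation is the difference of their coordinates.
  have e2 : g₂ • P = g₁ • (g₁⁻¹ * g₂) • P := by rw [mul_smul, smul_inv_smul]
  have e3 : g₃ • P = g₁ • (g₁⁻¹ * g₃) • P := by rw [mul_smul, smul_inv_smul]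
  have hdeg (h0 : orient (g₁ • P) (g₂ • P) (g₃ • P) ≤ 0)
      (h1 : (g₁⁻¹ * g₂) 1 0 = 0 ∨ (g₁⁻¹ * g₃) 1 0 = 0 ∨
      (g₁⁻¹ * g₂) 0 0 / (g₁⁻¹ * g₂) 1 0 = (g₁⁻¹ * g₃) 0 0 / (g₁⁻¹ * g₃) 1 0) :
      volume (openTriangle (g₁ • P) (g₂ • P) (g₃ • P)) ≠ ⊤ ∧
      Tendsto (fun s : ℝ => triArea (g₁ • translation s • UpperHalfPlane.I)
      (g₂ • translation s • UpperHalfPlane.I) (g₃ • translation s • UpperHalfPlane.I)) atTop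
      (𝓝 (volume.real (openTriangle (g₁ • P) (g₂ • P) (g₃ • P)))) := by
    rw [openTriangle_eq_empty h0]
    simpa using tendsto_triArea_zero h1
  have hfix {k : SL(2, ℝ)} (hk : k 1 0 = 0) : k • P = P := by
    rw [hP, smul_inr, smul_infty_eq_iff.2 hk]
  by_cases c2 : (g₁⁻¹ * g₂) 1 0 = 0
  · refine hdeg ?_ (Or.inl c2)
    rw [e2, hfix c2, ← orient_rotate, orient_self']
  by_cases c3 : (g₁⁻¹ * g₃) 1 0 = 0
  · refine hdeg ?_ (Or.inr (Or.inl c3))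
    rw [e3, hfix c3, orient_self']
  have f2 : (g₁⁻¹ * g₂) • P = Sum.inr _ := congrArg Sum.inr (smul_infty_of_ne c2)
  have f3 : (g₁⁻¹ * g₃) • P = Sum.inr _ := congrArg Sum.inr (smul_infty_of_ne c3)
  rw [f2] at e2
  rw [f3] at e3
  obtain ⟨k, hk, e⟩ := orient_smul g₁ P (Sum.inr
    (((g₁⁻¹ * g₂) 0 0 / (g₁⁻¹ * g₂) 1 0 : ℝ) : OnePoint ℝ)) (Sum.inr
    (((g₁⁻¹ * g₃) 0 0 / (g₁⁻¹ * g₃) 1 0 : ℝ) : OnePoint ℝ))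
  rw [← e2, ← e3] at e
  have e4 : orient P (Sum.inr (((g₁⁻¹ * g₂) 0 0 / (g₁⁻¹ * g₂) 1 0 : ℝ) : OnePoint ℝ)) (Sum.inr
    (((g₁⁻¹ * g₃) 0 0 / (g₁⁻¹ * g₃) 1 0 : ℝ) : OnePoint ℝ)) =
      (g₁⁻¹ * g₃) 0 0 / (g₁⁻¹ * g₃) 1 0 - (g₁⁻¹ * g₂) 0 0 / (g₁⁻¹ * g₂) 1 0 := by
    simp only [hP, orient, det3, modelVec_infty, modelVec_real]
    ring
  rw [e4] at e
  have hle := e ▸ mul_nonneg hk.le h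
  rcases hle.eq_or_lt with h0 | h0
  · refine hdeg ?_ (Or.inr (Or.inr (by linarith)))
    rw [← h0] at e
    exact ((mul_eq_zero.1 e.symm).resolve_left hk.ne').le
  · have hv := volume_openTriangle_ideal (sub_pos.1 h0)
    rw [← volume_openTriangle_smul g₁, ← hP, ← e2, ← e3] at hv
    rw [measureReal_def, hv, ENNReal.toReal_ofReal Real.pi_pos.le]
    exact ⟨ENNReal.ofReal_ne_top, tendsto_triArea_pi c2 c3 (sub_pos.1 h0)⟩

lemma approximates_inr {g : SL(2, ℝ)} {ξ : OnePoint ℝ}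
    (hg : (g : GL (Fin 2) ℝ) • OnePoint.infty = ξ) :
    Approximates (fun s => g • translation s • UpperHalfPlane.I) (Sum.inr ξ) := by
  have e (u : PSLCover) : u • (Sum.inr ξ : ClosedPlane) =
      (UniversalCover.proj u * g) • (Sum.inr OnePoint.infty : ClosedPlane) := by
    rw [mul_smul, smul_inr, hg]; rfl
  have e' (u : PSLCover) (s : ℝ) : u • g • translation s • UpperHalfPlane.I =
      (UniversalCover.proj u * g) • translation s • UpperHalfPlane.I := by
    rw [mul_smul]; rfl
  refine ⟨fun a b => ?_, fun u v w h => ?_, fun u v w h => ?_⟩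
  · simp only [e, e', smul_inr]
    exact tendsto_idealTwist a rfl
  · rw [e, e, e] at h ⊢
    exact (ideal_triangle _ _ _ h).1
  · simp only [e, e'] at h ⊢
    exact (ideal_triangle _ _ _ h).2

lemma exists_approximates (p : ClosedPlane) : ∃ x, Approximates x p := by
  rcases p with y | ξ
  · exact ⟨_, approximates_inl y⟩
  · obtain ⟨θ, h⟩ := exists_smul_infty ξ
    exact ⟨_, approximates_inr h⟩

lemma tendsto_chainSum {X : Type*} {f : ℝ → X → X → ℝ} {F : X → X → ℝ} {l : List X}
    (h : ∀ a b, [a, b].Sublist l → Tendsto (fun s => f s a b) atTop (𝓝 (F a b))) :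
    Tendsto (fun s => chainSum (f s) l) atTop (𝓝 (chainSum F l)) := by
  induction l with
  | nil => exact tendsto_const_nhds
  | cons a l ih => cases l with
    | nil => exact tendsto_const_nhds
    | cons b l =>
      exact (h a b (((List.nil_sublist l).cons_cons b).cons_cons a)).add
        (ih fun c d hcd => h c d (hcd.cons a))

lemma Approximates.tendsto_cycleSum {x : ℝ → ℍ} {p : ClosedPlane} (hx : Approximates x p)
    {W : List PSLCover} (hW : W ≠ []) (hconv : OrientedConvex (W.map (· • p))) :
    Tendsto (fun s => cycleSum (fun v w : PSLCover => horArea (v • x s) (w • x s)) W) atTop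
      (𝓝 (regionArea (W.map (· • p)))) := by
  obtain ⟨u, W, rfl⟩ := List.exists_cons_of_ne_nil hW
  have hor : ∀ a b, [a, b].Sublist W → 0 ≤ orient (u • p) (a • p) (b • p) := fun a b h =>
    hconv _ _ _ ((h.cons_cons u).map (· • p))
  rw [List.map_cons] at hconv ⊢
  rw [regionArea_eq_chainSum hconv, chainSum_map]
  · simp_rw [cycleSum_eq_fan (fun v w : PSLCover => horArea_swap (v • x _) (w • x _))]
    exact tendsto_chainSum fun a b h => hx.tendsto_triArea u a b (hor a b h)
  · intro a b h
    obtain ⟨l, hl, e⟩ := List.sublist_map_iff.1 h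
    match l, e, hl with
    | [v, w], e, hl =>
      simp only [List.map_cons, List.map_nil, List.cons.injEq, and_true] at e
      rw [e.1, e.2]
      exact hx.volume_ne_top u v w (hor v w hl)

/-- Reversing the list changes the sign of the edge sum and keeps the hull, which reduces the
clockwise case to the anticlockwise one. -/
lemma Approximates.tendsto_cycleSum_signedArea {x : ℝ → ℍ} {p : ClosedPlane}
    (hx : Approximates x p) {W : List PSLCover} (hW : W ≠ [])
    (hconv : IsConvexPolygon (W.map (· • p))) :
    Tendsto (fun s => cycleSum (fun v w : PSLCover => horArea (v • x s) (w • x s)) W) atTop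
      (𝓝 (signedArea (W.map (· • p)))) := by
  by_cases h : IsAnticlockwiseConvex (W.map (· • p))
  · rw [signedArea, if_pos h]
    exact hx.tendsto_cycleSum hW h.orientedConvex
  · have h' := (hconv.resolve_left h).orientedConvex
    rw [← List.map_reverse] at h'
    have := (hx.tendsto_cycleSum (mt List.reverse_eq_nil_iff.1 hW) h').neg
    rw [List.map_reverse, regionArea_reverse] at this
    rw [signedArea, if_neg h]
    refine this.congr fun s => ?_
    rw [cycleSum_reverse (fun v w : PSLCover => horArea_swap (v • x s) (w • x s)), neg_neg]

end

/-! ### The twist formula. -/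

theorem mainTheorem10 {g n : ℕ} (α β : Fin g → PSLCover) (γ : Fin n → PSLCover) (p : ClosedPlane)
    (hconvex : IsConvexPolygon (relatorPolygon α β γ p)) :
    twist ((List.ofFn fun i => ⁅α i, β i⁆).prod * (List.ofFn γ).prod) p =
      ∑ j : Fin n, twist (γ j) (tailProd γ ((j : ℕ) + 1) • p) +
        signedArea (relatorPolygon α β γ p) := by
  obtain ⟨x, hx⟩ := exists_approximates p
  rw [relatorPolygon_eq] at hconvex ⊢
  have hl := hx.tendsto_twist ((List.ofFn fun i => ⁅α i, β i⁆).prod * (List.ofFn γ).prod) 1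
  rw [one_smul] at hl
  -- The exact identity `cycleSum_relatorWords` holds at every `x s`, and each of its terms
  -- converges to the corresponding term at `p`.
  refine tendsto_nhds_unique hl (Tendsto.congr (fun s => ?_)
    ((tendsto_finsetSum _ fun j _ => hx.tendsto_twist (γ j) (tailProd γ ((j : ℕ) + 1))).add
      (hx.tendsto_cycleSum_signedArea (by simp [relatorWords]) hconvex)))
  rw [one_smul, ← tailTwist_ofFn, ← cycleSum_relatorWords, List.map_ofFn]
  rfl
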